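/- For a permutation $\pi\in S_n$, a peak is a position $i$ with $1<i<n$ and $\pi(i-1)<\pi(i)>\pi(i+1)$; let $p(\pi)$ be the number of peaks of $\pi$. For each $n\ge 1$ let $C_n$ be a conjugacy class of $S_n$, and let $\alpha_1(C_n)$ be the fraction of fixed points of each element of $C_n$, i.e. the number of its fixed points divided by $n$. Suppose that $\alpha_1(C_n)\to\alpha$ as $n\to\infty$ for some $\alpha\in[0,1]$, and that $\pi_n$ is chosen uniformly at random from $C_n$. Then, as $n\to\infty$, \[ \frac{p(\pi_n)-\frac{1-\alpha_1(C_n)^3}{3}\,n}{\sqrt n} \quad\text{converges in distribution to}\quad \mathcal N\!\left(0,\ \tfrac{2}{45}+\tfrac19\alpha^3-\tfrac35\alpha^5+\tfrac49\alpha^6\right), \] where $\mathcal N(0,0)$ denotes the point mass at $0$ (the case $\alpha=1$). -/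

import Mathlib

open MeasureTheory ProbabilityTheory Filter

/-- The finite set `S_n` carries the discrete σ-algebra. -/
instance instMeasurableSpacePermFin (n : ℕ) : MeasurableSpace (Equiv.Perm (Fin n)) := ⊤

/-- The number of peaks of `π`: positions `i` that have both a left neighbour `a` and a right
neighbour `b`, with `π a < π i > π b`. -/
def peaks {n : ℕ} (π : Equiv.Perm (Fin n)) : ℕ :=
  (Finset.univ.filter fun i : Fin n =>
    ∃ a b : Fin n, (a : ℕ) + 1 = i ∧ (i : ℕ) + 1 = b ∧ π a < π i ∧ π b < π i).card

/-- The number of fixed points of a permutation. -/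
def numFixedPoints {n : ℕ} (π : Equiv.Perm (Fin n)) : ℕ :=
  (Finset.univ.filter fun i : Fin n => π i = i).card

theorem numFixedPoints_eq_of_isConj {n : ℕ} {σ τ : Equiv.Perm (Fin n)} (h : IsConj σ τ) :
    numFixedPoints σ = numFixedPoints τ := by
  obtain ⟨c, rfl⟩ := isConj_iff.1 h
  refine Finset.card_bij (fun i _ => c i) ?_ ?_ ?_
  · intro i hi
    have h' : σ i = i := (Finset.mem_filter.1 hi).2
    exact Finset.mem_filter.2 ⟨Finset.mem_univ _, by simp [h']⟩
  · intro i _ j _ hij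
    exact c.injective hij
  · intro j hj
    have h' : (c * σ * c⁻¹) j = j := (Finset.mem_filter.1 hj).2
    refine ⟨c⁻¹ j, Finset.mem_filter.2 ⟨Finset.mem_univ _, ?_⟩, by simp⟩
    exact c.injective (by simpa using h')

/-- The common number of fixed points of the elements of a conjugacy class. -/
def classFixedPoints {n : ℕ} (C : ConjClasses (Equiv.Perm (Fin n))) : ℕ :=
  Quotient.lift numFixedPoints (fun _ _ h => numFixedPoints_eq_of_isConj h) C

/-- The fraction `α₁(C)` of fixed points of each element of a conjugacy class `C` of `S_n`. -/
noncomputable def fixedPointDensity {n : ℕ} (C : ConjClasses (Equiv.Perm (Fin n))) : ℝ :=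
  (classFixedPoints C : ℝ) / n

/-- The limiting variance as a function of the limiting density of fixed points. -/
noncomputable def peakVariance (α : ℝ) : ℝ :=
  2 / 45 + α ^ 3 / 9 - 3 / 5 * α ^ 5 + 4 / 9 * α ^ 6

theorem peakVariance_nonneg {α : ℝ} (hα : α ∈ Set.Icc (0 : ℝ) 1) : 0 ≤ peakVariance α := by
  obtain ⟨h0, h1⟩ := hα
  have h : peakVariance α =
      (1 - α) ^ 2 * (2 + 4 * α + 6 * α ^ 2 + 13 * α ^ 3 + 20 * α ^ 4) / 45 := by
    unfold peakVariance
    ring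
  rw [h]
  positivity

/-- The limiting variance as a nonnegative real, for a density in `[0, 1]`. -/
noncomputable def peakVarianceNN (α : ℝ) (hα : α ∈ Set.Icc (0 : ℝ) 1) : NNReal :=
  ⟨peakVariance α, peakVariance_nonneg hα⟩

/-!
Label `n` points by `2 a` letters, and order pairs (label, rank) lexicographically with ties broken
upwards or downwards according to the parity of the letter. The number of labellings compatible
with a permutation `π` then depends on `π` only through its number of peaks: after multiplication by
`n! / (2 a) ^ n` it is an explicit binomial average, the label ratio of `π`.

Averaging over a conjugacy class amounts to fixing one permutation `τ` and taking a uniformly random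
ranking of the points, so the average of the label ratio is the expected number of rankings
compatible with `τ` and uniformly random labels. Two such rankings with the same order on the fixed
points of `τ` differ by a permutation commuting with `τ` and preserving the labels; conversely, if
no point moved by `τ` shares its label with another point while their images share theirs as well,
then every compatible ranking of the fixed points extends. Both exceptions are rare, so the moved
points only contribute a factor `1 + O(n / a)`, and the average is close to the label ratio of the
identity on the fixed points.

When `a` is of order `n ^ (5 / 4)`, both label ratios become exponentials of polynomials in the
number of peaks and the number of fixed points. Comparing them yields the Laplace transform of the
normalized number of peaks at a point converging to any prescribed `θ < 0`, up to a bounded tilt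
that concentrates and can therefore be removed. Laplace transforms are convex, so convergence along
perturbed points implies pointwise convergence on `(-∞, 0)`, and the continuity theorem for Laplace
transforms on a half line concludes.
-/

section ConvexConvergence

open scoped Topology

variable {ι : Type*} {l : Filter ι} {S : Set ℝ} {f : ι → ℝ → ℝ} {g : ℝ → ℝ}

theorem eventually_lt_of_convexOn_of_tendsto_perturbed (hS : IsOpen S)
    (hf : ∀ n, ConvexOn ℝ S (f n)) (hg : ContinuousOn g S)
    (h : ∀ x ∈ S, ∃ s : ι → ℝ, Tendsto s l (𝓝 x) ∧ Tendsto (fun n => f n (s n)) l (𝓝 (g x)))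
    {x c : ℝ} (hx : x ∈ S) (hc : g x < c) {t : ι → ℝ} (ht : Tendsto t l (𝓝 x)) :
    ∀ᶠ n in l, f n (t n) < c := by
  have hnhds : ∀ᶠ y in 𝓝 x, y ∈ S ∧ g y < c :=
    (hS.eventually_mem hx).and ((hg.continuousAt (hS.mem_nhds hx)).eventually_lt_const hc)
  obtain ⟨a, ⟨haS, hga⟩, hax⟩ :=
    ((hnhds.filter_mono nhdsWithin_le_nhds).and (self_mem_nhdsWithin (s := Set.Iio x))).exists
  obtain ⟨b, ⟨hbS, hgb⟩, hxb⟩ :=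
    ((hnhds.filter_mono nhdsWithin_le_nhds).and (self_mem_nhdsWithin (s := Set.Ioi x))).exists
  obtain ⟨sa, hsa, hfa⟩ := h a haS
  obtain ⟨sb, hsb, hfb⟩ := h b hbS
  filter_upwards [hsa.eventually_lt ht hax, ht.eventually_lt hsb hxb, hsa (hS.mem_nhds haS),
    hsb (hS.mem_nhds hbS), hfa.eventually_lt_const hga, hfb.eventually_lt_const hgb]
    with n hat htb haS hbS hfa hfb
  exact ((hf n).le_max_of_mem_Icc haS hbS ⟨hat.le, htb.le⟩).trans_lt (max_lt hfa hfb)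

theorem tendsto_of_convexOn_of_tendsto_perturbed (hS : IsOpen S)
    (hf : ∀ n, ConvexOn ℝ S (f n)) (hg : ContinuousOn g S)
    (h : ∀ x ∈ S, ∃ s : ι → ℝ, Tendsto s l (𝓝 x) ∧ Tendsto (fun n => f n (s n)) l (𝓝 (g x)))
    {x : ℝ} (hx : x ∈ S) : Tendsto (fun n => f n x) l (𝓝 (g x)) := by
  refine tendsto_order.2 ⟨fun c hc => ?_, fun c hc =>
    eventually_lt_of_convexOn_of_tendsto_perturbed hS hf hg h hx hc tendsto_const_nhds⟩
  obtain ⟨s, hs, hfs⟩ := h x hx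
  -- The upper bound applies to the reflection `2 * s n - x` of `x` in `s n`.
  have hreflect : Tendsto (fun n => 2 * s n - x) l (𝓝 x) := by
    convert (hs.const_mul 2).sub_const x using 2; ring
  filter_upwards [hreflect (hS.mem_nhds hx),
    hfs.eventually_const_lt (show g x - (g x - c) / 3 < g x by linarith),
    eventually_lt_of_convexOn_of_tendsto_perturbed hS hf hg h hx
      (show g x < g x + (g x - c) / 3 by linarith) hreflect] with n hmem hlow hup
  have hmid : f n (s n) ≤ 1 / 2 * f n x + 1 / 2 * f n (2 * s n - x) := by
    have := (hf n).2 hx hmem (by norm_num : (0 : ℝ) ≤ 1 / 2) (by norm_num : (0 : ℝ) ≤ 1 / 2)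
      (by norm_num)
    simp only [smul_eq_mul] at this
    rwa [show 1 / 2 * x + 1 / 2 * (2 * s n - x) = s n by ring] at this
  linarith

end ConvexConvergence

section MomentGenerating

open scoped Topology

theorem convexOn_mgf {Ω : Type*} [MeasurableSpace Ω] {μ : Measure Ω} {X : Ω → ℝ} :
    ConvexOn ℝ (integrableExpSet X μ) (mgf X μ) := by
  refine ⟨convex_integrableExpSet, fun s hs t ht a b ha hb hab => ?_⟩
  have hst : a • s + b • t ∈ integrableExpSet X μ := convex_integrableExpSet hs ht ha hb hab
  simp only [mgf, smul_eq_mul] at hst ⊢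
  rw [← integral_const_mul, ← integral_const_mul,
    ← integral_add (hs.const_mul a) (ht.const_mul b)]
  refine integral_mono hst ((hs.const_mul a).add (ht.const_mul b)) fun ω => ?_
  have := convexOn_exp.2 (Set.mem_univ (s * X ω)) (Set.mem_univ (t * X ω)) ha hb hab
  simp only [smul_eq_mul] at this
  convert this using 2
  ring

theorem exp_mul_le_one_add_exp_mul {s θ x : ℝ} (hs : s ≤ θ) (hθ : θ ≤ 0) :
    Real.exp (θ * x) ≤ 1 + Real.exp (s * x) := by
  rcases le_total 0 x with hx | hx
  · have : Real.exp (θ * x) ≤ 1 :=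
      Real.exp_le_one_iff.2 (mul_nonpos_of_nonpos_of_nonneg hθ hx)
    linarith [Real.exp_pos (s * x)]
  · have : Real.exp (θ * x) ≤ Real.exp (s * x) :=
      Real.exp_le_exp.2 (mul_le_mul_of_nonpos_right hs hx)
    linarith

variable {μ ν : Measure ℝ}

theorem tendsto_complexMGF_left_of_imaginary_axis [IsFiniteMeasure μ]
    (hμ : Set.Iio 0 ⊆ integrableExpSet id μ) (t : ℝ) :
    Tendsto (fun θ : ℝ => complexMGF id μ (θ + t * Complex.I)) (𝓝[<] 0) (𝓝 (charFun μ t)) := by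
  rw [← complexMGF_id_mul_I]
  refine tendsto_integral_filter_of_dominated_convergence (fun x => 1 + Real.exp (-1 * x))
    (Eventually.of_forall fun θ => by fun_prop) ?_
    ((integrable_const 1).add (hμ (by simp : (-1 : ℝ) ∈ Set.Iio 0)))
    (Eventually.of_forall fun x => ?_)
  · filter_upwards [Ioo_mem_nhdsLT (show (-1 : ℝ) < 0 by norm_num)] with θ hθ
    refine Eventually.of_forall fun x => ?_
    rw [Complex.norm_exp]
    simpa using exp_mul_le_one_add_exp_mul (x := x) hθ.1.le hθ.2.le
  · have : Continuous fun θ : ℝ => Complex.exp ((θ + t * Complex.I) * x) := by fun_prop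
    simpa using (this.tendsto 0).mono_left nhdsWithin_le_nhds

theorem tendsto_mgf_nhdsLT_zero [IsProbabilityMeasure μ]
    (hμ : Set.Iio 0 ⊆ integrableExpSet id μ) :
    Tendsto (mgf id μ) (𝓝[<] 0) (𝓝 1) := by
  have := tendsto_complexMGF_left_of_imaginary_axis hμ 0
  simp only [Complex.ofReal_zero, zero_mul, add_zero, complexMGF_ofReal, charFun_zero,
    probReal_univ] at this
  exact tendsto_ofReal_iff.1 (by exact_mod_cast this)

theorem analyticOnNhd_complexMGF_of_Iio_subset (hμ : Set.Iio 0 ⊆ integrableExpSet id μ) :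
    AnalyticOnNhd ℂ (complexMGF id μ) {z | z.re < 0} :=
  analyticOnNhd_complexMGF.mono fun _ hz => interior_mono hμ (by simpa using hz)

theorem eqOn_complexMGF_of_eqOn_mgf_Iio (hμ : Set.Iio 0 ⊆ integrableExpSet id μ)
    (hν : Set.Iio 0 ⊆ integrableExpSet id ν) (h : Set.EqOn (mgf id μ) (mgf id ν) (Set.Iio 0)) :
    Set.EqOn (complexMGF id μ) (complexMGF id ν) {z | z.re < 0} := by
  have hpre : IsPreconnected {z : ℂ | z.re < 0} :=
    ((convex_Iio (0 : ℝ)).linear_preimage Complex.reLm).isPreconnected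
  refine (analyticOnNhd_complexMGF_of_Iio_subset hμ).eqOn_of_preconnected_of_frequently_eq
    (analyticOnNhd_complexMGF_of_Iio_subset hν) hpre (z₀ := ((-1 : ℝ) : ℂ)) (by simp) ?_
  have hofReal : Tendsto ((↑) : ℝ → ℂ) (𝓝[≠] (-1)) (𝓝[≠] ((-1 : ℝ) : ℂ)) :=
    Complex.continuous_ofReal.continuousWithinAt.tendsto_nhdsWithin fun x hx => by
      simpa using! fun h => hx (by exact_mod_cast h)
  refine hofReal.frequently (Eventually.frequently ?_)
  filter_upwards [nhdsWithin_le_nhds (Iio_mem_nhds (show (-1 : ℝ) < 0 by norm_num))] with x hx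
  rw [complexMGF_ofReal, complexMGF_ofReal, h hx]

theorem measure_eq_of_eqOn_mgf_Iio [IsFiniteMeasure μ] [IsFiniteMeasure ν]
    (hμ : Set.Iio 0 ⊆ integrableExpSet id μ) (hν : Set.Iio 0 ⊆ integrableExpSet id ν)
    (h : Set.EqOn (mgf id μ) (mgf id ν) (Set.Iio 0)) : μ = ν := by
  refine Measure.ext_of_charFun (funext fun t => ?_)
  refine tendsto_nhds_unique (tendsto_complexMGF_left_of_imaginary_axis hμ t)
    ((tendsto_complexMGF_left_of_imaginary_axis hν t).congr' ?_)
  filter_upwards [self_mem_nhdsWithin] with θ hθ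
  exact (eqOn_complexMGF_of_eqOn_mgf_Iio hμ hν h (by simpa using hθ)).symm

theorem integrable_exp_mul_sub_one_sq [IsProbabilityMeasure μ] {θ : ℝ}
    (h1 : θ ∈ integrableExpSet id μ) (h2 : 2 * θ ∈ integrableExpSet id μ) :
    Integrable (fun x => (Real.exp (θ * x) - 1) ^ 2) μ ∧
      ∫ x, (Real.exp (θ * x) - 1) ^ 2 ∂μ = mgf id μ (2 * θ) - 2 * mgf id μ θ + 1 := by
  have hexpand : (fun x : ℝ => (Real.exp (θ * x) - 1) ^ 2) =
      fun x => Real.exp (2 * θ * x) - 2 * Real.exp (θ * x) + 1 := by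
    funext x
    rw [mul_assoc, two_mul (θ * x), Real.exp_add]
    ring
  have h1 : Integrable (fun x => 2 * Real.exp (θ * x)) μ := Integrable.const_mul h1 2
  have h2 : Integrable (fun x => Real.exp (2 * θ * x)) μ := h2
  have hdiff : Integrable (fun x => Real.exp (2 * θ * x) - 2 * Real.exp (θ * x)) μ := h2.sub h1
  rw [hexpand]
  refine ⟨hdiff.add (integrable_const 1), ?_⟩
  rw [integral_add hdiff (integrable_const 1), integral_sub h2 h1, integral_const_mul]
  simp [mgf]

theorem quarter_le_exp_mul_sub_one_sq {θ x : ℝ} (hx : 1 ≤ |θ * x|) :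
    1 / 4 ≤ (Real.exp (θ * x) - 1) ^ 2 := by
  have he : (2 : ℝ) ≤ Real.exp 1 := by linarith [Real.add_one_le_exp 1]
  rcases le_abs'.1 hx with h | h
  · have h1 : Real.exp (θ * x) ≤ Real.exp (-1) := Real.exp_le_exp.2 h
    have h2 : Real.exp (-1) ≤ 1 / 2 := by
      rw [Real.exp_neg, inv_eq_one_div]
      exact one_div_le_one_div_of_le (by norm_num) he
    nlinarith
  · have h1 : Real.exp 1 ≤ Real.exp (θ * x) := Real.exp_le_exp.2 h
    nlinarith

theorem measureReal_norm_gt_le_mgf [IsProbabilityMeasure μ] {θ r : ℝ} (hr : 1 ≤ r * |θ|)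
    (h1 : θ ∈ integrableExpSet id μ) (h2 : 2 * θ ∈ integrableExpSet id μ) :
    μ.real {x | r < ‖x‖} ≤ 4 * (mgf id μ (2 * θ) - 2 * mgf id μ θ + 1) := by
  obtain ⟨hInt, heq⟩ := integrable_exp_mul_sub_one_sq h1 h2
  have hsub : {x : ℝ | r < ‖x‖} ⊆ {x | 1 / 4 ≤ (Real.exp (θ * x) - 1) ^ 2} := fun x hx => by
    refine quarter_le_exp_mul_sub_one_sq (hr.trans ?_)
    rw [abs_mul, mul_comm]
    exact mul_le_mul_of_nonneg_left (le_of_lt hx) (abs_nonneg θ)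
  have hmarkov := mul_meas_ge_le_integral_of_nonneg
    (Eventually.of_forall fun x => sq_nonneg (Real.exp (θ * x) - 1)) hInt (1 / 4)
  linarith [measureReal_mono (μ := μ) hsub]

theorem isTightMeasureSet_range_of_tendsto_mgf_Iio {μ : ℕ → Measure ℝ}
    [∀ n, IsProbabilityMeasure (μ n)] {m : ℝ → ℝ}
    (hμ : ∀ n, Set.Iio 0 ⊆ integrableExpSet id (μ n)) (hm : Tendsto m (𝓝[<] 0) (𝓝 1))
    (h : ∀ θ < 0, Tendsto (fun n => mgf id (μ n) θ) atTop (𝓝 (m θ))) :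
    IsTightMeasureSet (Set.range μ) := by
  refine isTightMeasureSet_range_of_tendsto_limsup_measure_norm_gt
    (ENNReal.tendsto_nhds_zero.2 fun ε hε => ?_)
  obtain ⟨δ, -, hδ0, hδε⟩ := ENNReal.lt_iff_exists_real_btwn.1 hε
  have hdouble : Tendsto (fun θ : ℝ => 2 * θ) (𝓝[<] 0) (𝓝[<] 0) := by
    refine tendsto_nhdsWithin_iff.2 ⟨?_, ?_⟩
    · simpa using ((continuous_const_mul (2 : ℝ)).tendsto 0).mono_left nhdsWithin_le_nhds
    · filter_upwards [self_mem_nhdsWithin] with θ hθ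
      exact mul_neg_of_pos_of_neg two_pos (Set.mem_Iio.1 hθ)
  have hbound : Tendsto (fun θ => 4 * (m (2 * θ) - 2 * m θ + 1)) (𝓝[<] 0) (𝓝 0) := by
    have := (((hm.comp hdouble).sub (hm.const_mul 2)).add_const 1).const_mul 4
    norm_num at this
    exact this
  obtain ⟨θ, hθδ, hθ⟩ : ∃ θ, 4 * (m (2 * θ) - 2 * m θ + 1) < δ ∧ θ < 0 :=
    ((hbound.eventually_lt_const (ENNReal.ofReal_pos.1 hδ0)).and self_mem_nhdsWithin).exists
  have hθ2 : 2 * θ < 0 := mul_neg_of_pos_of_neg two_pos hθ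
  have hlim : Tendsto (fun n => 4 * (mgf id (μ n) (2 * θ) - 2 * mgf id (μ n) θ + 1)) atTop
      (𝓝 (4 * (m (2 * θ) - 2 * m θ + 1))) :=
    (((h _ hθ2).sub ((h θ hθ).const_mul 2)).add_const 1).const_mul 4
  filter_upwards [eventually_ge_atTop (1 / |θ|)] with r hr
  refine (limsup_le_of_le (a := ENNReal.ofReal δ) (by isBoundedDefault) ?_).trans hδε.le
  filter_upwards [hlim.eventually_lt_const hθδ] with n hn
  rw [← ofReal_measureReal]
  exact ENNReal.ofReal_le_ofReal ((measureReal_norm_gt_le_mgf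
    ((div_le_iff₀ (abs_pos.2 hθ.ne)).1 hr) (hμ n hθ) (hμ n hθ2)).trans hn.le)

end MomentGenerating

section UniformIntegrability

open scoped Topology

variable {Ω : Type*} [TopologicalSpace Ω] [MeasurableSpace Ω] [OpensMeasurableSpace Ω]
  {ν : ℕ → ProbabilityMeasure Ω} {ν₀ : ProbabilityMeasure Ω} {f : Ω → ℝ} {K : ℝ}

theorem integrable_of_tendsto_of_integral_le [HasOuterApproxClosed Ω]
    (hν : Tendsto ν atTop (𝓝 ν₀)) (hf : Continuous f) (hf0 : 0 ≤ f)
    (hInt : ∀ n, Integrable f (ν n : Measure Ω)) (hK : ∀ n, ∫ x, f x ∂(ν n : Measure Ω) ≤ K) :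
    Integrable f (ν₀ : Measure Ω) ∧ ∫ x, f x ∂(ν₀ : Measure Ω) ≤ K := by
  have hfatou : ∫⁻ x, ENNReal.ofReal (f x) ∂(ν₀ : Measure Ω) ≤ ENNReal.ofReal K := by
    refine (lintegral_le_liminf_lintegral_of_forall_isOpen_measure_le_liminf_measure hf hf0
      fun G hG => ProbabilityMeasure.le_liminf_measure_open_of_tendsto hν hG).trans ?_
    refine liminf_le_of_le (by isBoundedDefault) fun b hb => ?_
    obtain ⟨n, hn⟩ := hb.exists
    refine hn.trans ?_
    rw [← ofReal_integral_eq_lintegral_ofReal (hInt n) (Eventually.of_forall hf0)]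
    exact ENNReal.ofReal_le_ofReal (hK n)
  have hK0 : 0 ≤ K := (integral_nonneg hf0).trans (hK 0)
  refine ⟨⟨hf.aestronglyMeasurable, ?_⟩, ?_⟩
  · rw [hasFiniteIntegral_iff_ofReal (Eventually.of_forall hf0)]
    exact hfatou.trans_lt ENNReal.ofReal_lt_top
  · rw [integral_eq_lintegral_of_nonneg_ae (Eventually.of_forall hf0) hf.aestronglyMeasurable]
    exact ENNReal.toReal_le_of_le_ofReal hK0 hfatou

theorem integrable_min_const {μ : Measure Ω} [IsFiniteMeasure μ] (hf : Continuous f) (hf0 : 0 ≤ f)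
    {B : ℝ} (hB : 0 ≤ B) : Integrable (fun x => min (f x) B) μ := by
  refine (integrable_const B).mono' (by fun_prop) (Eventually.of_forall fun x => ?_)
  rw [Real.norm_of_nonneg (le_min (hf0 x) hB)]
  exact min_le_right _ _

theorem tendsto_integral_min_const (hν : Tendsto ν atTop (𝓝 ν₀)) (hf : Continuous f)
    (hf0 : 0 ≤ f) {B : ℝ} (hB : 0 ≤ B) :
    Tendsto (fun n => ∫ x, min (f x) B ∂(ν n : Measure Ω)) atTop
      (𝓝 (∫ x, min (f x) B ∂(ν₀ : Measure Ω))) := by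
  refine ProbabilityMeasure.tendsto_iff_forall_integral_tendsto.1 hν
    (BoundedContinuousFunction.ofNormedAddCommGroup (fun x => min (f x) B) (by fun_prop) B
      fun x => ?_)
  rw [Real.norm_of_nonneg (le_min (hf0 x) hB)]
  exact min_le_right _ _

theorem dist_integral_integral_min_const_le {μ : Measure Ω} [IsFiniteMeasure μ]
    (hf : Continuous f) (hf0 : 0 ≤ f) (hInt : Integrable f μ)
    (hsq : Integrable (fun x => f x ^ 2) μ) {B : ℝ} (hB : 0 < B) :
    dist (∫ x, f x ∂μ) (∫ x, min (f x) B ∂μ) ≤ (∫ x, f x ^ 2 ∂μ) / B := by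
  have hmin := integrable_min_const (μ := μ) hf hf0 hB.le
  rw [Real.dist_eq, ← integral_sub hInt hmin,
    abs_of_nonneg (integral_nonneg fun x => sub_nonneg.2 (min_le_left _ _)), ← integral_div]
  refine integral_mono (hInt.sub hmin) (hsq.div_const B) fun x => ?_
  have hfx : 0 ≤ f x := hf0 x
  rw [le_div_iff₀ hB]
  rcases le_total (f x) B with h | h
  · rw [min_eq_left h]
    nlinarith
  · rw [min_eq_right h]
    nlinarith

theorem tendsto_integral_of_integral_sq_le [HasOuterApproxClosed Ω]
    (hν : Tendsto ν atTop (𝓝 ν₀)) (hf : Continuous f) (hf0 : 0 ≤ f)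
    (hInt : ∀ n, Integrable f (ν n : Measure Ω))
    (hsq : ∀ n, Integrable (fun x => f x ^ 2) (ν n : Measure Ω))
    (hK : ∀ n, ∫ x, f x ^ 2 ∂(ν n : Measure Ω) ≤ K) :
    Integrable f (ν₀ : Measure Ω) ∧
      Tendsto (fun n => ∫ x, f x ∂(ν n : Measure Ω)) atTop (𝓝 (∫ x, f x ∂(ν₀ : Measure Ω))) := by
  obtain ⟨hsq₀, hK₀⟩ := integrable_of_tendsto_of_integral_le hν (hf.pow 2)
    (fun x => sq_nonneg (f x)) hsq hK
  have hint₀ : Integrable f (ν₀ : Measure Ω) :=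
    ((memLp_two_iff_integrable_sq hf.aestronglyMeasurable).2 hsq₀).integrable one_le_two
  refine ⟨hint₀, Metric.tendsto_nhds.2 fun ε hε => ?_⟩
  obtain ⟨B, hB, hKB⟩ : ∃ B : ℕ, 0 < B ∧ K / B < ε / 3 :=
    ((eventually_gt_atTop 0).and ((tendsto_const_div_atTop_nhds_zero_nat K).eventually_lt_const
      (by positivity))).exists
  have hB : (0 : ℝ) < B := Nat.cast_pos.2 hB
  filter_upwards [Metric.tendsto_nhds.1 (tendsto_integral_min_const hν hf hf0 hB.le) (ε / 3)
    (by positivity)] with n hn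
  have htail := (dist_integral_integral_min_const_le hf hf0 (hInt n) (hsq n) hB).trans
    (div_le_div_of_nonneg_right (hK n) hB.le)
  have htail₀ := (dist_integral_integral_min_const_le hf hf0 hint₀ hsq₀ hB).trans
    (div_le_div_of_nonneg_right hK₀ hB.le)
  rw [dist_comm] at htail₀
  linarith [dist_triangle4 (∫ x, f x ∂(ν n : Measure Ω)) (∫ x, min (f x) B ∂(ν n : Measure Ω))
    (∫ x, min (f x) B ∂(ν₀ : Measure Ω)) (∫ x, f x ∂(ν₀ : Measure Ω))]

end UniformIntegrability

section LaplaceContinuity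

open scoped Topology

variable {ν : ℕ → ProbabilityMeasure ℝ} {ν₀ : ProbabilityMeasure ℝ}

theorem mgf_of_tendsto_of_tendsto_mgf_Iio {m : ℝ → ℝ}
    (hνint : ∀ n, Set.Iio 0 ⊆ integrableExpSet id (ν n : Measure ℝ))
    (h : ∀ θ < 0, Tendsto (fun n => mgf id (ν n : Measure ℝ) θ) atTop (𝓝 (m θ)))
    (hν : Tendsto ν atTop (𝓝 ν₀)) {θ : ℝ} (hθ : θ < 0) :
    θ ∈ integrableExpSet id (ν₀ : Measure ℝ) ∧ mgf id (ν₀ : Measure ℝ) θ = m θ := by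
  have hθ2 : 2 * θ < 0 := mul_neg_of_pos_of_neg two_pos hθ
  have hsq : ∀ x, Real.exp (θ * x) ^ 2 = Real.exp (2 * θ * x) := fun x => by
    rw [sq, ← Real.exp_add]
    ring_nf
  obtain ⟨K, hK⟩ := (h (2 * θ) hθ2).bddAbove_range
  obtain ⟨hInt, hlim⟩ := tendsto_integral_of_integral_sq_le (f := fun x => Real.exp (θ * x))
    (K := K) hν (by fun_prop) (fun x => (Real.exp_pos _).le) (fun n => hνint n hθ)
    (fun n => by simpa only [hsq] using! hνint n hθ2)
    (fun n => by simpa only [hsq] using! hK ⟨n, rfl⟩)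
  exact ⟨hInt, tendsto_nhds_unique hlim (h θ hθ)⟩

theorem tendsto_of_tendsto_mgf_Iio
    (hν : ∀ n, Set.Iio 0 ⊆ integrableExpSet id (ν n : Measure ℝ))
    (hν₀ : Set.Iio 0 ⊆ integrableExpSet id (ν₀ : Measure ℝ))
    (h : ∀ θ < 0, Tendsto (fun n => mgf id (ν n : Measure ℝ) θ) atTop
      (𝓝 (mgf id (ν₀ : Measure ℝ) θ))) :
    Tendsto ν atTop (𝓝 ν₀) := by
  have htight : IsTightMeasureSet (Set.range fun n => (ν n : Measure ℝ)) :=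
    isTightMeasureSet_range_of_tendsto_mgf_Iio hν (tendsto_mgf_nhdsLT_zero hν₀) h
  have hcompact : IsCompact (closure (Set.range ν)) := by
    refine isCompact_closure_of_isTightMeasureSet (htight.subset ?_)
    rintro _ ⟨_, ⟨n, rfl⟩, rfl⟩
    exact ⟨n, rfl⟩
  refine tendsto_of_subseq_tendsto fun ns hns => ?_
  obtain ⟨ν', -, φ, hφ, hν'⟩ := hcompact.tendsto_subseq
    (x := fun n => ν (ns n)) fun n => subset_closure ⟨ns n, rfl⟩
  have hmgf := fun θ (hθ : θ < 0) => mgf_of_tendsto_of_tendsto_mgf_Iio (fun n => hν (ns (φ n)))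
    (fun θ hθ => (h θ hθ).comp (hns.comp hφ.tendsto_atTop)) hν' hθ
  have heq : (ν' : Measure ℝ) = ν₀ :=
    measure_eq_of_eqOn_mgf_Iio (fun θ hθ => (hmgf θ hθ).1) hν₀ fun θ hθ => (hmgf θ hθ).2
  exact ⟨φ, Subtype.ext heq ▸ hν'⟩

theorem tendsto_of_tendsto_mgf_perturbed
    (hν : ∀ n, Set.Iio 0 ⊆ integrableExpSet id (ν n : Measure ℝ))
    (hν₀ : Set.Iio 0 ⊆ integrableExpSet id (ν₀ : Measure ℝ))
    (h : ∀ θ < 0, ∃ s : ℕ → ℝ, Tendsto s atTop (𝓝 θ) ∧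
      Tendsto (fun n => mgf id (ν n : Measure ℝ) (s n)) atTop
        (𝓝 (mgf id (ν₀ : Measure ℝ) θ))) :
    Tendsto ν atTop (𝓝 ν₀) := by
  have hconvex : ∀ μ : ProbabilityMeasure ℝ, Set.Iio 0 ⊆ integrableExpSet id (μ : Measure ℝ) →
      ConvexOn ℝ (Set.Iio 0) (mgf id (μ : Measure ℝ)) := fun μ hμ =>
    convexOn_mgf.subset hμ (convex_Iio 0)
  exact tendsto_of_tendsto_mgf_Iio hν hν₀ fun θ hθ =>
    tendsto_of_convexOn_of_tendsto_perturbed isOpen_Iio (fun n => hconvex _ (hν n))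
      ((hconvex _ hν₀).continuousOn isOpen_Iio) h hθ

end LaplaceContinuity

section Words

/-- The strict order on pairs (label, rank) in which labels come first and ties are broken by the
ranks at odd labels and by the reversed ranks at even labels. -/
def SignedLexLT {q N : ℕ} (u v : Fin q × Fin N) : Prop :=
  u.1 < v.1 ∨ (u.1 = v.1 ∧ if Even (u.1 : ℕ) then v.2 < u.2 else u.2 < v.2)

theorem SignedLexLT.trans {q N : ℕ} {u v w : Fin q × Fin N} (huv : SignedLexLT u v)
    (hvw : SignedLexLT v w) : SignedLexLT u w := by
  simp only [SignedLexLT] at *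
  grind

/-- The ranking `r` of the points is induced by the labels `ℓ`, ties being broken through the ranks
of the images under `τ`. -/
def IsCompatible {X : Type*} {N q : ℕ} (τ : Equiv.Perm X) (ℓ : X → Fin q) (r : X ≃ Fin N) : Prop :=
  ∀ x y, r x < r y → SignedLexLT (ℓ x, r (τ x)) (ℓ y, r (τ y))

/-- The number of labellings with `q` letters compatible with `π` in the natural order. -/
noncomputable def compatibleCount {n : ℕ} (q : ℕ) (π : Equiv.Perm (Fin n)) : ℕ :=
  Nat.card {f : Fin n → Fin q // IsCompatible π f (Equiv.refl _)}

/-- The total weight of the words of `i + 1` letters ending in a given letter, where the weight of a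
word is the product of the weights `K s` of its transitions. -/
def transferSum {ι R : Type*} [Fintype ι] [CommSemiring R] (K : ℕ → ι → ι → R) : ℕ → ι → R
  | 0, _ => 1
  | i + 1, g => ∑ h, transferSum K i h * K i h g

theorem sum_prod_mul_last_eq_transferSum {ι R : Type*} [Fintype ι] [CommSemiring R]
    (K : ℕ → ι → ι → R) (i : ℕ) (φ : ι → R) :
    ∑ w : Fin (i + 1) → ι, (∏ s : Fin i, K s (w s.castSucc) (w s.succ)) * φ (w (Fin.last i)) =
      ∑ g, transferSum K i g * φ g := by
  induction i generalizing φ with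
  | zero =>
    rw [← (Equiv.funUnique (Fin 1) ι).symm.sum_comp]
    simp [transferSum]
  | succ i ih =>
    rw [← (Fin.snocEquiv fun _ => ι).sum_comp, Fintype.sum_prod_type_right]
    have hlast : ∀ w : Fin (i + 1) → ι, ∑ g, (∏ s : Fin (i + 1),
        K s ((Fin.snoc w g : Fin (i + 2) → ι) s.castSucc) ((Fin.snoc w g : Fin (i + 2) → ι) s.succ))
          * φ ((Fin.snoc w g : Fin (i + 2) → ι) (Fin.last (i + 1))) =
        (∏ s : Fin i, K s (w s.castSucc) (w s.succ)) *
          ∑ g, K i (w (Fin.last i)) g * φ g := fun w => by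
      simp only [Fin.prod_univ_castSucc, Fin.succ_castSucc, Fin.snoc_castSucc, Fin.succ_last,
        Fin.snoc_last, Fin.val_castSucc, Fin.val_last, mul_assoc, Finset.mul_sum]
    refine (Finset.sum_congr rfl fun w _ => hlast w).trans ?_
    rw [ih fun h => ∑ g, K i h g * φ g]
    simp only [transferSum, Finset.mul_sum, Finset.sum_mul, mul_assoc]
    exact Finset.sum_comm

/-- The words counted by `prefixCount` (pattern words): weakly increasing, with equality in slot
`s` only at even letters if `D s` and only at odd letters otherwise. -/
def IsPatternWord (D : ℕ → Prop) {i q : ℕ} (f : Fin (i + 1) → Fin q) : Prop :=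
  ∀ s : Fin i, f s.castSucc < f s.succ ∨
    (f s.castSucc = f s.succ ∧ (Even (f s.succ : ℕ) ↔ D s))

variable (D : ℕ → Prop) [DecidablePred D]

/-- The number of pattern words of `i + 1` letters in `ℕ` ending in a given letter. -/
def prefixCount : ℕ → ℕ → ℕ
  | 0, _ => 1
  | i + 1, g =>
    ∑ h ∈ Finset.range g, prefixCount i h + if (Even g ↔ D i) then prefixCount i g else 0

theorem transferSum_eq_prefixCount (q i : ℕ) (g : Fin q) :
    transferSum (fun s (h g : Fin q) => if h < g ∨ h = g ∧ (Even (g : ℕ) ↔ D s) then 1 else 0) i g =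
      prefixCount D i g := by
  induction i generalizing g with
  | zero => rfl
  | succ i ih =>
    have hsplit : ∀ h : ℕ, prefixCount D i h *
        (if h < (g : ℕ) ∨ h = g ∧ (Even (g : ℕ) ↔ D i) then 1 else 0) =
        (if h < (g : ℕ) then prefixCount D i h else 0) +
          if h = (g : ℕ) then (if (Even (g : ℕ) ↔ D i) then prefixCount D i g else 0) else 0 := by
      grind
    have hrange : (Finset.range q).filter (· < (g : ℕ)) = Finset.range g := by
      ext h
      simp only [Finset.mem_filter, Finset.mem_range]
      omega
    simp only [transferSum, prefixCount, ih]
    simp only [Fin.lt_def, Fin.ext_iff]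
    rw [Fin.sum_univ_eq_sum_range (fun h => prefixCount D i h *
      if h < (g : ℕ) ∨ h = g ∧ (Even (g : ℕ) ↔ D i) then 1 else 0) q]
    simp only [hsplit]
    rw [Finset.sum_add_distrib, ← Finset.sum_filter, hrange, Finset.sum_ite_eq',
      if_pos (Finset.mem_range.2 g.2)]

theorem card_isPatternWord (q i : ℕ) :
    Nat.card {f : Fin (i + 1) → Fin q // IsPatternWord D f} =
      ∑ g ∈ Finset.range q, prefixCount D i g := by
  classical
  have hsum := sum_prod_mul_last_eq_transferSum
    (fun s (h g : Fin q) => if h < g ∨ h = g ∧ (Even (g : ℕ) ↔ D s) then 1 else 0) i fun _ => 1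
  simp only [mul_one, transferSum_eq_prefixCount, Finset.prod_boole, Finset.mem_univ,
    forall_const] at hsum
  rw [Nat.card_eq_fintype_card, Fintype.card_subtype, Finset.card_filter,
    ← Fin.sum_univ_eq_sum_range, ← hsum]
  exact Finset.sum_congr rfl fun f _ => if_congr Iff.rfl rfl rfl

end Words

section GeneratingFunction

open PowerSeries

variable (D : ℕ → Prop) [DecidablePred D]

/-- Generating function of the number of pattern words with letters below `2 * a`. -/
noncomputable def totalSeries (i : ℕ) : PowerSeries ℤ :=
  PowerSeries.mk fun a => ((∑ g ∈ Finset.range (2 * a), prefixCount D i g : ℕ) : ℤ)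

/-- Generating function of the number of pattern words ending in the even letter `2 * v`. -/
noncomputable def evenSeries (i : ℕ) : PowerSeries ℤ :=
  PowerSeries.mk fun v => (prefixCount D i (2 * v) : ℤ)

/-- Generating function of the number of pattern words ending in the odd letter `2 * v + 1`. -/
noncomputable def oddSeries (i : ℕ) : PowerSeries ℤ :=
  PowerSeries.mk fun v => (prefixCount D i (2 * v + 1) : ℤ)

/-- The number of slots `s < i` with `D s` that are preceded by a slot without `D`. -/
def patternPeaks (i : ℕ) : ℕ := ((Finset.range i).filter fun s => 0 < s ∧ ¬ D (s - 1) ∧ D s).card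

variable {D} {i : ℕ}

theorem one_sub_X_mul_totalSeries :
    (1 - X) * totalSeries D i = X * (oddSeries D i + evenSeries D i) := by
  ext a
  cases a with
  | zero => simp [totalSeries, sub_mul]
  | succ a =>
    rw [sub_mul, one_mul, map_sub, coeff_succ_X_mul, coeff_succ_X_mul, map_add]
    simp only [totalSeries, oddSeries, evenSeries, coeff_mk]
    rw [show 2 * (a + 1) = 2 * a + 1 + 1 by ring, Finset.sum_range_succ, Finset.sum_range_succ]
    push_cast
    ring

theorem oddSeries_zero : oddSeries D 0 = evenSeries D 0 := by
  ext v
  simp [oddSeries, evenSeries, prefixCount]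

theorem one_sub_X_mul_evenSeries_zero : (1 - X) * evenSeries D 0 = 1 := by
  have : evenSeries D 0 = PowerSeries.mk 1 := by
    ext v
    simp [evenSeries, prefixCount]
  rw [this, mul_comm, PowerSeries.mk_one_mul_one_sub_eq_one]

theorem evenSeries_succ_of_not (h : ¬ D i) : evenSeries D (i + 1) = totalSeries D i := by
  ext v
  simp [evenSeries, totalSeries, prefixCount, h]

theorem X_mul_oddSeries_succ_of_not (h : ¬ D i) :
    X * oddSeries D (i + 1) = totalSeries D i := by
  ext v
  cases v with
  | zero => simp [totalSeries]
  | succ v =>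
    rw [coeff_succ_X_mul]
    simp only [oddSeries, totalSeries, prefixCount, coeff_mk, h, iff_false]
    rw [if_pos (by simp), show 2 * (v + 1) = 2 * v + 1 + 1 by ring, ← Finset.sum_range_succ]

theorem evenSeries_succ_of_pos (h : D i) :
    evenSeries D (i + 1) = totalSeries D i + evenSeries D i := by
  ext v
  simp [evenSeries, totalSeries, prefixCount, h]

theorem oddSeries_succ_of_pos (h : D i) : oddSeries D (i + 1) = evenSeries D (i + 1) := by
  ext v
  simp [evenSeries, oddSeries, prefixCount, h, Finset.sum_range_succ]

theorem two_X_mul_evenSeries (h : i = 0 ∨ D (i - 1)) :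
    2 * X * evenSeries D i = (1 - X) * totalSeries D i := by
  have hodd : oddSeries D i = evenSeries D i := by
    cases i with
    | zero => exact oddSeries_zero
    | succ i => exact oddSeries_succ_of_pos (h.resolve_left i.succ_ne_zero)
  rw [one_sub_X_mul_totalSeries, hodd]
  ring

theorem one_sub_X_mul_totalSeries_succ_of_not (h : ¬ D i) :
    (1 - X) * totalSeries D (i + 1) = (1 + X) * totalSeries D i := by
  rw [one_sub_X_mul_totalSeries, mul_add, X_mul_oddSeries_succ_of_not h, evenSeries_succ_of_not h]
  ring

theorem one_add_X_mul_evenSeries (hi : 0 < i) (h : ¬ D (i - 1)) :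
    (1 + X) * evenSeries D i = (1 - X) * totalSeries D i := by
  obtain ⟨i, rfl⟩ := Nat.exists_eq_add_one.2 hi
  rw [Nat.add_sub_cancel] at h
  rw [one_sub_X_mul_totalSeries_succ_of_not h, evenSeries_succ_of_not h]

theorem one_sub_X_mul_totalSeries_succ_of_pos (h : D i) :
    (1 - X) * totalSeries D (i + 1) = 2 * X * (totalSeries D i + evenSeries D i) := by
  rw [one_sub_X_mul_totalSeries, oddSeries_succ_of_pos h, evenSeries_succ_of_pos h]
  ring

theorem totalSeries_succ_of_not_peak (h : ¬ (0 < i ∧ ¬ D (i - 1) ∧ D i)) :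
    (1 - X) * totalSeries D (i + 1) = (1 + X) * totalSeries D i := by
  by_cases hD : D i
  · have hprev : i = 0 ∨ D (i - 1) := by grind
    linear_combination one_sub_X_mul_totalSeries_succ_of_pos hD + two_X_mul_evenSeries hprev
  · exact one_sub_X_mul_totalSeries_succ_of_not hD

theorem totalSeries_succ_of_peak (hi : 0 < i) (hprev : ¬ D (i - 1)) (hD : D i) :
    (1 + X) * (1 - X) * totalSeries D (i + 1) = 4 * X * totalSeries D i := by
  linear_combination (1 + X) * one_sub_X_mul_totalSeries_succ_of_pos hD +
    2 * X * one_add_X_mul_evenSeries hi hprev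

theorem patternPeaks_succ : patternPeaks D (i + 1) =
    patternPeaks D i + if 0 < i ∧ ¬ D (i - 1) ∧ D i then 1 else 0 := by
  unfold patternPeaks
  rw [Finset.range_add_one, Finset.filter_insert]
  split_ifs with h
  · rw [Finset.card_insert_of_notMem (by simp)]
  · rfl

theorem two_mul_patternPeaks_le : 2 * patternPeaks D i ≤ i := by
  suffices 2 * patternPeaks D i ≤ i ∧ (0 < i → ¬ D (i - 1) → 2 * patternPeaks D i + 1 ≤ i) from
    this.1
  induction i with
  | zero => simp [patternPeaks]
  | succ i ih =>
    rw [patternPeaks_succ]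
    grind

theorem totalSeries_closed_form :
    (1 + X) ^ (2 * patternPeaks D i) * ((1 - X) ^ (i + 2) * totalSeries D i) =
      2 * X * (1 + X) ^ i * (4 * X) ^ patternPeaks D i := by
  induction i with
  | zero =>
    have hzero : patternPeaks D 0 = 0 := by simp [patternPeaks]
    rw [hzero]
    linear_combination (2 * X) * one_sub_X_mul_evenSeries_zero (D := D) -
      (1 - X) * two_X_mul_evenSeries (D := D) (.inl rfl)
  | succ i ih =>
    rw [patternPeaks_succ]
    split_ifs with h
    · linear_combination (1 + X) ^ (2 * patternPeaks D i + 1) * (1 - X) ^ (i + 2) *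
        totalSeries_succ_of_peak h.1 h.2.1 h.2.2 + (1 + X) * (4 * X) * ih
    · linear_combination (1 + X) ^ (2 * patternPeaks D i) * (1 - X) ^ (i + 2) *
        totalSeries_succ_of_not_peak h + (1 + X) * ih

theorem totalSeries_eq {m : ℕ} (hm : m + 2 * patternPeaks D i = i) :
    totalSeries D i =
      2 * X * (1 + X) ^ m * (4 * X) ^ patternPeaks D i * (invOneSubPow ℤ (i + 2)).val := by
  have hinv : (1 - X : PowerSeries ℤ) ^ (i + 2) * (invOneSubPow ℤ (i + 2)).val = 1 := by
    rw [← invOneSubPow_inv_eq_one_sub_pow]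
    exact (invOneSubPow ℤ (i + 2)).inv_val
  have hne : (1 + X : PowerSeries ℤ) ≠ 0 := fun h => by simpa using congrArg (coeff 0) h
  refine mul_left_cancel₀ (pow_ne_zero (2 * patternPeaks D i) hne) ?_
  have hpow : (1 + X : PowerSeries ℤ) ^ i = (1 + X) ^ m * (1 + X) ^ (2 * patternPeaks D i) := by
    rw [← pow_add, hm]
  linear_combination (invOneSubPow ℤ (i + 2)).val * totalSeries_closed_form (D := D) (i := i) -
    (1 + X) ^ (2 * patternPeaks D i) * totalSeries D i * hinv +
    2 * X * (4 * X) ^ patternPeaks D i * (invOneSubPow ℤ (i + 2)).val * hpow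

theorem sum_prefixCount_eq {m a : ℕ} (hm : m + 2 * patternPeaks D i = i)
    (ha : m + patternPeaks D i + 1 ≤ a) :
    ∑ g ∈ Finset.range (2 * a), prefixCount D i g =
      2 * 4 ^ patternPeaks D i * ∑ j ∈ Finset.range (m + 1),
        m.choose j * (i + 1 + (a - (patternPeaks D i + 1 + j))).choose (i + 1) := by
  have hexpand : totalSeries D i = ∑ j ∈ Finset.range (m + 1),
      C (2 * 4 ^ patternPeaks D i * (m.choose j : ℤ)) *
        (X ^ (patternPeaks D i + 1 + j) * (invOneSubPow ℤ (i + 2)).val) := by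
    rw [totalSeries_eq hm, add_comm (1 : PowerSeries ℤ) X, add_pow, Finset.mul_sum, Finset.sum_mul,
      Finset.sum_mul]
    refine Finset.sum_congr rfl fun j _ => ?_
    simp only [map_mul, map_pow, map_natCast, map_ofNat, one_pow, mul_one]
    ring
  have hcoeff := congrArg (coeff a) hexpand
  rw [totalSeries, coeff_mk, map_sum] at hcoeff
  zify
  rw [Nat.cast_sum] at hcoeff
  rw [hcoeff, Finset.mul_sum]
  refine Finset.sum_congr rfl fun j hj => ?_
  have hjm : j ≤ m := Nat.lt_succ_iff.1 (Finset.mem_range.1 hj)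
  rw [coeff_C_mul, coeff_X_pow_mul', if_pos (by omega), invOneSubPow_val_succ_eq_mk_add_choose,
    coeff_mk]
  ring

end GeneratingFunction

section Peaks

/-- The descent pattern of a permutation. -/
def HasDescent {n : ℕ} (π : Equiv.Perm (Fin n)) (s : ℕ) : Prop :=
  ∃ h : s + 1 < n, π ⟨s + 1, h⟩ < π ⟨s, by omega⟩

theorem not_hasDescent_iff {n s : ℕ} (π : Equiv.Perm (Fin n)) (h : s + 1 < n) :
    ¬ HasDescent π s ↔ π ⟨s, by omega⟩ < π ⟨s + 1, h⟩ := by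
  have hne : π ⟨s, by omega⟩ ≠ π ⟨s + 1, h⟩ := fun he => by simpa using π.injective he
  simp only [HasDescent, h, exists_true_left, not_lt]
  exact ⟨fun hle => hle.lt_of_ne hne, le_of_lt⟩

open Classical in
theorem peaks_eq_patternPeaks {i : ℕ} (π : Equiv.Perm (Fin (i + 1))) :
    peaks π = patternPeaks (HasDescent π) i := by
  refine Finset.card_bij (fun s _ => (s : ℕ)) (fun s hs => ?_) (fun s _ t _ => Fin.ext)
    fun s hs => ?_
  · obtain ⟨a, b, ha, hb, hlt, hgt⟩ := (Finset.mem_filter.1 hs).2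
    obtain ⟨s, hsn⟩ := s
    obtain rfl : s = a + 1 := ha.symm
    have hb' : b = ⟨a + 1 + 1, by omega⟩ := Fin.ext hb.symm
    rw [hb'] at hgt
    refine Finset.mem_filter.2 ⟨Finset.mem_range.2 (by omega), Nat.succ_pos _, ?_, _, hgt⟩
    exact (not_hasDescent_iff π hsn).2 hlt
  · obtain ⟨hsi, hpos, hasc, h, hdesc⟩ := Finset.mem_filter.1 hs
    obtain ⟨s, rfl⟩ := Nat.exists_eq_add_one.2 hpos
    exact ⟨⟨s + 1, by omega⟩, Finset.mem_filter.2 ⟨Finset.mem_univ _, ⟨s, by omega⟩,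
      ⟨s + 1 + 1, h⟩, rfl, rfl, (not_hasDescent_iff π (by omega)).1 hasc, hdesc⟩, rfl⟩

theorem two_mul_peaks_le {i : ℕ} (π : Equiv.Perm (Fin (i + 1))) : 2 * peaks π ≤ i := by
  classical
  rw [peaks_eq_patternPeaks]
  exact two_mul_patternPeaks_le

theorem isCompatible_refl_iff {i q : ℕ} (π : Equiv.Perm (Fin (i + 1))) (f : Fin (i + 1) → Fin q) :
    IsCompatible π f (Equiv.refl _) ↔ IsPatternWord (HasDescent π) f := by
  have : IsTrans (Fin q × Fin (i + 1)) SignedLexLT := ⟨fun _ _ _ => SignedLexLT.trans⟩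
  refine (Fin.liftFun_iff_succ SignedLexLT (f := fun s => (f s, π s))).trans
    (forall_congr' fun s => or_congr Iff.rfl (and_congr_right fun hfs => ?_))
  have hasc : ¬ HasDescent π s ↔ π s.castSucc < π s.succ := not_hasDescent_iff π (by omega)
  have hdesc : HasDescent π s ↔ π s.succ < π s.castSucc :=
    ⟨fun ⟨_, h⟩ => h, fun h => ⟨by omega, h⟩⟩
  simp only at hfs
  simp only [hfs]
  split_ifs with h <;> simp [h, ← hasc, hdesc]

theorem compatibleCount_eq_sum_prefixCount {i : ℕ} (q : ℕ) (π : Equiv.Perm (Fin (i + 1)))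
    [DecidablePred (HasDescent π)] :
    compatibleCount q π = ∑ g ∈ Finset.range q, prefixCount (HasDescent π) i g := by
  rw [← card_isPatternWord]
  exact Nat.card_congr (Equiv.subtypeEquivRight fun f => isCompatible_refl_iff π f)

theorem compatibleCount_of_isEmpty {q : ℕ} (π : Equiv.Perm (Fin 0)) : compatibleCount q π = 1 :=
  Nat.card_eq_one_iff_unique.2 ⟨⟨fun _ _ => Subtype.ext (funext fun x => x.elim0)⟩,
    ⟨⟨fun x => x.elim0, fun x => x.elim0⟩⟩⟩

/-- The normalized number of labellings with `2 * a` letters compatible with a permutation of `k`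
points, as a binomial average over `m` trials. -/
noncomputable def labelRatio (a : ℝ) (k m : ℕ) : ℝ :=
  (1 / 2) ^ m * ∑ j ∈ Finset.range (m + 1), (m.choose j : ℝ) *
    ∏ i ∈ Finset.range k, (1 + ((i - (k - 1) / 2) - (j - m / 2)) / a)

theorem factorial_mul_choose_eq_prod (k t : ℕ) :
    (k.factorial : ℝ) * ((k + t).choose k : ℝ) = ∏ s ∈ Finset.range k, ((t : ℝ) + 1 + s) := by
  have h := Nat.ascFactorial_eq_factorial_mul_choose t k
  rw [Nat.ascFactorial_eq_prod_range, add_comm t k] at h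
  exact_mod_cast h.symm

theorem prod_add_eq_pow_mul_prod {a : ℝ} (ha : a ≠ 0) (k : ℕ) {b c : ℝ}
    (hb : b = a - (k - 1) / 2 - c) :
    ∏ s ∈ Finset.range k, (b + s) =
      a ^ k * ∏ s ∈ Finset.range k, (1 + ((s - (k - 1) / 2) - c) / a) := by
  calc ∏ s ∈ Finset.range k, (b + s)
      = ∏ s ∈ Finset.range k, a * (1 + ((s - (k - 1) / 2) - c) / a) :=
        Finset.prod_congr rfl fun s _ => by
          rw [hb]
          field_simp
          ring
    _ = _ := by rw [Finset.prod_mul_distrib, Finset.prod_const, Finset.card_range]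

theorem two_mul_four_pow_eq {m p i : ℕ} (hm : m + 2 * p = i) :
    (2 : ℝ) * 4 ^ p = (1 / 2) ^ m * 2 ^ (i + 1) := by
  rw [← hm, pow_succ, pow_add, pow_mul, one_div, inv_pow]
  field_simp
  norm_num

theorem compatibleCount_eq_labelRatio {n a : ℕ} (ha : n ≤ a) (ha0 : 0 < a)
    (π : Equiv.Perm (Fin n)) :
    (n.factorial : ℝ) * compatibleCount (2 * a) π / (2 * a : ℝ) ^ n =
      labelRatio a n (n - 1 - 2 * peaks π) := by
  classical
  obtain _ | i := n
  · simp [compatibleCount_of_isEmpty, labelRatio]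
  have hpeaks := two_mul_peaks_le π
  obtain ⟨m, hm⟩ : ∃ m, m + 2 * peaks π = i := ⟨i - 2 * peaks π, by omega⟩
  have hmR : (m : ℝ) + 2 * peaks π = i := by exact_mod_cast hm
  have ha0R : (a : ℝ) ≠ 0 := Nat.cast_ne_zero.2 ha0.ne'
  rw [show i + 1 - 1 - 2 * peaks π = m by omega, compatibleCount_eq_sum_prefixCount,
    sum_prefixCount_eq (by rwa [← peaks_eq_patternPeaks]) (by rw [← peaks_eq_patternPeaks]; omega),
    ← peaks_eq_patternPeaks, labelRatio]
  push_cast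
  rw [two_mul_four_pow_eq hm, mul_assoc ((1 / 2 : ℝ) ^ m), mul_left_comm, mul_div_assoc,
    Finset.mul_sum, Finset.mul_sum, Finset.sum_div]
  congr 1
  refine Finset.sum_congr rfl fun j hj => ?_
  have hja : peaks π + 1 + j ≤ a := by
    have := Finset.mem_range.1 hj
    omega
  have hprod := factorial_mul_choose_eq_prod (i + 1) (a - (peaks π + 1 + j))
  rw [prod_add_eq_pow_mul_prod ha0R (i + 1) (c := j - m / 2) (by
    push_cast [hja, ← hmR]
    ring)] at hprod
  rw [div_eq_iff (by positivity), mul_pow]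
  push_cast at hprod ⊢
  linear_combination (m.choose j : ℝ) * 2 ^ (i + 1) * hprod

end Peaks

section Ranks

theorem exists_rank_equiv {Y α : Type*} [Fintype Y] [LinearOrder α] {k : ℕ}
    (hk : Fintype.card Y = k) {h : Y → α} (hh : Function.Injective h) :
    ∃ e : Y ≃ Fin k, ∀ x y, e x < e y ↔ h x < h y := by
  let := LinearOrder.lift' h hh
  exact ⟨(Fintype.orderIsoFinOfCardEq Y hk).symm.toEquiv,
    fun _ _ => (Fintype.orderIsoFinOfCardEq Y hk).symm.lt_iff_lt⟩

theorem rank_equiv_unique {Y : Type*} {k : ℕ} {e e' : Y ≃ Fin k}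
    (h : ∀ x y, e x < e y → e' x < e' y) : e = e' := by
  have hmono : StrictMono (e.symm.trans e') := fun i j hij => h _ _ (by simpa using hij)
  have hid : ⇑(e.symm.trans e') = id := (hmono.range_inj strictMono_id).1
    (by rw [(e.symm.trans e').range_eq_univ, Set.range_id])
  ext x
  simpa using congrArg Fin.val (congrFun hid (e x)).symm

end Ranks

section Key

variable {X : Type*} {q N : ℕ}

/-- The sign of a letter: even letters are negative. -/
noncomputable def letterSign (g : ℕ) : ℝ := if Even g then -1 else 1

theorem abs_letterSign (g : ℕ) : |letterSign g| = 1 := by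
  unfold letterSign
  split_ifs <;> simp

/-- A real key that sorts the points by their label, breaking ties through the keys of the images
under `τ`: the key of `x` is a signed expansion in base `1 / β` of the labels of `x`, `τ x`,
`τ (τ x)`, … -/
structure IsKey (τ : Equiv.Perm X) (ℓ : X → Fin q) (β : ℝ) (v : X → ℝ) : Prop where
  pos : 0 < β
  lt_one : β < 1
  eq : ∀ x, v x = β * ((ℓ x : ℕ) + letterSign (ℓ x) * v (τ x))
  abs_lt_half : ∀ x, |v x| < 1 / 2

/-- The map whose fixed points satisfy the equation of a key. -/
noncomputable def keyMap (τ : Equiv.Perm X) (ℓ : X → Fin q) (β : ℝ) (v : X → ℝ) : X → ℝ :=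
  fun x => β * ((ℓ x : ℕ) + letterSign (ℓ x) * v (τ x))

theorem contractingWith_keyMap [Fintype X] (τ : Equiv.Perm X) (ℓ : X → Fin q) {β : NNReal}
    (hβ : β < 1) : ContractingWith β (keyMap τ ℓ β) := by
  refine ⟨hβ, LipschitzWith.of_dist_le_mul fun v w =>
    (dist_pi_le_iff (by positivity)).2 fun x => ?_⟩
  have hsub : keyMap τ ℓ β v x - keyMap τ ℓ β w x =
      β * (letterSign (ℓ x) * (v (τ x) - w (τ x))) := by
    simp only [keyMap]
    ring
  rw [Real.dist_eq, hsub, abs_mul, abs_mul, abs_letterSign, one_mul, NNReal.abs_eq, ← Real.dist_eq]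
  exact mul_le_mul_of_nonneg_left (dist_le_pi_dist v w (τ x)) β.2

theorem exists_isKey [Finite X] (τ : Equiv.Perm X) (ℓ : X → Fin q) :
    ∃ β v, IsKey τ ℓ β v := by
  have := Fintype.ofFinite X
  let β : NNReal := 1 / (4 * (q + 1))
  have hβq : (β : ℝ) * (4 * (q + 1)) = 1 := by
    simp only [β]
    push_cast
    field_simp
  have hβ : (β : ℝ) ≤ 1 / 4 := by nlinarith [β.2, q.cast_nonneg (α := ℝ)]
  have hT := contractingWith_keyMap τ ℓ (β := β) (by
    rw [← NNReal.coe_lt_coe, NNReal.coe_one]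
    linarith)
  refine ⟨β, hT.fixedPoint, by positivity, by linarith,
    fun x => (congrFun hT.fixedPoint_isFixedPt x).symm, fun x => ?_⟩
  have hzero : dist 0 (keyMap τ ℓ β 0) ≤ 1 / 4 := by
    refine (dist_pi_le_iff (by norm_num)).2 fun y => ?_
    have hy : ((ℓ y : ℕ) : ℝ) ≤ q := by exact_mod_cast (ℓ y).2.le
    have hval : keyMap τ ℓ β 0 y = β * (ℓ y : ℕ) := by simp [keyMap]
    rw [Real.dist_eq, hval, Pi.zero_apply, zero_sub, abs_neg, abs_of_nonneg (by positivity)]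
    nlinarith [β.2]
  calc |hT.fixedPoint _ x| = dist ((0 : X → ℝ) x) (hT.fixedPoint _ x) := by
        rw [Pi.zero_apply, dist_comm, Real.dist_0_eq_abs]
    _ ≤ dist 0 (keyMap τ ℓ β 0) / (1 - β) := (dist_le_pi_dist _ _ x).trans (hT.dist_fixedPoint_le 0)
    _ < 1 / 2 := by
        rw [div_lt_iff₀ (by linarith)]
        linarith

namespace IsKey

variable {τ : Equiv.Perm X} {ℓ : X → Fin q} {β : ℝ} {v : X → ℝ}

theorem label_le (hv : IsKey τ ℓ β v) {x y : X} (h : v x ≤ v y) : ℓ x ≤ ℓ y := by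
  by_contra! hlt
  have hlabel : ((ℓ y : ℕ) : ℝ) + 1 ≤ (ℓ x : ℕ) := by exact_mod_cast hlt
  have hsigned (z : X) : |letterSign (ℓ z) * v (τ z)| < 1 / 2 := by
    rw [abs_mul, abs_letterSign, one_mul]
    exact hv.abs_lt_half (τ z)
  rw [hv.eq x, hv.eq y] at h
  have := le_of_mul_le_mul_left h hv.pos
  linarith [(abs_lt.1 (hsigned x)).1, (abs_lt.1 (hsigned y)).2]

theorem label_eq (hv : IsKey τ ℓ β v) {x y : X} (h : v x = v y) : ℓ x = ℓ y :=
  le_antisymm (hv.label_le h.le) (hv.label_le h.ge)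

theorem sub_eq (hv : IsKey τ ℓ β v) {x y : X} (h : ℓ x = ℓ y) :
    v x - v y = β * (letterSign (ℓ x) * (v (τ x) - v (τ y))) := by
  rw [hv.eq x, hv.eq y, h]
  ring

theorem apply_eq (hv : IsKey τ ℓ β v) {x y : X} (h : v x = v y) : v (τ x) = v (τ y) := by
  have hsub := hv.sub_eq (hv.label_eq h)
  have hsign : letterSign (ℓ x) ≠ 0 := abs_pos.1 (by simp [abs_letterSign])
  rw [h, sub_self] at hsub
  simpa [hv.pos.ne', hsign, sub_eq_zero] using hsub.symm

theorem pow_apply_eq (hv : IsKey τ ℓ β v) {x y : X} (h : v x = v y) (d : ℕ) :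
    v ((τ ^ d) x) = v ((τ ^ d) y) := by
  induction d with
  | zero => simpa
  | succ d ih =>
    rw [pow_succ', Equiv.Perm.mul_apply, Equiv.Perm.mul_apply]
    exact hv.apply_eq ih

theorem apply_eq_iff [Finite X] (hv : IsKey τ ℓ β v) {x y : X} :
    v (τ x) = v (τ y) ↔ v x = v y := by
  refine ⟨fun h => ?_, hv.apply_eq⟩
  have hinv (z : X) : (τ ^ (orderOf τ - 1)) (τ z) = z := by
    rw [← Equiv.Perm.mul_apply, pow_sub_one_mul (orderOf_pos τ).ne', pow_orderOf_eq_one,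
      Equiv.Perm.one_apply]
  simpa only [hinv] using hv.pow_apply_eq h (orderOf τ - 1)

theorem lt_iff_of_label_eq (hv : IsKey τ ℓ β v) {x y : X} (h : ℓ x = ℓ y) :
    v x < v y ↔ if Even (ℓ x : ℕ) then v (τ y) < v (τ x) else v (τ x) < v (τ y) := by
  rw [← sub_neg, hv.sub_eq h, ← smul_eq_mul, smul_neg_iff_of_pos_left hv.pos, letterSign]
  split_ifs <;> simp

theorem le_of_lt [Finite X] (hv : IsKey τ ℓ β v) {r : X ≃ Fin N} (hr : IsCompatible τ ℓ r) {x y : X}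
    (hxy : r x < r y) : v x ≤ v y := by
  by_contra! hlt
  -- A misordered pair with the largest gap is carried by `τ` to one with a gap `1 / β` times
  -- larger.
  obtain ⟨⟨a, b⟩, hab, hmax⟩ := Set.exists_max_image {z : X × X | r z.1 < r z.2}
    (fun z => v z.1 - v z.2) (Set.toFinite _) ⟨(x, y), hxy⟩
  have hgap : v b < v a := by linarith [hmax (x, y) hxy]
  obtain hlabel | ⟨hlabel, himage⟩ := hr a b hab
  · exact absurd (hv.label_le hgap.le) (not_le.2 hlabel)
  · have hsub := hv.sub_eq hlabel
    have hβ := hv.pos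
    have hβ1 := hv.lt_one
    simp only [letterSign] at hsub
    simp only at hlabel himage
    split_ifs at hsub himage with heven
    · nlinarith [hmax (τ b, τ a) himage]
    · nlinarith [hmax (τ a, τ b) himage]

theorem lt_of_lt [Finite X] (hv : IsKey τ ℓ β v) {r : X ≃ Fin N} (hr : IsCompatible τ ℓ r) {x y : X}
    (hxy : v x < v y) : r x < r y := by
  by_contra! hle
  obtain h | h := hle.lt_or_eq
  · exact (hv.le_of_lt hr h).not_gt hxy
  · exact hxy.ne' (congrArg v (r.injective h))

theorem comp_symm_eq [Finite X] (hv : IsKey τ ℓ β v) {r r' : X ≃ Fin N}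
    (hr : IsCompatible τ ℓ r) (hr' : IsCompatible τ ℓ r') : v ∘ r.symm = v ∘ r'.symm := by
  have hmono {s : X ≃ Fin N} (hs : IsCompatible τ ℓ s) : Monotone (v ∘ s.symm) :=
    monotone_iff_forall_lt.2 fun i j hij => hv.le_of_lt hs (by simpa using hij)
  have hcomp : (v ∘ r.symm) ∘ (r'.symm.trans r) = v ∘ r'.symm := by
    ext i
    simp
  have := Tuple.unique_monotone (f := v ∘ r.symm) (σ := Equiv.refl _) (τ := r'.symm.trans r)
    (by simpa using hmono hr) (by simpa only [hcomp] using hmono hr')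
  simpa only [hcomp, Equiv.coe_refl, Function.comp_id] using this

theorem apply_trans_symm [Finite X] (hv : IsKey τ ℓ β v) {r r' : X ≃ Fin N}
    (hr : IsCompatible τ ℓ r) (hr' : IsCompatible τ ℓ r') (x : X) :
    v ((r.trans r'.symm) x) = v x := by
  simpa using (congrFun (hv.comp_symm_eq hr hr') (r x)).symm

theorem signedLexLT_of_lt (hv : IsKey τ ℓ β v) {r : X ≃ Fin N} (hr : ∀ x y, v x < v y → r x < r y)
    {x y : X} (h : v x < v y) : SignedLexLT (ℓ x, r (τ x)) (ℓ y, r (τ y)) := by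
  refine (hv.label_le h.le).lt_or_eq.imp id fun hlabel => ⟨hlabel, ?_⟩
  have himage := (hv.lt_iff_of_label_eq hlabel).1 h
  simp only
  split_ifs at himage ⊢ with heven <;> exact hr _ _ himage

end IsKey

namespace IsCompatible

variable {τ : Equiv.Perm X} {ℓ : X → Fin q}

theorem apply_lt_apply_iff {r : X ≃ Fin N} (hr : IsCompatible τ ℓ r) {x y : X} (h : ℓ x = ℓ y) :
    r (τ x) < r (τ y) ↔ if Even (ℓ x : ℕ) then r y < r x else r x < r y := by
  have htie {x y : X} (hlt : r x < r y) (h : ℓ x = ℓ y) :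
      if Even (ℓ x : ℕ) then r (τ y) < r (τ x) else r (τ x) < r (τ y) :=
    ((hr x y hlt).resolve_left (by simp [h])).2
  obtain hlt | heq | hgt := lt_trichotomy (r x) (r y)
  · grind [htie hlt h]
  · simp [r.injective heq]
  · grind [htie hgt h.symm]

theorem label_trans_symm [Finite X] {r r' : X ≃ Fin N} (hr : IsCompatible τ ℓ r)
    (hr' : IsCompatible τ ℓ r') (x : X) : ℓ ((r.trans r'.symm) x) = ℓ x := by
  cases nonempty_fintype X
  obtain ⟨β, v, hv⟩ := exists_isKey τ ℓ
  exact hv.label_eq (hv.apply_trans_symm hr hr' x)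

theorem trans_symm_commute [Finite X] {r r' : X ≃ Fin N} (hr : IsCompatible τ ℓ r)
    (hr' : IsCompatible τ ℓ r') (x : X) :
    (r.trans r'.symm) (τ x) = τ ((r.trans r'.symm) x) := by
  cases nonempty_fintype X
  obtain ⟨β, v, hv⟩ := exists_isKey τ ℓ
  let g : Equiv.Perm X := r.trans r'.symm
  have hg (x : X) : r' (g x) = r x := by simp [g]
  have hkey (x : X) : v (τ (g x)) = v (τ x) := hv.apply_eq (hv.apply_trans_symm hr hr' x)
  have hlabel (x : X) : ℓ (g x) = ℓ x := hr.label_trans_symm hr' x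
  have hmono : ∀ x y, r (τ x) < r (τ y) → r' (τ (g x)) < r' (τ (g y)) := fun x y hxy => by
    obtain h | h := (hv.le_of_lt hr hxy).lt_or_eq
    · exact hv.lt_of_lt hr' (by rwa [hkey, hkey])
    · have hxy' := hv.label_eq (hv.apply_eq_iff.1 h)
      rw [hr.apply_lt_apply_iff hxy'] at hxy
      rwa [hr'.apply_lt_apply_iff (by rw [hlabel, hlabel, hxy']), hlabel, hg, hg]
  have hequiv : τ.trans r = (g.trans τ).trans r' := rank_equiv_unique hmono
  refine r'.injective ?_
  rw [hg]
  exact Equiv.congr_fun hequiv x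

end IsCompatible

end Key

section Labellings

open scoped BigOperators

variable {X L : Type*} [Fintype X] [DecidableEq X] [Fintype L] [Nonempty L]

theorem expect_update (x : X) (φ : (X → L) → ℝ) :
    𝔼 ℓ : X → L, 𝔼 g : L, φ (Function.update ℓ x g) = 𝔼 ℓ, φ ℓ := by
  have hinv : Function.Involutive
      fun p : (X → L) × L => (Function.update p.1 x p.2, p.1 x) := fun p => by simp
  calc 𝔼 ℓ : X → L, 𝔼 g : L, φ (Function.update ℓ x g)
      = 𝔼 p : (X → L) × L, φ (Function.update p.1 x p.2) := by
        rw [← Finset.univ_product_univ, Finset.expect_product]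
    _ = 𝔼 p : (X → L) × L, φ p.1 := Fintype.expect_equiv hinv.toPerm _ _ fun _ => rfl
    _ = 𝔼 ℓ, φ ℓ := by
        rw [← Finset.univ_product_univ, Finset.expect_product]
        simp only [Fintype.expect_const]

theorem expect_ite_label_eq [DecidableEq L] {φ : (X → L) → ℝ} {x y : X} (hφ : DependsOn φ {x}ᶜ)
    (hyx : y ≠ x) : 𝔼 ℓ, (if ℓ x = ℓ y then φ ℓ else 0) = (𝔼 ℓ, φ ℓ) / Fintype.card L := by
  have hupdate (ℓ : X → L) (g : L) : φ (Function.update ℓ x g) = φ ℓ :=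
    hφ fun z hz => Function.update_of_ne hz _ _
  rw [← expect_update x, Finset.expect_div]
  refine Finset.expect_congr rfl fun ℓ _ => ?_
  rw [Fintype.expect_eq_sum_div_card]
  simp [hupdate, Function.update_of_ne hyx]

theorem expect_ite_label_eq_and [DecidableEq L] {φ : (X → L) → ℝ} {x y z w : X}
    (hφ : DependsOn φ {x, z}ᶜ) (hyx : y ≠ x) (hzx : z ≠ x) (hwx : w ≠ x) (hwz : w ≠ z) :
    𝔼 ℓ, (if ℓ x = ℓ y ∧ ℓ z = ℓ w then φ ℓ else 0) = (𝔼 ℓ, φ ℓ) / Fintype.card L ^ 2 := by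
  have hx : DependsOn φ {x}ᶜ := hφ.mono (by simp)
  have hz : DependsOn φ {z}ᶜ := hφ.mono (by simp)
  have hite : DependsOn (fun ℓ : X → L => if ℓ z = ℓ w then φ ℓ else 0) {x}ᶜ := fun ℓ ℓ' h => by
    simp only [h z hzx, h w hwx, hx h]
  simp_rw [ite_and]
  rw [expect_ite_label_eq hite hyx, expect_ite_label_eq hz hwz, div_div, pow_two]

theorem expect_domRestrict (s : Set X) [DecidablePred (· ∈ s)] (φ : (s → L) → ℝ) :
    𝔼 ℓ : X → L, φ (s.domRestrict ℓ) = 𝔼 ℓ, φ ℓ := by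
  let e := Equiv.piEquivPiSubtypeProd (· ∈ s) fun _ => L
  calc 𝔼 ℓ : X → L, φ (s.domRestrict ℓ)
      = 𝔼 p : (s → L) × ({x // x ∉ s} → L), φ p.1 := Fintype.expect_equiv e _ _ fun _ => rfl
    _ = 𝔼 ℓ, φ ℓ := by
        rw [← Finset.univ_product_univ, Finset.expect_product]
        simp only [Fintype.expect_const]

/-- Two points collide if they carry the same label and so do their images. -/
abbrev Collide {X L : Type*} (τ : Equiv.Perm X) (ℓ : X → L) (x y : X) : Prop :=
  ℓ x = ℓ y ∧ ℓ (τ x) = ℓ (τ y)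

theorem expect_ite_collide [DecidableEq L] (τ : Equiv.Perm X) {φ : (X → L) → ℝ} {x y : X}
    (hφ : DependsOn φ {x, τ x}ᶜ) (hx : τ x ≠ x) (hyx : y ≠ x) (hτy : τ y ≠ x) :
    𝔼 ℓ, (if Collide τ ℓ x y then φ ℓ else 0) = (𝔼 ℓ, φ ℓ) / Fintype.card L ^ 2 :=
  expect_ite_label_eq_and hφ hyx hx hτy (τ.injective.ne hyx)

end Labellings

section LabelStabilizer

open scoped BigOperators

variable {X L : Type*}

/-- The permutations commuting with `τ`, preserving the labels and moving only points of `A`. -/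
def labelStabilizer (τ : Equiv.Perm X) (ℓ : X → L) (A : Finset X) : Subgroup (Equiv.Perm X) where
  carrier := {g | Commute g τ ∧ (∀ x, ℓ (g x) = ℓ x) ∧ ∀ x ∉ A, g x = x}
  mul_mem' := fun ⟨hg, hgℓ, hgA⟩ ⟨hh, hhℓ, hhA⟩ =>
    ⟨hg.mul_left hh, fun x => by simp [hgℓ, hhℓ], fun x hx => by simp [hhA x hx, hgA x hx]⟩
  one_mem' := ⟨Commute.one_left τ, fun _ => rfl, fun _ _ => rfl⟩
  inv_mem' := fun {g} ⟨hg, hgℓ, hgA⟩ => ⟨hg.inv_left, fun x => by simpa using (hgℓ (g⁻¹ x)).symm,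
    fun x hx => Equiv.Perm.inv_eq_iff_eq.2 (hgA x hx).symm⟩

theorem labelStabilizer_empty (τ : Equiv.Perm X) (ℓ : X → L) : labelStabilizer τ ℓ ∅ = ⊥ :=
  (Subgroup.eq_bot_iff_forall _).2 fun _ hg => Equiv.ext fun x => hg.2.2 x (Finset.notMem_empty x)

theorem dependsOn_labelStabilizer (τ : Equiv.Perm X) (A : Finset X) :
    DependsOn (fun ℓ : X → L => labelStabilizer τ ℓ A) A := by
  intro ℓ ℓ' h
  ext g
  refine and_congr_right fun _ => and_congr_left fun hgA => forall_congr' fun x => ?_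
  by_cases hx : x ∈ A
  · have hgx : g x ∈ A := by
      by_contra hgx
      exact hgx (by rwa [g.injective (hgA _ hgx)])
    rw [h x hx, h (g x) hgx]
  · exact iff_of_true (congrArg ℓ (hgA x hx)) (congrArg ℓ' (hgA x hx))

theorem fixedPoints_subset_compl_pair {τ : Equiv.Perm X} {x : X} (hx : τ x ≠ x) :
    Function.fixedPoints τ ⊆ {x, τ x}ᶜ := by
  rintro z hz (rfl | rfl)
  · exact hx hz
  · exact hx (τ.injective hz)

theorem dependsOn_mul_card_labelStabilizer {τ : Equiv.Perm X} {A : Finset X} {x : X}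
    (hA : ∀ y, τ y ∈ A ↔ y ∈ A) (hxA : x ∉ A) (hx : τ x ≠ x) {φ : (X → L) → ℝ}
    (hφ : DependsOn φ (Function.fixedPoints τ)) :
    DependsOn (fun ℓ => φ ℓ * Nat.card (labelStabilizer τ ℓ A)) {x, τ x}ᶜ := by
  have hAsub : (A : Set X) ⊆ {x, τ x}ᶜ := by
    rintro z hz (rfl | rfl)
    · exact hxA hz
    · exact hxA ((hA x).1 hz)
  intro ℓ ℓ' h
  have hcard := congrArg (fun G : Subgroup (Equiv.Perm X) => Nat.card G)
    ((dependsOn_labelStabilizer τ A).mono hAsub h)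
  simp only [hφ.mono (fixedPoints_subset_compl_pair hx) h, hcard]

variable [DecidableEq X]

theorem mem_labelStabilizer_of_union {τ g : Equiv.Perm X} {ℓ : X → L} {A c : Finset X} {x : X}
    (hc : ∀ y ∈ c, τ.SameCycle x y) (hg : g ∈ labelStabilizer τ ℓ (A ∪ c)) (hgx : g x = x) :
    g ∈ labelStabilizer τ ℓ A := by
  obtain ⟨hcomm, hlabel, hfix⟩ := hg
  refine ⟨hcomm, hlabel, fun z hz => ?_⟩
  by_cases hzc : z ∈ c
  · obtain ⟨d, rfl⟩ := hc z hzc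
    rw [← Equiv.Perm.mul_apply, (hcomm.zpow_right d).eq, Equiv.Perm.mul_apply, hgx]
  · exact hfix z (by simp [hz, hzc])

section Collisions

variable [DecidableEq L]

theorem orbit_labelStabilizer_union_subset {τ : Equiv.Perm X} {ℓ : X → L} {A c : Finset X} {x : X}
    (hx : x ∈ c) : MulAction.orbit (labelStabilizer τ ℓ (A ∪ c)) x ⊆
      ({x} ∪ {y ∈ c.erase x | ℓ x = ℓ y} ∪ {y ∈ A | Collide τ ℓ x y} : Finset X) := by
  rintro _ ⟨⟨g, hcomm, hlabel, hfix⟩, rfl⟩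
  have hmem : g x ∈ A ∪ c := by
    by_contra hgx
    exact hgx (by simp [g.injective (hfix _ hgx), hx])
  have himage : ℓ (τ x) = ℓ (τ (g x)) := by
    rw [← Equiv.Perm.mul_apply τ g, ← hcomm.eq, Equiv.Perm.mul_apply, hlabel]
  change g x ∈ _
  grind

theorem card_labelStabilizer_union_le [Finite X] {τ : Equiv.Perm X} {ℓ : X → L} {A c : Finset X}
    {x : X} (hx : x ∈ c) (hc : ∀ y ∈ c, τ.SameCycle x y) :
    Nat.card (labelStabilizer τ ℓ (A ∪ c)) ≤ Nat.card (labelStabilizer τ ℓ A) *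
      (1 + ((c.erase x).filter fun y => ℓ x = ℓ y).card +
        (A.filter fun y => Collide τ ℓ x y).card) := by
  let G := labelStabilizer τ ℓ (A ∪ c)
  have hstab : Nat.card (MulAction.stabilizer G x) ≤ Nat.card (labelStabilizer τ ℓ A) :=
    Nat.card_le_card_of_injective
      (fun g => ⟨g.1.1, mem_labelStabilizer_of_union hc g.1.2 g.2⟩)
      fun g h hgh => Subtype.ext (Subtype.ext (Subtype.mk.inj hgh))
  have horbit : (MulAction.orbit G x).ncard ≤ 1 + ((c.erase x).filter fun y => ℓ x = ℓ y).card +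
      (A.filter fun y => Collide τ ℓ x y).card := by
    refine (Set.ncard_le_ncard (orbit_labelStabilizer_union_subset hx)).trans ?_
    rw [Set.ncard_coe_finset]
    exact (Finset.card_union_le _ _).trans
      (Nat.add_le_add_right (Finset.card_union_le _ _) _)
  calc Nat.card G
      = Nat.card (MulAction.stabilizer G x) * (MulAction.orbit G x).ncard := by
        rw [← MulAction.index_stabilizer, Subgroup.card_mul_index]
    _ ≤ _ := Nat.mul_le_mul hstab horbit

theorem mul_card_labelStabilizer_union_le [Finite X] (τ : Equiv.Perm X) {A c : Finset X} {x : X}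
    (hxc : x ∈ c) (hc : ∀ y ∈ c, τ.SameCycle x y) (ℓ : X → L) {w : ℝ} (hw : 0 ≤ w) :
    w * Nat.card (labelStabilizer τ ℓ (A ∪ c)) ≤
      w * Nat.card (labelStabilizer τ ℓ A) +
        ∑ y ∈ c.erase x, (if ℓ x = ℓ y then w * Nat.card (labelStabilizer τ ℓ A) else 0) +
        ∑ y ∈ A, if Collide τ ℓ x y then w * Nat.card (labelStabilizer τ ℓ A) else 0 := by
  refine (mul_le_mul_of_nonneg_left
    (Nat.cast_le.2 (card_labelStabilizer_union_le hxc hc)) hw).trans_eq ?_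
  rw [← Finset.sum_filter, ← Finset.sum_filter, Finset.sum_const, Finset.sum_const]
  simp only [nsmul_eq_mul]
  push_cast
  ring

theorem expect_add_sum_collide_le [Fintype X] [Fintype L] [Nonempty L] (τ : Equiv.Perm X)
    {A c : Finset X} {x : X} (hxc : x ∈ c) (hA : ∀ y, τ y ∈ A ↔ y ∈ A) (hxA : x ∉ A)
    (hx : τ x ≠ x) {ψ : (X → L) → ℝ} (hψ0 : 0 ≤ 𝔼 ℓ, ψ ℓ) (hψ : DependsOn ψ {x, τ x}ᶜ) :
    𝔼 ℓ, (ψ ℓ + ∑ y ∈ c.erase x, (if ℓ x = ℓ y then ψ ℓ else 0) +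
        ∑ y ∈ A, if Collide τ ℓ x y then ψ ℓ else 0) ≤
      (1 + (1 / Fintype.card L + Fintype.card X / Fintype.card L ^ 2)) ^ c.card * 𝔼 ℓ, ψ ℓ := by
  have hcycle : ∀ y ∈ c.erase x,
      𝔼 ℓ, (if ℓ x = ℓ y then ψ ℓ else 0) = (𝔼 ℓ, ψ ℓ) / Fintype.card L := fun y hy =>
    expect_ite_label_eq (hψ.mono (by simp)) (Finset.ne_of_mem_erase hy)
  have hcollide : ∀ y ∈ A,
      𝔼 ℓ, (if Collide τ ℓ x y then ψ ℓ else 0) = (𝔼 ℓ, ψ ℓ) / Fintype.card L ^ 2 := fun y hy =>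
    expect_ite_collide τ hψ hx (fun h => hxA (h ▸ hy)) fun h => hxA (h ▸ (hA y).2 hy)
  have hcard : ((c.erase x).card : ℝ) ≤ c.card := by exact_mod_cast Finset.card_erase_le
  have hAcard : (A.card : ℝ) ≤ c.card * Fintype.card X := by
    exact_mod_cast (Finset.card_le_univ A).trans
      (Nat.le_mul_of_pos_left _ (Finset.card_pos.2 ⟨x, hxc⟩))
  have hε : (0 : ℝ) ≤ 1 / Fintype.card L + Fintype.card X / Fintype.card L ^ 2 := by positivity
  rw [Finset.expect_add_distrib, Finset.expect_add_distrib, Finset.expect_sum_comm,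
    Finset.sum_congr rfl hcycle, Finset.expect_sum_comm, Finset.sum_congr rfl hcollide,
    Finset.sum_const, Finset.sum_const, nsmul_eq_mul, nsmul_eq_mul]
  calc 𝔼 ℓ, ψ ℓ + (c.erase x).card * ((𝔼 ℓ, ψ ℓ) / Fintype.card L) +
        A.card * ((𝔼 ℓ, ψ ℓ) / Fintype.card L ^ 2)
      ≤ 𝔼 ℓ, ψ ℓ + c.card * ((𝔼 ℓ, ψ ℓ) / Fintype.card L) +
        c.card * Fintype.card X * ((𝔼 ℓ, ψ ℓ) / Fintype.card L ^ 2) := by gcongr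
    _ = (1 + c.card * (1 / Fintype.card L + Fintype.card X / Fintype.card L ^ 2)) * 𝔼 ℓ, ψ ℓ := by
        ring
    _ ≤ _ := mul_le_mul_of_nonneg_right (one_add_mul_le_pow (by linarith) _) hψ0

end Collisions

variable [Fintype X] [Fintype L] [Nonempty L]

theorem expect_mul_card_labelStabilizer_union_le (τ : Equiv.Perm X) {A c : Finset X} {x : X}
    (hxc : x ∈ c) (hc : ∀ y ∈ c, τ.SameCycle x y) (hA : ∀ y, τ y ∈ A ↔ y ∈ A) (hxA : x ∉ A)
    (hx : τ x ≠ x) {φ : (X → L) → ℝ} (hφ0 : 0 ≤ φ)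
    (hφ : DependsOn φ (Function.fixedPoints τ)) :
    𝔼 ℓ, φ ℓ * Nat.card (labelStabilizer τ ℓ (A ∪ c)) ≤
      (1 + (1 / Fintype.card L + Fintype.card X / Fintype.card L ^ 2)) ^ c.card *
        𝔼 ℓ, φ ℓ * Nat.card (labelStabilizer τ ℓ A) := by
  classical
  exact (Finset.expect_le_expect fun ℓ _ =>
    mul_card_labelStabilizer_union_le (A := A) τ hxc hc ℓ (hφ0 ℓ)).trans <|
    expect_add_sum_collide_le τ hxc hA hxA hx
    (Finset.expect_nonneg fun ℓ _ => mul_nonneg (hφ0 ℓ) (Nat.cast_nonneg _))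
    (dependsOn_mul_card_labelStabilizer hA hxA hx hφ)

theorem expect_mul_card_labelStabilizer_le (τ : Equiv.Perm X) {φ : (X → L) → ℝ} (hφ0 : 0 ≤ φ)
    (hφ : DependsOn φ (Function.fixedPoints τ)) (A : Finset X) (hA : ∀ y, τ y ∈ A ↔ y ∈ A)
    (hAτ : ∀ y ∈ A, τ y ≠ y) :
    𝔼 ℓ, φ ℓ * Nat.card (labelStabilizer τ ℓ A) ≤
      (1 + (1 / Fintype.card L + Fintype.card X / Fintype.card L ^ 2)) ^ A.card * 𝔼 ℓ, φ ℓ := by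
  induction A using Finset.strongInduction with
  | H A ih =>
    obtain rfl | ⟨x, hx⟩ := A.eq_empty_or_nonempty
    · simp [labelStabilizer_empty]
    let c := A.filter fun y => τ.SameCycle x y
    have hcA : c ⊆ A := Finset.filter_subset _ _
    have hxc : x ∈ c := Finset.mem_filter.2 ⟨hx, Equiv.Perm.SameCycle.refl _ _⟩
    have hrest : ∀ y, τ y ∈ A \ c ↔ y ∈ A \ c := fun y => by
      simp [c, hA, Equiv.Perm.sameCycle_apply_right]
    have hind := ih (A \ c) (Finset.sdiff_ssubset hcA ⟨x, hxc⟩) hrest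
      fun y hy => hAτ y (Finset.mem_sdiff.1 hy).1
    have hpeel := expect_mul_card_labelStabilizer_union_le τ hxc
      (fun y hy => (Finset.mem_filter.1 hy).2) hrest (by simp [hxc]) (hAτ x hx) hφ0 hφ
    rw [Finset.sdiff_union_of_subset hcA] at hpeel
    refine hpeel.trans ((mul_le_mul_of_nonneg_left hind (by positivity)).trans_eq ?_)
    rw [← mul_assoc, ← pow_add, add_comm c.card, Finset.card_sdiff_add_card_eq_card hcA]

end LabelStabilizer

section Rankings

variable {X : Type*} {q N k : ℕ}

/-- The number of rankings compatible with the labels `ℓ`. -/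
noncomputable def rankingCount (N : ℕ) (τ : Equiv.Perm X) (ℓ : X → Fin q) : ℕ :=
  Nat.card {r : X ≃ Fin N // IsCompatible τ ℓ r}

theorem IsCompatible.domRestrict_fixedPoints {τ : Equiv.Perm X} {ℓ : X → Fin q} {r : X ≃ Fin N}
    (hr : IsCompatible τ ℓ r) {s : Function.fixedPoints τ ≃ Fin k}
    (hs : ∀ x y, s x < s y ↔ r x < r y) :
    IsCompatible 1 ((Function.fixedPoints τ).domRestrict ℓ) s := by
  intro x y hxy
  have h := hr x y ((hs x y).1 hxy)
  rw [x.2, y.2] at h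
  simpa only [SignedLexLT, Set.domRestrict_apply, Equiv.Perm.one_apply, hs] using h

theorem apply_eq_self_of_rank_lt_iff {τ g : Equiv.Perm X} (hg : Commute g τ)
    {s : Function.fixedPoints τ ≃ Fin k} {r r' : X ≃ Fin N} (hr : ∀ x y, s x < s y ↔ r x < r y)
    (hr' : ∀ x y, s x < s y ↔ r' x < r' y) (hrg : ∀ x, r' (g x) = r x) {x : X} (hx : τ x = x) :
    g x = x := by
  have hfixed (y : X) : g y ∈ Function.fixedPoints τ ↔ y ∈ Function.fixedPoints τ := by
    simp only [Function.mem_fixedPoints, Function.IsFixedPt]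
    rw [← Equiv.Perm.mul_apply τ, ← hg.eq, Equiv.Perm.mul_apply, g.injective.eq_iff]
  have hs : s = (g.subtypePerm hfixed).trans s := rank_equiv_unique fun y z hyz => by
    have hlt := (hr y z).1 hyz
    rw [← hrg y, ← hrg z] at hlt
    exact (hr' _ _).2 hlt
  have := s.injective (Equiv.congr_fun hs ⟨x, hx⟩)
  exact (congrArg Subtype.val this).symm

section UpperBound

variable [Fintype X] [DecidableEq X]

theorem IsCompatible.trans_symm_mem_labelStabilizer {τ : Equiv.Perm X} {ℓ : X → Fin q}
    {r r' : X ≃ Fin N} (hr : IsCompatible τ ℓ r) (hr' : IsCompatible τ ℓ r')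
    {s : Function.fixedPoints τ ≃ Fin k} (hs : ∀ x y, s x < s y ↔ r x < r y)
    (hs' : ∀ x y, s x < s y ↔ r' x < r' y) :
    r.trans r'.symm ∈ labelStabilizer τ ℓ τ.support := by
  have hcomm : Commute (r.trans r'.symm) τ := Equiv.ext (hr.trans_symm_commute hr')
  refine ⟨hcomm, hr.label_trans_symm hr', fun x hx => ?_⟩
  exact apply_eq_self_of_rank_lt_iff hcomm hs hs' (by simp) (Equiv.Perm.notMem_support.1 hx)

theorem rankingCount_le {τ : Equiv.Perm X} (hk : Fintype.card (Function.fixedPoints τ) = k)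
    (ℓ : X → Fin q) : rankingCount N τ ℓ ≤ Nat.card (labelStabilizer τ ℓ τ.support) *
      rankingCount k 1 ((Function.fixedPoints τ).domRestrict ℓ) := by
  let R := {r : X ≃ Fin N // IsCompatible τ ℓ r}
  choose res hres using fun r : R => exists_rank_equiv hk (h := fun x => r.1 x)
    (r.1.injective.comp Subtype.val_injective)
  -- Each ranking is compared with a fixed representative of its restriction to the fixed points.
  let rep (r : R) : R := Set.rangeSplitting res (Set.rangeFactorization res r)
  have hrep (r : R) : res (rep r) = res r :=
    Set.apply_rangeSplitting res (Set.rangeFactorization res r)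
  have hmem (r : R) := r.2.trans_symm_mem_labelStabilizer (rep r).2 (hres r) (hrep r ▸ hres (rep r))
  refine (Nat.card_le_card_of_injective (β := labelStabilizer τ ℓ τ.support × {s // _})
    (fun r : R => (⟨_, hmem r⟩, ⟨res r, r.2.domRestrict_fixedPoints (hres r)⟩))
    fun r r' h => ?_).trans_eq (Nat.card_prod _ _)
  obtain ⟨htrans, hrestrict⟩ := Prod.mk.inj h
  have hrep_eq : rep r = rep r' :=
    congrArg (Set.rangeSplitting res) (Subtype.ext (Subtype.mk.inj hrestrict))
  ext x
  have hx := Equiv.congr_fun (Subtype.mk.inj htrans) x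
  simp only [hrep_eq, Equiv.trans_apply, EmbeddingLike.apply_eq_iff_eq] at hx
  exact congrArg Fin.val hx

end UpperBound

section LowerBound

theorem IsKey.domRestrict_fixedPoints {τ : Equiv.Perm X} {ℓ : X → Fin q} {β : ℝ} {v : X → ℝ}
    (hv : IsKey τ ℓ β v) :
    IsKey 1 ((Function.fixedPoints τ).domRestrict ℓ) β
      ((Function.fixedPoints τ).domRestrict v) where
  pos := hv.pos
  lt_one := hv.lt_one
  eq x := by
    have h := hv.eq x
    rwa [x.2] at h
  abs_lt_half x := hv.abs_lt_half x

theorem IsKey.exists_isCompatible_extending [Fintype X] {τ : Equiv.Perm X} {ℓ : X → Fin q} {β : ℝ}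
    {v : X → ℝ} (hv : IsKey τ ℓ β v) (hN : Fintype.card X = N)
    (hτ : ∀ x, τ x ≠ x → ∀ y ≠ x, ¬Collide τ ℓ x y) {s : Function.fixedPoints τ ≃ Fin k}
    (hs : IsCompatible 1 ((Function.fixedPoints τ).domRestrict ℓ) s) :
    ∃ r : X ≃ Fin N, IsCompatible τ ℓ r ∧ ∀ x y, s x < s y → r x < r y := by
  classical
  have hfixed {x y : X} (hxy : x ≠ y) (h : v x = v y) : τ x = x := by
    by_contra hx
    exact hτ x hx y hxy.symm ⟨hv.label_eq h, hv.label_eq (hv.apply_eq h)⟩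
  let tie (x : X) : ℕ := if hx : τ x = x then s ⟨x, hx⟩ else 0
  have htie (x : Function.fixedPoints τ) : tie x = s x := dif_pos x.2
  have hinj : Function.Injective fun x => toLex (v x, tie x) := fun x y h => by
    obtain ⟨hxy, ht⟩ := Prod.mk.inj (toLex.injective h)
    by_contra hne
    rw [htie ⟨x, hfixed hne hxy⟩, htie ⟨y, hfixed (Ne.symm hne) hxy.symm⟩] at ht
    exact hne (congrArg Subtype.val (s.injective (Fin.val_injective ht)))
  obtain ⟨r, hr⟩ := exists_rank_equiv hN hinj
  simp only [Prod.Lex.toLex_lt_toLex] at hr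
  have hrv : ∀ x y, v x < v y → r x < r y := fun x y h => (hr x y).2 (Or.inl h)
  have hrs : ∀ x y, s x < s y → r x < r y := fun x y h => (hr x y).2 <| by
    obtain hlt | heq := (hv.domRestrict_fixedPoints.le_of_lt hs h).lt_or_eq
    · exact Or.inl hlt
    · exact Or.inr ⟨heq, by simpa only [htie, Fin.val_fin_lt] using h⟩
  refine ⟨r, fun x y hxy => ?_, hrs⟩
  obtain hlt | ⟨heq, ht⟩ := (hr x y).1 hxy
  · exact hv.signedLexLT_of_lt hrv hlt
  · have hne : x ≠ y := ne_of_apply_ne r hxy.ne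
    lift x to Function.fixedPoints τ using hfixed hne heq
    lift y to Function.fixedPoints τ using hfixed hne.symm heq.symm
    rw [htie, htie, Fin.val_fin_lt] at ht
    have hlabel := hv.label_eq heq
    have hlex : if Even (ℓ x : ℕ) then s y < s x else s x < s y :=
      ((hs x y ht).resolve_left (by simp [hlabel])).2
    rw [x.2, y.2]
    refine Or.inr ⟨hlabel, ?_⟩
    simp only
    split_ifs with heven
    · rw [if_pos heven] at hlex
      exact absurd hlex ht.not_gt
    · exact hxy

theorem rankingCount_domRestrict_le [Fintype X] (hN : Fintype.card X = N) {τ : Equiv.Perm X}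
    {ℓ : X → Fin q} (hτ : ∀ x, τ x ≠ x → ∀ y ≠ x, ¬Collide τ ℓ x y) :
    rankingCount k 1 ((Function.fixedPoints τ).domRestrict ℓ) ≤ rankingCount N τ ℓ := by
  obtain ⟨β, v, hv⟩ := exists_isKey τ ℓ
  choose ext hext hlt using fun s : {s : Function.fixedPoints τ ≃ Fin k // IsCompatible 1 _ s} =>
    hv.exists_isCompatible_extending hN hτ s.2
  refine Nat.card_le_card_of_injective (fun s => ⟨ext s, hext s⟩) fun s s' h => Subtype.ext ?_
  refine rank_equiv_unique fun x y hxy => ?_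
  obtain h' | h' | h' := lt_trichotomy (s'.1 x) (s'.1 y)
  · exact h'
  · exact absurd (s'.1.injective h') (ne_of_apply_ne s.1 hxy.ne)
  · have := hlt s x y hxy
    rw [Subtype.mk.inj h] at this
    exact absurd this (hlt s' y x h').not_gt

theorem sub_sum_collide_le_rankingCount [Fintype X] [DecidableEq X] (hN : Fintype.card X = N)
    (τ : Equiv.Perm X) (ℓ : X → Fin q) {w : ℝ}
    (hw : rankingCount k 1 ((Function.fixedPoints τ).domRestrict ℓ) = w) :
    w - ∑ x ∈ τ.support, ∑ y ∈ Finset.univ.erase x, (if Collide τ ℓ x y then w else 0) ≤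
      rankingCount N τ ℓ := by
  have hw0 : 0 ≤ w := hw ▸ Nat.cast_nonneg _
  by_cases hτ : ∀ x, τ x ≠ x → ∀ y ≠ x, ¬Collide τ ℓ x y
  · refine (sub_le_self _ (by positivity)).trans ?_
    rw [← hw]
    exact Nat.cast_le.2 (rankingCount_domRestrict_le hN hτ)
  · push Not at hτ
    obtain ⟨x, hx, y, hyx, hcollide⟩ := hτ
    refine (sub_nonpos.2 ?_).trans (Nat.cast_nonneg _)
    calc w = if Collide τ ℓ x y then w else 0 := (if_pos hcollide).symm
      _ ≤ ∑ y ∈ Finset.univ.erase x, if Collide τ ℓ x y then w else 0 :=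
        Finset.single_le_sum (f := fun y => if Collide τ ℓ x y then w else 0)
          (fun _ _ => by positivity) (by simp [hyx])
      _ ≤ _ := Finset.single_le_sum
          (f := fun x => ∑ y ∈ Finset.univ.erase x, if Collide τ ℓ x y then w else 0)
          (fun _ _ => by positivity) (Equiv.Perm.mem_support.2 hx)

end LowerBound

theorem card_isCompatible_eq_compatibleCount (τ : Equiv.Perm X) (r : X ≃ Fin N) :
    Nat.card {ℓ : X → Fin q // IsCompatible τ ℓ r} = compatibleCount q (r.permCongr τ) := by
  refine Nat.card_congr ((r.arrowCongr (Equiv.refl (Fin q))).subtypeEquiv fun ℓ => ?_)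
  simp only [IsCompatible, r.symm.forall_congr_left]
  simp

section Expectation

open scoped BigOperators

variable [Fintype X] [DecidableEq X]

theorem expect_rankingCount_eq (hN : Fintype.card X = N) (τ : Equiv.Perm X) :
    𝔼 ℓ : X → Fin q, (rankingCount N τ ℓ : ℝ) =
      𝔼 r : X ≃ Fin N, (N.factorial * compatibleCount q (r.permCongr τ) / q ^ N : ℝ) := by
  classical
  have hswap : ∑ ℓ : X → Fin q, rankingCount N τ ℓ =
      ∑ r : X ≃ Fin N, compatibleCount q (r.permCongr τ) := by
    simp only [← card_isCompatible_eq_compatibleCount, rankingCount, Nat.card_eq_fintype_card,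
      Fintype.card_subtype]
    exact Finset.sum_card_bipartiteAbove_eq_sum_card_bipartiteBelow _
  rw [Fintype.expect_eq_sum_div_card, Fintype.expect_eq_sum_div_card, ← Nat.cast_sum, hswap,
    Fintype.card_equiv (Fintype.equivFinOfCardEq hN), Fintype.card_fun, Fintype.card_fin, hN,
    ← Finset.sum_div, ← Finset.mul_sum]
  have := N.factorial_ne_zero
  push_cast
  field_simp

variable [NeZero q]

theorem expect_rankingCount_le (hN : Fintype.card X = N) {τ : Equiv.Perm X}
    (hk : Fintype.card (Function.fixedPoints τ) = k) :
    𝔼 ℓ : X → Fin q, (rankingCount N τ ℓ : ℝ) ≤ (1 + (1 / q + N / q ^ 2)) ^ N *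
      𝔼 ℓ : Function.fixedPoints τ → Fin q, (rankingCount k 1 ℓ : ℝ) := by
  let φ (ℓ : X → Fin q) : ℝ := rankingCount k 1 ((Function.fixedPoints τ).domRestrict ℓ)
  have hφ0 : 0 ≤ φ := fun ℓ => Nat.cast_nonneg _
  have hφ : DependsOn φ (Function.fixedPoints τ) := fun ℓ ℓ' h => by
    simp only [φ, Set.dependsOn_domRestrict _ h]
  have hpeel := expect_mul_card_labelStabilizer_le τ hφ0 hφ τ.support
    (fun y => Equiv.Perm.apply_mem_support) fun y => Equiv.Perm.mem_support.1
  have hsupport : τ.support.card ≤ N := hN ▸ Finset.card_le_univ _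
  rw [hN, Fintype.card_fin] at hpeel
  calc 𝔼 ℓ : X → Fin q, (rankingCount N τ ℓ : ℝ)
      ≤ 𝔼 ℓ, φ ℓ * Nat.card (labelStabilizer τ ℓ τ.support) := Finset.expect_le_expect fun ℓ _ => by
        rw [mul_comm, ← Nat.cast_mul]
        exact Nat.cast_le.2 (rankingCount_le hk ℓ)
    _ ≤ (1 + (1 / q + N / q ^ 2)) ^ τ.support.card * 𝔼 ℓ, φ ℓ := hpeel
    _ ≤ (1 + (1 / q + N / q ^ 2)) ^ N * 𝔼 ℓ, φ ℓ := mul_le_mul_of_nonneg_right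
        (pow_le_pow_right₀ (le_add_of_nonneg_right (by positivity)) hsupport)
        (Finset.expect_nonneg fun ℓ _ => hφ0 ℓ)
    _ = _ := by rw [expect_domRestrict _ fun ℓ => (rankingCount k 1 ℓ : ℝ)]

theorem expect_ite_collide_le {τ : Equiv.Perm X} {x y : X} (hx : τ x ≠ x) (hyx : y ≠ x)
    {φ : (X → Fin q) → ℝ} (hφ0 : 0 ≤ φ) (hφ : DependsOn φ {x, τ x}ᶜ) :
    𝔼 ℓ, (if Collide τ ℓ x y then φ ℓ else 0) ≤
      (if y = τ⁻¹ x then (𝔼 ℓ, φ ℓ) / q else 0) + (𝔼 ℓ, φ ℓ) / q ^ 2 := by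
  have hE : 0 ≤ 𝔼 ℓ, φ ℓ := Finset.expect_nonneg fun ℓ _ => hφ0 ℓ
  split_ifs with hy
  · have hlabel := expect_ite_label_eq (hφ.mono (by simp)) hyx
    rw [Fintype.card_fin] at hlabel
    refine le_add_of_le_of_nonneg (hlabel ▸ Finset.expect_le_expect fun ℓ _ => ?_) (by positivity)
    have := hφ0 ℓ
    split_ifs with hcollide hne
    exacts [le_rfl, absurd hcollide.1 hne, this, le_rfl]
  · rw [zero_add, expect_ite_collide τ hφ hx hyx fun h => hy (Equiv.Perm.eq_inv_iff_eq.2 h),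
      Fintype.card_fin]

theorem sum_expect_ite_collide_le (hN : Fintype.card X = N) {τ : Equiv.Perm X} {x : X}
    (hx : τ x ≠ x) {φ : (X → Fin q) → ℝ} (hφ0 : 0 ≤ φ) (hφ : DependsOn φ {x, τ x}ᶜ) :
    ∑ y ∈ Finset.univ.erase x, 𝔼 ℓ, (if Collide τ ℓ x y then φ ℓ else 0) ≤
      (1 / q + N / q ^ 2) * 𝔼 ℓ, φ ℓ := by
  have hE : 0 ≤ 𝔼 ℓ, φ ℓ := Finset.expect_nonneg fun ℓ _ => hφ0 ℓ
  calc _ ≤ ∑ y ∈ Finset.univ.erase x,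
          ((if y = τ⁻¹ x then (𝔼 ℓ, φ ℓ) / q else 0) + (𝔼 ℓ, φ ℓ) / q ^ 2) :=
        Finset.sum_le_sum fun y hy => expect_ite_collide_le hx (Finset.ne_of_mem_erase hy) hφ0 hφ
    _ ≤ ∑ y, ((if y = τ⁻¹ x then (𝔼 ℓ, φ ℓ) / q else 0) + (𝔼 ℓ, φ ℓ) / q ^ 2) :=
        Finset.sum_le_sum_of_subset_of_nonneg (Finset.erase_subset _ _) fun y _ _ => by positivity
    _ = (1 / q + N / q ^ 2) * 𝔼 ℓ, φ ℓ := by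
        rw [Finset.sum_add_distrib, Finset.sum_ite_eq', if_pos (Finset.mem_univ _),
          Finset.sum_const, Finset.card_univ, hN, nsmul_eq_mul]
        ring

theorem le_expect_rankingCount (hN : Fintype.card X = N) (τ : Equiv.Perm X) :
    (1 - N * (1 / q + N / q ^ 2)) *
        𝔼 ℓ : Function.fixedPoints τ → Fin q, (rankingCount k 1 ℓ : ℝ) ≤
      𝔼 ℓ : X → Fin q, (rankingCount N τ ℓ : ℝ) := by
  let φ (ℓ : X → Fin q) : ℝ := rankingCount k 1 ((Function.fixedPoints τ).domRestrict ℓ)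
  have hφ0 : 0 ≤ φ := fun ℓ => Nat.cast_nonneg _
  have hφ : DependsOn φ (Function.fixedPoints τ) := fun ℓ ℓ' h => by
    simp only [φ, Set.dependsOn_domRestrict _ h]
  have : 0 ≤ 𝔼 ℓ, φ ℓ := Finset.expect_nonneg fun ℓ _ => hφ0 ℓ
  have hsupport : (τ.support.card : ℝ) ≤ N := hN ▸ Nat.cast_le.2 (Finset.card_le_univ _)
  have hcollide : ∑ x ∈ τ.support, ∑ y ∈ Finset.univ.erase x,
      𝔼 ℓ, (if Collide τ ℓ x y then φ ℓ else 0) ≤ N * ((1 / q + N / q ^ 2) * 𝔼 ℓ, φ ℓ) :=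
    (Finset.sum_le_card_nsmul _ _ _ fun x hx => by
      have hx := Equiv.Perm.mem_support.1 hx
      exact sum_expect_ite_collide_le hN hx hφ0
        (hφ.mono (fixedPoints_subset_compl_pair hx))).trans
      (by rw [nsmul_eq_mul]; gcongr)
  calc _ = 𝔼 ℓ, φ ℓ - N * ((1 / q + N / q ^ 2) * 𝔼 ℓ, φ ℓ) := by
        rw [expect_domRestrict _ fun ℓ => (rankingCount k 1 ℓ : ℝ)]
        ring
    _ ≤ 𝔼 ℓ, (φ ℓ - ∑ x ∈ τ.support, ∑ y ∈ Finset.univ.erase x,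
          if Collide τ ℓ x y then φ ℓ else 0) := by
        simp only [Finset.expect_sub_distrib, Finset.expect_sum_comm]
        linarith
    _ ≤ _ := Finset.expect_le_expect fun ℓ _ => sub_sum_collide_le_rankingCount hN τ ℓ rfl

theorem expect_rankingCount_eq_expect_labelRatio {a : ℕ} (hN : Fintype.card X = N) (ha : N ≤ a)
    (ha0 : 0 < a) (τ : Equiv.Perm X) :
    𝔼 ℓ : X → Fin (2 * a), (rankingCount N τ ℓ : ℝ) =
      𝔼 r : X ≃ Fin N, labelRatio a N (N - 1 - 2 * peaks (r.permCongr τ)) := by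
  rw [expect_rankingCount_eq hN]
  push_cast
  simp only [compatibleCount_eq_labelRatio ha ha0]

theorem peaks_one (k : ℕ) : peaks (1 : Equiv.Perm (Fin k)) = 0 := by
  refine Finset.card_eq_zero.2 (Finset.filter_eq_empty_iff.2 ?_)
  rintro i - ⟨_, b, -, hib, -, hbi⟩
  have : (b : ℕ) < i := hbi
  omega

theorem expect_rankingCount_one {a : ℕ} (hN : Fintype.card X = N) (ha : N ≤ a) (ha0 : 0 < a) :
    𝔼 ℓ : X → Fin (2 * a), (rankingCount N 1 ℓ : ℝ) = labelRatio a N (N - 1) := by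
  have : Nonempty (X ≃ Fin N) := ⟨Fintype.equivFinOfCardEq hN⟩
  have hone (r : X ≃ Fin N) : r.permCongr 1 = 1 := by
    ext
    simp
  simp only [expect_rankingCount_eq_expect_labelRatio hN ha ha0, hone, peaks_one, mul_zero,
    Nat.sub_zero, Fintype.expect_const]

theorem card_fixedPoints_eq_numFixedPoints {n : ℕ} (τ : Equiv.Perm (Fin n)) :
    Fintype.card (Function.fixedPoints τ) = numFixedPoints τ :=
  Fintype.card_subtype _

theorem numFixedPoints_le {n : ℕ} (τ : Equiv.Perm (Fin n)) : numFixedPoints τ ≤ n :=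
  (Finset.card_le_univ _).trans_eq (Fintype.card_fin n)

theorem expect_labelRatio_le {n a : ℕ} (ha : n ≤ a) (ha0 : 0 < a) (τ : Equiv.Perm (Fin n)) :
    𝔼 r : Equiv.Perm (Fin n), labelRatio a n (n - 1 - 2 * peaks (r * τ * r⁻¹)) ≤
      (1 + (1 / (2 * a) + n / (2 * a) ^ 2)) ^ n *
        labelRatio a (numFixedPoints τ) (numFixedPoints τ - 1) := by
  have : NeZero (2 * a) := ⟨by omega⟩
  have hk := card_fixedPoints_eq_numFixedPoints τ
  have h := expect_rankingCount_le (q := 2 * a) (Fintype.card_fin n) hk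
  rw [expect_rankingCount_eq_expect_labelRatio (Fintype.card_fin n) ha ha0,
    expect_rankingCount_one hk ((numFixedPoints_le τ).trans ha) ha0] at h
  exact_mod_cast h

theorem le_expect_labelRatio {n a : ℕ} (ha : n ≤ a) (ha0 : 0 < a) (τ : Equiv.Perm (Fin n)) :
    (1 - n * (1 / (2 * a) + n / (2 * a) ^ 2)) *
        labelRatio a (numFixedPoints τ) (numFixedPoints τ - 1) ≤
      𝔼 r : Equiv.Perm (Fin n), labelRatio a n (n - 1 - 2 * peaks (r * τ * r⁻¹)) := by
  have : NeZero (2 * a) := ⟨by omega⟩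
  have hk := card_fixedPoints_eq_numFixedPoints τ
  have h := le_expect_rankingCount (q := 2 * a) (k := numFixedPoints τ) (Fintype.card_fin n) τ
  rw [expect_rankingCount_eq_expect_labelRatio (Fintype.card_fin n) ha ha0,
    expect_rankingCount_one hk ((numFixedPoints_le τ).trans ha) ha0] at h
  exact_mod_cast h

end Expectation

end Rankings

section Asymptotics

theorem abs_log_one_add_sub_le {z y : ℝ} (hz : |z| ≤ y) (hy : y ≤ 1 / 2) :
    |Real.log (1 + z) - (z - z ^ 2 / 2 + z ^ 3 / 3 - z ^ 4 / 4)| ≤ 2 * y ^ 5 := by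
  have htaylor := Real.abs_log_sub_add_sum_range_le (x := -z) (by rw [abs_neg]; linarith) 4
  have hremainder : |z| ^ (4 + 1) / (1 - |z|) ≤ 2 * y ^ 5 := by
    rw [div_le_iff₀ (by linarith)]
    have hpow : |z| ^ (4 + 1) ≤ y ^ 5 := pow_le_pow_left₀ (abs_nonneg z) hz 5
    nlinarith [pow_nonneg ((abs_nonneg z).trans hz) 5]
  rw [abs_neg, sub_neg_eq_add] at htaylor
  refine le_trans (le_of_eq ?_) (htaylor.trans hremainder)
  simp only [Finset.sum_range_succ, Finset.sum_range_zero]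
  norm_num
  ring_nf

theorem sum_range_sub_pow_one (k : ℕ) (c : ℝ) :
    ∑ i ∈ Finset.range k, ((i : ℝ) - c) = k * (k - 1) / 2 - k * c := by
  induction k with
  | zero => simp
  | succ k ih => rw [Finset.sum_range_succ, ih]; push_cast; ring

theorem sum_range_sub_pow_two (k : ℕ) (c : ℝ) :
    ∑ i ∈ Finset.range k, ((i : ℝ) - c) ^ 2 =
      (k - 1) * k * (2 * k - 1) / 6 - c * (k * (k - 1)) + k * c ^ 2 := by
  induction k with
  | zero => simp
  | succ k ih => rw [Finset.sum_range_succ, ih]; push_cast; ring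

theorem sum_range_sub_pow_three (k : ℕ) (c : ℝ) :
    ∑ i ∈ Finset.range k, ((i : ℝ) - c) ^ 3 =
      (k * (k - 1) / 2) ^ 2 - 3 * c * ((k - 1) * k * (2 * k - 1) / 6) +
        3 * c ^ 2 * (k * (k - 1) / 2) - k * c ^ 3 := by
  induction k with
  | zero => simp
  | succ k ih => rw [Finset.sum_range_succ, ih]; push_cast; ring

theorem sum_range_sub_pow_four (k : ℕ) (c : ℝ) :
    ∑ i ∈ Finset.range k, ((i : ℝ) - c) ^ 4 =
      k * (k - 1) * (2 * k - 1) * (3 * k ^ 2 - 3 * k - 1) / 30 -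
        4 * c * (k * (k - 1) / 2) ^ 2 + 6 * c ^ 2 * ((k - 1) * k * (2 * k - 1) / 6) -
        4 * c ^ 3 * (k * (k - 1) / 2) + k * c ^ 4 := by
  induction k with
  | zero => simp
  | succ k ih => rw [Finset.sum_range_succ, ih]; push_cast; ring

/-- The fourth order expansion in `1 / a` of `∑ i < k, log (1 + (i - (k - 1) / 2 - J) / a)`. -/
noncomputable def logSumExpansion (a k J : ℝ) : ℝ :=
  -(k * J) / a - ((k ^ 3 - k) / 12 + k * J ^ 2) / (2 * a ^ 2) -
    ((k ^ 3 - k) / 4 * J + k * J ^ 3) / (3 * a ^ 3) -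
    ((3 * k ^ 5 - 10 * k ^ 3 + 7 * k) / 240 + (k ^ 3 - k) / 2 * J ^ 2 + k * J ^ 4) / (4 * a ^ 4)

theorem sum_range_taylor_eq_logSumExpansion (a J : ℝ) (k : ℕ) :
    ∑ i ∈ Finset.range k, ((i - ((k - 1) / 2 + J)) / a - ((i - ((k - 1) / 2 + J)) / a) ^ 2 / 2 +
      ((i - ((k - 1) / 2 + J)) / a) ^ 3 / 3 - ((i - ((k - 1) / 2 + J)) / a) ^ 4 / 4) =
      logSumExpansion a k J := by
  rw [Finset.sum_sub_distrib, Finset.sum_add_distrib, Finset.sum_sub_distrib]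
  simp only [div_pow, ← Finset.sum_div]
  rw [sum_range_sub_pow_one, sum_range_sub_pow_two, sum_range_sub_pow_three,
    sum_range_sub_pow_four, logSumExpansion]
  ring

theorem abs_sum_log_sub_le {k : ℕ} {a J y : ℝ} (hy : y ≤ 1 / 2)
    (hz : ∀ i ∈ Finset.range k, |((i - ((k : ℝ) - 1) / 2) - J) / a| ≤ y) :
    |∑ i ∈ Finset.range k, Real.log (1 + ((i - ((k : ℝ) - 1) / 2) - J) / a) -
      logSumExpansion a k J| ≤ k * (2 * y ^ 5) := by
  simp only [sub_sub] at hz ⊢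
  rw [← sum_range_taylor_eq_logSumExpansion, ← Finset.sum_sub_distrib]
  calc _ ≤ ∑ i ∈ Finset.range k, 2 * y ^ 5 :=
        (Finset.abs_sum_le_sum_abs _ _).trans
          (Finset.sum_le_sum fun i hi => abs_log_one_add_sub_le (hz i hi) hy)
    _ = _ := by rw [Finset.sum_const, Finset.card_range, nsmul_eq_mul]

/-- The fourth order expansion in `x` of `-j log (1 - x / 2) - (m - j) log (1 + x / 2)`, where
`J = j - m / 2`. -/
noncomputable def tiltExpansion (x m J : ℝ) : ℝ :=
  J * x + J * x ^ 3 / 12 + m * x ^ 2 / 8 + m * x ^ 4 / 64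

theorem abs_tilt_sub_le {m j : ℕ} (hj : j ≤ m) {x y : ℝ} (hx0 : 0 ≤ x) (hxy : x ≤ y)
    (hy : y ≤ 1 / 2) :
    |(-(j * Real.log (1 - x / 2)) - (m - j) * Real.log (1 + x / 2)) -
      tiltExpansion x m (j - m / 2)| ≤ m * y ^ 5 := by
  have hbound : 2 * (y / 2) ^ 5 ≤ y ^ 5 := by
    linear_combination 15 / 16 * pow_nonneg (hx0.trans hxy) 5
  have hminus := (abs_log_one_add_sub_le (z := -(x / 2)) (y := y / 2)
    (by rw [abs_neg, abs_of_nonneg (by linarith)]; linarith) (by linarith)).trans hbound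
  have hplus := (abs_log_one_add_sub_le (z := x / 2) (y := y / 2)
    (by rw [abs_of_nonneg (by linarith)]; linarith) (by linarith)).trans hbound
  rw [← sub_eq_add_neg] at hminus
  have hmj : (0 : ℝ) ≤ m - j := sub_nonneg.2 (by exact_mod_cast hj)
  set eminus := Real.log (1 - x / 2) - _
  set eplus := Real.log (1 + x / 2) - _
  calc _ = |-(j * eminus) + -((m - j) * eplus)| := by
        congr 1
        simp only [eminus, eplus, tiltExpansion]
        ring
    _ ≤ j * |eminus| + (m - j) * |eplus| := by
        refine (abs_add_le _ _).trans_eq ?_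
        rw [abs_neg, abs_neg, abs_mul, abs_mul, Nat.abs_cast, abs_of_nonneg hmj]
    _ ≤ j * y ^ 5 + (m - j) * y ^ 5 := by gcongr
    _ = m * y ^ 5 := by ring

/-- The exponent `L` with `labelRatio a k m ≈ exp L` when `k`, `m` are of order `n` and `a` is of
order at least `n ^ (5 / 4)`. -/
noncomputable def ratioExponent (a k m : ℝ) : ℝ :=
  -k ^ 3 / (24 * a ^ 2) + k ^ 2 * m / (8 * a ^ 2) +
    (-k ^ 5 / 320 + k ^ 4 * m / 64 - k ^ 3 * m ^ 2 / 32) / a ^ 4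

/-- The difference between `logSumExpansion + tiltExpansion` and `ratioExponent`, in terms of
`x = k / a`, `s = 1 / a`, the centred binomial variable `J` and its mean `μ` under the tilted
weights. -/
noncomputable def exponentDeviation (x s μ J : ℝ) : ℝ :=
  -(x * s) * ((J ^ 2 - μ ^ 2) / 2 + J ^ 2 * (J * s / 3 + (x ^ 2 - s ^ 2) / 8 + (J * s) ^ 2 / 4)) +
    (x * s / 24 + x * (J * s) * s / 12 + (10 * x ^ 3 * s - 7 * x * s ^ 3) / 960)

theorem logSumExpansion_add_tiltExpansion_sub_ratioExponent {a k m J : ℝ} (ha : a ≠ 0) :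
    logSumExpansion a k J + tiltExpansion (k / a) m J - ratioExponent a k m =
      exponentDeviation (k / a) (1 / a) (-(m * (k / a) / 4)) J := by
  unfold logSumExpansion tiltExpansion ratioExponent exponentDeviation
  field_simp
  ring

section Deviation

variable {n x y s w u μ J D ρ e K : ℝ}

theorem abs_deviation_factor_le (hx0 : 0 ≤ x) (hxy : x ≤ y) (hs0 : 0 ≤ s) (hsy : s ≤ y)
    (hy1 : y ≤ 1) (hw : |w| ≤ y / 2) : |w / 3 + (x ^ 2 - s ^ 2) / 8 + w ^ 2 / 4| ≤ y / 2 := by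
  have hyy : y ^ 2 ≤ y := pow_le_of_le_one (hx0.trans hxy) hy1 two_ne_zero
  have hw2 : w ^ 2 ≤ y ^ 2 / 4 := by
    linear_combination sq_le_sq' (abs_le.1 hw).1 (abs_le.1 hw).2
  have hx2 : x ^ 2 ≤ y ^ 2 := pow_le_pow_left₀ hx0 hxy 2
  have hs2 : s ^ 2 ≤ y ^ 2 := pow_le_pow_left₀ hs0 hsy 2
  obtain ⟨hlower, hupper⟩ := abs_le.1 hw
  rw [abs_le]
  constructor <;> linarith [sq_nonneg x, sq_nonneg s, sq_nonneg w]

theorem abs_deviation_residual_le (hx0 : 0 ≤ x) (hxy : x ≤ y) (hs0 : 0 ≤ s) (hsy : s ≤ y)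
    (hy1 : y ≤ 1) (hw : |w| ≤ y / 2) :
    |x * s / 24 + x * w * s / 12 + (10 * x ^ 3 * s - 7 * x * s ^ 3) / 960| ≤ y / 2 := by
  have hxs : x * s ≤ y := by
    simpa only [mul_one] using mul_le_mul hxy (hsy.trans hy1) hs0 (hx0.trans hxy)
  have hfactor : |1 / 24 + w / 12 + (10 * x ^ 2 - 7 * s ^ 2) / 960| ≤ 1 / 2 := by
    have hx1 : x ^ 2 ≤ 1 := pow_le_one₀ hx0 (hxy.trans hy1)
    have hs1 : s ^ 2 ≤ 1 := pow_le_one₀ hs0 (hsy.trans hy1)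
    obtain ⟨hlower, hupper⟩ := abs_le.1 hw
    rw [abs_le]
    constructor <;> linarith [sq_nonneg x, sq_nonneg s]
  calc _ = x * s * |1 / 24 + w / 12 + (10 * x ^ 2 - 7 * s ^ 2) / 960| := by
        rw [← abs_of_nonneg (mul_nonneg hx0 hs0), ← abs_mul, abs_of_nonneg (mul_nonneg hx0 hs0)]
        ring_nf
    _ ≤ y * (1 / 2) := mul_le_mul hxs hfactor (abs_nonneg _) (hx0.trans hxy)
    _ = y / 2 := by ring

theorem exists_exponentDeviation_eq (hn : 1 ≤ n) (hx0 : 0 ≤ x) (hxy : x ≤ y) (hy1 : y ≤ 1)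
    (hs0 : 0 ≤ s) (hs : s * n = y) (hJ : |J| ≤ n / 2) :
    ∃ ρ e : ℝ, |ρ| ≤ y / 2 ∧ |e| ≤ y / 2 ∧
      ∀ μ, exponentDeviation x s μ J = -(x * s) * ((J ^ 2 - μ ^ 2) / 2 + J ^ 2 * ρ) + e := by
  have hsy : s ≤ y := hs ▸ le_mul_of_one_le_right hs0 hn
  have hw : |J * s| ≤ y / 2 := by
    rw [abs_mul, abs_of_nonneg hs0, ← hs]
    calc |J| * s ≤ n / 2 * s := by gcongr
      _ = s * n / 2 := by ring
  exact ⟨_, _, abs_deviation_factor_le hx0 hxy hs0 hsy hy1 hw,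
    abs_deviation_residual_le hx0 hxy hs0 hsy hy1 hw, fun _ => rfl⟩

theorem mul_sq_mean_le (hn : 0 ≤ n) (hu0 : 0 ≤ u) (hun : u * n ≤ y ^ 2) (hμ : |μ| ≤ n * y / 4)
    (hK : n * y ^ 4 ≤ K) : u * μ ^ 2 ≤ K / 16 :=
  calc u * μ ^ 2 ≤ u * (n * y / 4) ^ 2 := by
        have := sq_le_sq' (abs_le.1 hμ).1 (abs_le.1 hμ).2
        gcongr
    _ = (u * n) * (n * y ^ 2) / 16 := by ring
    _ ≤ y ^ 2 * (n * y ^ 2) / 16 := by gcongr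
    _ = n * y ^ 4 / 16 := by ring
    _ ≤ K / 16 := by gcongr

theorem deviation_le (hn : 0 ≤ n) (hy1 : y ≤ 1) (hu0 : 0 ≤ u) (hun : u * n ≤ y ^ 2)
    (hμ : |μ| ≤ n * y / 4) (hρ : |ρ| ≤ y / 2) (he : |e| ≤ y / 2) (hK : n * y ^ 4 ≤ K) :
    -u * ((J ^ 2 - μ ^ 2) / 2 + J ^ 2 * ρ) + e ≤ K / 32 + 1 := by
  have hquadratic : 0 ≤ u * (J ^ 2 * (1 / 2 + ρ)) :=
    mul_nonneg hu0 (mul_nonneg (sq_nonneg J) (by linarith [(abs_le.1 hρ).1]))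
  linarith [mul_sq_mean_le hn hu0 hun hμ hK, (abs_le.1 he).2]

theorem le_div_of_mul_le_sq (hn : 0 < n) (hy0 : 0 ≤ y) (hy1 : y ≤ 1) (hun : u * n ≤ y ^ 2) :
    u ≤ y / n :=
  (le_div_iff₀ hn).2 (hun.trans (pow_le_of_le_one hy0 hy1 two_ne_zero))

theorem abs_deviation_linear_le (hn : 0 < n) (hy0 : 0 ≤ y) (hu0 : 0 ≤ u)
    (hun : u * n ≤ y ^ 2) (hμ : |μ| ≤ n * y / 4) (hK : n * y ^ 4 ≤ K) :
    |u * (μ * D)| ≤ (K * (y / n * D ^ 2) + y) / 8 :=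
  calc |u * (μ * D)| = u * (|μ| * |D|) := by rw [abs_mul, abs_mul, abs_of_nonneg hu0]
    _ ≤ u * (n * y / 4 * |D|) := by gcongr
    _ = u * n * (y / 4 * |D|) := by ring
    _ ≤ y ^ 2 * (y / 4 * |D|) := by gcongr
    _ = y / 8 * (2 * (y ^ 2 * |D|) * 1) := by ring
    _ ≤ y / 8 * ((y ^ 2 * |D|) ^ 2 + 1 ^ 2) := by gcongr; exact two_mul_le_add_sq _ _
    _ = (n * y ^ 4 * (y / n * |D| ^ 2) + y) / 8 := by field_simp
    _ ≤ (K * (y / n * D ^ 2) + y) / 8 := by rw [sq_abs]; gcongr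

theorem abs_deviation_quadratic_le (hn : 0 < n) (hy0 : 0 ≤ y) (hy1 : y ≤ 1)
    (hu0 : 0 ≤ u) (hun : u * n ≤ y ^ 2) (hμ : |μ| ≤ n * y / 4) (hK : n * y ^ 4 ≤ K) :
    |u * (((D + μ) ^ 2 - μ ^ 2) / 2)| ≤ y / n * D ^ 2 / 2 + (K * (y / n * D ^ 2) + y) / 8 :=
  calc _ = |u * D ^ 2 / 2 + u * (μ * D)| := by ring_nf
    _ ≤ |u * D ^ 2 / 2| + |u * (μ * D)| := abs_add_le _ _
    _ ≤ _ := by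
      rw [abs_of_nonneg (by positivity : 0 ≤ u * D ^ 2 / 2)]
      have := le_div_of_mul_le_sq hn hy0 hy1 hun
      gcongr
      exact abs_deviation_linear_le hn hy0 hu0 hun hμ hK

theorem abs_deviation_cubic_le (hn : 0 < n) (hy0 : 0 ≤ y) (hy1 : y ≤ 1)
    (hu0 : 0 ≤ u) (hun : u * n ≤ y ^ 2) (hμ : |μ| ≤ n * y / 4) (hρ : |ρ| ≤ y / 2)
    (hK : n * y ^ 4 ≤ K) : |u * ((D + μ) ^ 2 * ρ)| ≤ y / n * D ^ 2 + K * y / 16 :=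
  calc |u * ((D + μ) ^ 2 * ρ)| = u * ((D + μ) ^ 2 * |ρ|) := by
        rw [abs_mul, abs_mul, abs_of_nonneg hu0, abs_sq]
    _ ≤ u * ((2 * (D ^ 2 + μ ^ 2)) * (y / 2)) := by
        gcongr
        exact add_sq_le
    _ = u * D ^ 2 * y + u * μ ^ 2 * y := by ring
    _ ≤ y / n * D ^ 2 * 1 + K / 16 * y := by
        have := le_div_of_mul_le_sq hn hy0 hy1 hun
        have := mul_sq_mean_le hn.le hu0 hun hμ hK
        gcongr
    _ = _ := by ring

theorem abs_deviation_le (hn : 0 < n) (hy0 : 0 ≤ y) (hy1 : y ≤ 1) (hu0 : 0 ≤ u)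
    (hun : u * n ≤ y ^ 2) (hμ : |μ| ≤ n * y / 4) (hρ : |ρ| ≤ y / 2) (he : |e| ≤ y / 2)
    (hK1 : 1 ≤ K) (hK : n * y ^ 4 ≤ K) :
    |-u * ((J ^ 2 - μ ^ 2) / 2 + J ^ 2 * ρ) + e| ≤ 2 * K * y * (1 + (J - μ) ^ 2 / n) := by
  obtain ⟨D, rfl⟩ : ∃ D, J = D + μ := ⟨J - μ, by ring⟩
  have hquadratic := abs_deviation_quadratic_le (D := D) hn hy0 hy1 hu0 hun hμ hK
  have hcubic := abs_deviation_cubic_le (D := D) hn hy0 hy1 hu0 hun hμ hρ hK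
  have hD : y / n * D ^ 2 ≤ K * (y / n * D ^ 2) := le_mul_of_one_le_left (by positivity) hK1
  have hy : y ≤ K * y := le_mul_of_one_le_left hy0 hK1
  calc _ = |-(u * (((D + μ) ^ 2 - μ ^ 2) / 2)) + -(u * ((D + μ) ^ 2 * ρ)) + e| := by ring_nf
    _ ≤ |u * (((D + μ) ^ 2 - μ ^ 2) / 2)| + |u * ((D + μ) ^ 2 * ρ)| + |e| := by
        refine (abs_add_three _ _ _).trans_eq ?_
        rw [abs_neg, abs_neg]
    _ ≤ 2 * (K * y) + 2 * (K * (y / n * D ^ 2)) := by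
        have hDK : 0 ≤ K * (y / n * D ^ 2) := by positivity
        linarith
    _ = _ := by ring

theorem exponentDeviation_bounds (hn : 1 ≤ n) (hx0 : 0 ≤ x) (hxy : x ≤ y) (hy1 : y ≤ 1)
    (hs0 : 0 ≤ s) (hs : s * n = y) (hμ : |μ| ≤ n * y / 4) (hJ : |J| ≤ n / 2)
    (hK1 : 1 ≤ K) (hK : n * y ^ 4 ≤ K) :
    exponentDeviation x s μ J ≤ K / 32 + 1 ∧
      |exponentDeviation x s μ J| ≤ 2 * K * y * (1 + (J - μ) ^ 2 / n) := by
  have hn0 : 0 < n := one_pos.trans_le hn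
  have hy0 : 0 ≤ y := hx0.trans hxy
  have hu0 : 0 ≤ x * s := mul_nonneg hx0 hs0
  have hun : x * s * n ≤ y ^ 2 := by
    rw [mul_assoc, hs, pow_two]
    gcongr
  obtain ⟨ρ, e, hρ, he, hdev⟩ := exists_exponentDeviation_eq hn hx0 hxy hy1 hs0 hs hJ
  rw [hdev]
  exact ⟨deviation_le hn0.le hy1 hu0 hun hμ hρ he hK,
    abs_deviation_le hn0 hy0 hy1 hu0 hun hμ hρ he hK1 hK⟩

end Deviation

theorem sum_eval_bernsteinPolynomial (m : ℕ) (ν : ℝ) :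
    ∑ j ∈ Finset.range (m + 1), (bernsteinPolynomial ℝ m j).eval ν = 1 := by
  rw [← Polynomial.eval_finsetSum, bernsteinPolynomial.sum, Polynomial.eval_one]

theorem sum_eval_bernsteinPolynomial_mul_sq (m : ℕ) (ν : ℝ) :
    ∑ j ∈ Finset.range (m + 1), (bernsteinPolynomial ℝ m j).eval ν * (j - m * ν) ^ 2 =
      m * (ν * (1 - ν)) := by
  have h := congrArg (Polynomial.eval ν) (bernsteinPolynomial.variance (R := ℝ) m)
  simp only [Polynomial.eval_finsetSum, Polynomial.eval_mul, Polynomial.eval_pow,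
    Polynomial.eval_sub, Polynomial.eval_X, Polynomial.eval_natCast, Polynomial.eval_one,
    nsmul_eq_mul] at h
  rw [← mul_assoc, ← h]
  exact Finset.sum_congr rfl fun j _ => by ring

theorem eval_bernsteinPolynomial (m j : ℕ) (ν : ℝ) :
    (bernsteinPolynomial ℝ m j).eval ν = m.choose j * (ν ^ j * (1 - ν) ^ (m - j)) := by
  simp only [bernsteinPolynomial, Polynomial.eval_mul, Polynomial.eval_pow, Polynomial.eval_sub,
    Polynomial.eval_X, Polynomial.eval_natCast, Polynomial.eval_one, mul_assoc]

theorem eval_bernsteinPolynomial_nonneg (m j : ℕ) {ν : ℝ} (hν0 : 0 ≤ ν) (hν1 : ν ≤ 1) :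
    0 ≤ (bernsteinPolynomial ℝ m j).eval ν := by
  have := sub_nonneg.2 hν1
  rw [eval_bernsteinPolynomial]
  positivity

theorem abs_exp_sub_one_le_mul {u B : ℝ} (hB : 0 ≤ B) (hu : u ≤ B) :
    |Real.exp u - 1| ≤ Real.exp B * |u| := by
  rcases le_total 0 u with h | h
  · rw [abs_of_nonneg (by linarith [Real.one_le_exp h]), abs_of_nonneg h]
    have hexp : Real.exp u * Real.exp (-u) = 1 := by
      rw [← Real.exp_add, add_neg_cancel, Real.exp_zero]
    calc Real.exp u - 1 = Real.exp u * (1 - Real.exp (-u)) := by rw [mul_sub, hexp, mul_one]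
      _ ≤ Real.exp u * u := by gcongr; linarith [Real.add_one_le_exp (-u)]
      _ ≤ Real.exp B * u := by gcongr
  · rw [abs_of_nonpos (by linarith [Real.exp_le_one_iff.2 h]), abs_of_nonpos h]
    calc -(Real.exp u - 1) ≤ -u := by linarith [Real.add_one_le_exp u]
      _ ≤ Real.exp B * -u := le_mul_of_one_le_left (neg_nonneg.2 h) (Real.one_le_exp hB)

theorem abs_sum_mul_exp_sub_one_le {ι : Type*} {s : Finset ι} {b f v : ι → ℝ} {B C : ℝ}
    (hB : 0 ≤ B) (hb : ∀ j ∈ s, 0 ≤ b j) (hb1 : ∑ j ∈ s, b j = 1) (hf : ∀ j ∈ s, f j ≤ B)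
    (hfv : ∀ j ∈ s, |f j| ≤ C * (1 + v j)) :
    |∑ j ∈ s, b j * Real.exp (f j) - 1| ≤ Real.exp B * (C * (1 + ∑ j ∈ s, b j * v j)) :=
  calc _ = |∑ j ∈ s, b j * (Real.exp (f j) - 1)| := by
        simp only [mul_sub, mul_one, Finset.sum_sub_distrib, hb1]
    _ ≤ ∑ j ∈ s, |b j * (Real.exp (f j) - 1)| := Finset.abs_sum_le_sum_abs _ _
    _ ≤ ∑ j ∈ s, b j * (Real.exp B * (C * (1 + v j))) := by
        refine Finset.sum_le_sum fun j hj => ?_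
        rw [abs_mul, abs_of_nonneg (hb j hj)]
        exact mul_le_mul_of_nonneg_left ((abs_exp_sub_one_le_mul hB (hf j hj)).trans
          (mul_le_mul_of_nonneg_left (hfv j hj) (Real.exp_pos B).le)) (hb j hj)
    _ = ∑ j ∈ s, Real.exp B * (C * (b j + b j * v j)) :=
        Finset.sum_congr rfl fun j _ => by ring
    _ = _ := by rw [← Finset.mul_sum, ← Finset.mul_sum, Finset.sum_add_distrib, hb1]

/-- The exponent of the `j`-th summand of `labelRatio` relative to the binomial weights with
success probability `1 / 2 - x / 4`. At `x = k / a` these weights are centred where the summands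
of `labelRatio a k m` concentrate. -/
noncomputable def tiltedExponent (a x : ℝ) (k m j : ℕ) : ℝ :=
  ∑ i ∈ Finset.range k, Real.log (1 + ((i - ((k : ℝ) - 1) / 2) - (j - m / 2)) / a) +
    (-(j * Real.log (1 - x / 2)) - (m - j) * Real.log (1 + x / 2))

theorem eval_bernsteinPolynomial_half_sub {m j : ℕ} (hj : j ≤ m) (x : ℝ) :
    (bernsteinPolynomial ℝ m j).eval (1 / 2 - x / 4) =
      (1 / 2) ^ m * (m.choose j * ((1 - x / 2) ^ j * (1 + x / 2) ^ (m - j))) := by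
  rw [eval_bernsteinPolynomial, show 1 / 2 - x / 4 = 1 / 2 * (1 - x / 2) by ring,
    show 1 - 1 / 2 * (1 - x / 2) = 1 / 2 * (1 + x / 2) by ring, mul_pow, mul_pow,
    ← pow_mul_pow_sub (1 / 2 : ℝ) hj]
  ring

theorem exp_tiltedExponent {a x : ℝ} {k m j : ℕ} (hj : j ≤ m) (hx0 : 0 ≤ x) (hx1 : x ≤ 1)
    (hpos : ∀ i ∈ Finset.range k, 0 < 1 + ((i - ((k : ℝ) - 1) / 2) - ((j : ℝ) - m / 2)) / a) :
    Real.exp (tiltedExponent a x k m j) =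
      (∏ i ∈ Finset.range k, (1 + ((i - ((k : ℝ) - 1) / 2) - (j - m / 2)) / a)) *
        ((1 - x / 2) ^ j * (1 + x / 2) ^ (m - j))⁻¹ := by
  rw [tiltedExponent, ← Nat.cast_sub hj, Real.exp_add, Real.exp_sub, Real.exp_neg,
    Real.exp_nat_mul, Real.exp_log (by linarith), Real.exp_nat_mul,
    Real.exp_log (by linarith), Real.exp_sum, mul_inv, div_eq_mul_inv]
  congr 1
  exact Finset.prod_congr rfl fun i hi => Real.exp_log (hpos i hi)

section Parameters

variable {n k m : ℕ} {a K : ℝ}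

theorem abs_labelRatio_node_le {i j : ℕ} (hk : k ≤ n) (hm : m ≤ n) (ha : 0 ≤ a) (hi : i < k)
    (hj : j ≤ m) : |((i - ((k : ℝ) - 1) / 2) - ((j : ℝ) - m / 2)) / a| ≤ n / a := by
  rify at hk hm hj
  have hi1 : (i : ℝ) + 1 ≤ k := by exact_mod_cast hi
  have : (0 : ℝ) ≤ i := Nat.cast_nonneg i
  have : (0 : ℝ) ≤ j := Nat.cast_nonneg j
  rw [abs_div, abs_of_nonneg ha]
  gcongr
  rw [abs_le]
  constructor <;> linarith

theorem labelRatio_eq_sum_bernsteinPolynomial_mul_exp (hk : k ≤ n) (hm : m ≤ n)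
    (ha0 : 0 < a) (ha : n / a ≤ 1 / 4) :
    labelRatio a k m = ∑ j ∈ Finset.range (m + 1),
      (bernsteinPolynomial ℝ m j).eval (1 / 2 - k / a / 4) *
        Real.exp (tiltedExponent a (k / a) k m j) := by
  have hx0 : 0 ≤ k / a := by positivity
  have hx1 : k / a ≤ 1 / 4 := le_trans (by gcongr) ha
  rw [labelRatio, Finset.mul_sum]
  refine Finset.sum_congr rfl fun j hj => ?_
  have hj : j ≤ m := Finset.mem_range_succ_iff.1 hj
  have hpos (i) (hi : i ∈ Finset.range k) :
      0 < 1 + ((i - ((k : ℝ) - 1) / 2) - ((j : ℝ) - m / 2)) / a := by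
    linarith [(abs_le.1 (abs_labelRatio_node_le hk hm ha0.le (Finset.mem_range.1 hi) hj)).1]
  have hweight : (1 - k / a / 2) ^ j * (1 + k / a / 2) ^ (m - j) ≠ 0 :=
    (mul_pos (pow_pos (by linarith) _) (pow_pos (by linarith) _)).ne'
  rw [exp_tiltedExponent hj hx0 (by linarith) hpos, eval_bernsteinPolynomial_half_sub hj, mul_assoc,
    mul_assoc, mul_left_comm (_ * _) (∏ i ∈ _, _), mul_inv_cancel₀ hweight, mul_one]

theorem abs_tiltedExponent_sub_le {j : ℕ} (hk : k ≤ n) (hm : m ≤ n) (hj : j ≤ m) (ha0 : 0 < a)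
    (ha : n / a ≤ 1 / 4) :
    |tiltedExponent a (k / a) k m j - ratioExponent a k m -
      exponentDeviation (k / a) (1 / a) (-(m * (k / a) / 4)) (j - m / 2)| ≤
        3 * (n * (n / a) ^ 5) := by
  have : 0 ≤ n / a := by positivity
  have hlog := abs_sum_log_sub_le (a := a) (k := k) (J := j - m / 2) (y := n / a) (by linarith)
    fun i hi => abs_labelRatio_node_le hk hm ha0.le (Finset.mem_range.1 hi) hj
  have htilt := abs_tilt_sub_le hj (x := k / a) (y := n / a) (by positivity) (by gcongr)
    (by linarith)
  rw [← logSumExpansion_add_tiltExpansion_sub_ratioExponent ha0.ne', tiltedExponent]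
  calc _ ≤ k * (2 * (n / a) ^ 5) + m * (n / a) ^ 5 := by
        refine le_trans (le_of_eq (congrArg _ ?_)) ((abs_add_le _ _).trans (add_le_add hlog htilt))
        ring
    _ ≤ n * (2 * (n / a) ^ 5) + n * (n / a) ^ 5 := by gcongr
    _ = _ := by ring

theorem tiltedExponent_sub_bounds {j : ℕ} (hn : 1 ≤ n) (hk : k ≤ n) (hm : m ≤ n)
    (hj : j ≤ m) (ha0 : 0 < a) (ha : n / a ≤ 1 / 4) (hK1 : 1 ≤ K) (hK : n * (n / a) ^ 4 ≤ K) :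
    tiltedExponent a (k / a) k m j - ratioExponent a k m ≤ 5 * K ∧
      |tiltedExponent a (k / a) k m j - ratioExponent a k m| ≤
        5 * K * (n / a) * (1 + (j - m * (1 / 2 - k / a / 4)) ^ 2 / n) := by
  have : 0 ≤ n / a := by positivity
  have hJ : |(j : ℝ) - m / 2| ≤ n / 2 := by
    rify at hm hj
    have : (0 : ℝ) ≤ j := Nat.cast_nonneg j
    rw [abs_le]
    constructor <;> linarith
  have hμ : |-(m * (k / a) / 4)| ≤ n * (n / a) / 4 := by
    rw [abs_neg, abs_of_nonneg (by positivity)]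
    gcongr
  have hdev := exponentDeviation_bounds (s := 1 / a) (x := k / a) (Nat.one_le_cast.2 hn)
    (by positivity) (by gcongr) (by linarith) (by positivity) (by ring) hμ hJ hK1 hK
  rw [show (j : ℝ) - m / 2 - -(m * (k / a) / 4) = j - m * (1 / 2 - k / a / 4) by ring] at hdev
  have herror : 3 * (n * (n / a) ^ 5) ≤ 3 * (K * (n / a)) := by
    rw [pow_succ, ← mul_assoc (n : ℝ)]
    gcongr
  have hdiff := (abs_tiltedExponent_sub_le hk hm hj ha0 ha).trans herror
  constructor
  · nlinarith [hdev.1, (abs_le.1 hdiff).2]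
  · have hV : K * (n / a) ≤ K * (n / a) * (1 + (j - m * (1 / 2 - k / a / 4)) ^ 2 / n) :=
      le_mul_of_one_le_right (by positivity) (le_add_of_nonneg_right (by positivity))
    linarith [hdev.2, abs_sub_abs_le_abs_sub (tiltedExponent a (k / a) k m j - ratioExponent a k m)
      (exponentDeviation (k / a) (1 / a) (-(m * (k / a) / 4)) (j - m / 2))]

theorem abs_labelRatio_mul_exp_sub_one_le (hn : 1 ≤ n) (hk : k ≤ n)
    (hm : m ≤ n) (ha : 4 * n ≤ a) (hK1 : 1 ≤ K) (hK : n ^ 5 ≤ K * a ^ 4) :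
    |labelRatio a k m * Real.exp (-ratioExponent a k m) - 1| ≤
      Real.exp (5 * K) * (7 * K * (n / a)) := by
  have hn0 : (0 : ℝ) < n := by exact_mod_cast hn
  have ha0 : 0 < a := by linarith
  have hy : n / a ≤ 1 / 4 := by rw [div_le_iff₀ ha0]; linarith
  have hKy : n * (n / a) ^ 4 ≤ K := by
    rwa [div_pow, ← mul_div_assoc, div_le_iff₀ (by positivity), ← pow_succ']
  have hx : k / a ≤ n / a := by gcongr
  have hx0 : 0 ≤ k / a := by positivity
  set ν := 1 / 2 - k / a / 4 with hν
  have hbounds (j) (hj : j ∈ Finset.range (m + 1)) :=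
    tiltedExponent_sub_bounds hn hk hm (Finset.mem_range_succ_iff.1 hj) ha0 hy hK1 hKy
  have hvariance : ∑ j ∈ Finset.range (m + 1), (bernsteinPolynomial ℝ m j).eval ν *
      ((j - m * ν) ^ 2 / n) ≤ 1 / 4 := by
    simp only [← mul_div_assoc, ← Finset.sum_div, sum_eval_bernsteinPolynomial_mul_sq]
    rw [div_le_iff₀ hn0]
    calc m * (ν * (1 - ν)) ≤ m * (1 / 4) := by gcongr; linarith [sq_nonneg (ν - 1 / 2)]
      _ ≤ 1 / 4 * n := by rw [mul_comm]; gcongr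
  calc _ = |∑ j ∈ Finset.range (m + 1), (bernsteinPolynomial ℝ m j).eval ν *
          Real.exp (tiltedExponent a (k / a) k m j - ratioExponent a k m) - 1| := by
        simp only [labelRatio_eq_sum_bernsteinPolynomial_mul_exp hk hm ha0 hy, Finset.sum_mul,
          mul_assoc, ← Real.exp_add, ← sub_eq_add_neg, hν]
    _ ≤ Real.exp (5 * K) * (5 * K * (n / a) * (1 + _)) :=
        abs_sum_mul_exp_sub_one_le (by positivity)
          (fun j _ => eval_bernsteinPolynomial_nonneg m j (by linarith) (by linarith))
          (sum_eval_bernsteinPolynomial m ν) (fun j hj => (hbounds j hj).1)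
          fun j hj => (hbounds j hj).2
    _ ≤ Real.exp (5 * K) * (5 * K * (n / a) * (1 + 1 / 4)) := by gcongr
    _ ≤ Real.exp (5 * K) * (7 * K * (n / a)) := by
        gcongr _ * ?_
        linarith [show 0 ≤ K * (n / a) by positivity]

end Parameters

end Asymptotics

section ClassAverage

open scoped BigOperators

instance instDiscreteMeasurableSpacePermFin (n : ℕ) :
    DiscreteMeasurableSpace (Equiv.Perm (Fin n)) := ⟨fun _ => trivial⟩

theorem integral_uniformOn_finset {Ω E : Type*} [MeasurableSpace Ω] [MeasurableSingletonClass Ω]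
    [NormedAddCommGroup E] [NormedSpace ℝ E] [CompleteSpace E] (s : Finset Ω) (g : Ω → E) :
    ∫ ω, g ω ∂uniformOn (s : Set Ω) = (s.card : ℝ)⁻¹ • ∑ ω ∈ s, g ω := by
  have hInt : ∫ ω in s, g ω ∂Measure.count = ∑ ω ∈ s, g ω := by
    have hs : IntegrableOn g s Measure.count := by
      rw [← Set.biUnion_of_singleton (s : Set Ω), integrableOn_finite_biUnion s.finite_toSet]
      exact fun ω _ => integrableOn_singleton (hx := by simp)
    rw [setIntegral_finset s hs]
    simp
  rw [uniformOn, ProbabilityTheory.cond, integral_smul_measure, hInt, Measure.count_apply_finset]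
  simp

theorem expect_isConj_eq_expect_conj {G M : Type*} [Group G] [Fintype G] [AddCommMonoid M]
    [Module ℚ≥0 M] (τ : G) [DecidablePred (IsConj τ)] (g : G → M) :
    𝔼 σ with IsConj τ σ, g σ = 𝔼 r : G, g (r * τ * r⁻¹) := by
  have hconj (r σ : G) : IsConj σ (r * σ * r⁻¹) := isConj_iff.2 ⟨r, rfl⟩
  calc 𝔼 σ with IsConj τ σ, g σ = 𝔼 _r : G, 𝔼 σ with IsConj τ σ, g σ :=
        (Fintype.expect_const _).symm
    _ = 𝔼 r : G, 𝔼 σ with IsConj τ σ, g (r * σ * r⁻¹) :=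
        Finset.expect_congr rfl fun r _ => (Finset.expect_equiv (MulAut.conj r).toEquiv
          (fun σ => by
            simp only [Finset.mem_filter, Finset.mem_univ, true_and]
            exact ⟨fun h => h.trans (hconj r σ), fun h => h.trans (hconj r σ).symm⟩)
          fun σ _ => rfl).symm
    _ = 𝔼 σ with IsConj τ σ, 𝔼 r : G, g (r * σ * r⁻¹) := Finset.expect_comm _ _ _
    _ = 𝔼 σ with IsConj τ σ, 𝔼 r : G, g (r * τ * r⁻¹) := Finset.expect_congr rfl fun σ hσ => by
        obtain ⟨c, rfl⟩ := isConj_iff.1 (Finset.mem_filter.1 hσ).2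
        exact Fintype.expect_equiv (Equiv.mulRight c) _ _ fun r => by simp [mul_assoc]
    _ = 𝔼 r : G, g (r * τ * r⁻¹) :=
        Finset.expect_const ⟨τ, Finset.mem_filter.2 ⟨Finset.mem_univ _, IsConj.refl τ⟩⟩ _

variable {G : Type*} [Group G] [MeasurableSpace G] [MeasurableSingletonClass G]

instance isProbabilityMeasure_uniformOn_carrier_mk [Finite G] (τ : G) :
    IsProbabilityMeasure (uniformOn (ConjClasses.mk τ).carrier) :=
  isProbabilityMeasure_uniformOn (Set.toFinite _) ⟨τ, ConjClasses.mem_carrier_mk⟩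

theorem integral_uniformOn_carrier_mk [Fintype G] (τ : G) (g : G → ℝ) :
    ∫ σ, g σ ∂uniformOn (ConjClasses.mk τ).carrier = 𝔼 r : G, g (r * τ * r⁻¹) := by
  classical
  have hcarrier : (ConjClasses.mk τ).carrier = ({σ | IsConj τ σ} : Finset G) := by
    ext σ
    rw [ConjClasses.mem_carrier_iff_mk_eq, ConjClasses.mk_eq_mk_iff_isConj, isConj_comm]
    simp only [Finset.coe_filter_univ, Set.mem_ofPred_eq]
  rw [hcarrier, integral_uniformOn_finset, ← expect_isConj_eq_expect_conj τ,
    Finset.expect_eq_sum_div_card, smul_eq_mul, inv_mul_eq_div]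

end ClassAverage

section TiltRemoval

open scoped Topology

theorem mul_exp_neg_mul_le {c : ℝ} (hc : 0 < c) (x : ℝ) : x * Real.exp (-(c * x)) ≤ 1 / c := by
  have h : c * x * Real.exp (-(c * x)) ≤ 1 :=
    (Real.mul_exp_neg_le_exp_neg_one _).trans (Real.exp_le_one_iff.2 (by norm_num))
  rw [le_div_iff₀ hc]
  linarith

theorem abs_mul_exp_mul_le {s θ x : ℝ} (hs : s < θ) (hθ : θ < 0) :
    |x| * Real.exp (θ * x) ≤ 1 / (-θ) + 1 / (θ - s) * Real.exp (s * x) := by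
  rcases le_total 0 x with hx | hx
  · have h := mul_exp_neg_mul_le (neg_pos.2 hθ) x
    rw [neg_mul, neg_neg] at h
    rw [abs_of_nonneg hx]
    exact le_add_of_le_of_nonneg h
      (mul_nonneg (one_div_nonneg.2 (by linarith)) (Real.exp_pos _).le)
  · have h := mul_exp_neg_mul_le (sub_pos.2 hs) (-x)
    rw [abs_of_nonpos hx]
    refine le_add_of_nonneg_of_le (one_div_nonneg.2 (by linarith)) ?_
    calc -x * Real.exp (θ * x)
        = -x * Real.exp (-((θ - s) * -x)) * Real.exp (s * x) := by
          rw [mul_assoc, ← Real.exp_add]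
          ring_nf
      _ ≤ 1 / (θ - s) * Real.exp (s * x) := by gcongr

theorem abs_exp_tilt_sub_le {θ s c q r w ε : ℝ} (hs : s ∈ Set.Ioo (2 * θ) (θ / 2)) (hq : |q| ≤ 1)
    (hr : |r| ≤ 1) (hε : 0 ≤ ε) (hqr : |q - r| ≤ ε * |w|) :
    |Real.exp (-(c * r)) * Real.exp (s * w + c * q) - Real.exp (s * w)| ≤
      Real.exp (2 * |c|) * |c| * ε * (2 / (-θ) + Real.exp ((2 * θ - 1) * w)) := by
  obtain ⟨hs2, hs1⟩ := hs
  have htilt : c * (q - r) ≤ 2 * |c| :=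
    calc c * (q - r) ≤ |q - r| * |c| := by
          rw [← abs_mul, mul_comm]
          exact le_abs_self _
      _ ≤ 2 * |c| := by
          gcongr
          exact (abs_sub _ _).trans (by linarith)
  have hmoment : |w| * Real.exp (s * w) ≤ 2 / (-θ) + Real.exp ((2 * θ - 1) * w) := by
    refine (abs_mul_exp_mul_le (s := 2 * θ - 1) (by linarith) (by linarith)).trans
      (add_le_add ?_ (mul_le_of_le_one_left (Real.exp_pos _).le ?_))
    · rw [div_le_div_iff₀ (by linarith) (by linarith)]
      linarith
    · rw [div_le_one (by linarith)]
      linarith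
  calc _ = Real.exp (s * w) * |Real.exp (c * (q - r)) - 1| := by
        rw [← abs_of_pos (Real.exp_pos (s * w)), ← abs_mul, abs_of_pos (Real.exp_pos (s * w)),
          mul_sub, ← Real.exp_add, ← Real.exp_add, mul_one]
        ring_nf
    _ ≤ Real.exp (s * w) * (Real.exp (2 * |c|) * (|c| * (ε * |w|))) := by
        gcongr
        exact (abs_exp_sub_one_le_mul (by positivity) htilt).trans (by rw [abs_mul]; gcongr)
    _ = Real.exp (2 * |c|) * |c| * ε * (|w| * Real.exp (s * w)) := by ring
    _ ≤ _ := by gcongr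

section Single

variable {Ω : Type*} [Finite Ω] [MeasurableSpace Ω] [MeasurableSingletonClass Ω] {μ : Measure Ω}
  [IsProbabilityMeasure μ] {W q : Ω → ℝ} {θ s c : ℝ}

theorem mgf_le_of_tilt {B : ℝ} (hs : s ≤ θ) (hθ : θ ≤ 0) (hc : |c| ≤ B) (hq : ∀ ω, |q ω| ≤ 1) :
    mgf W μ θ ≤ 1 + Real.exp B * ∫ ω, Real.exp (s * W ω + c * q ω) ∂μ := by
  have htilt (ω) : -B ≤ c * q ω := by
    refine neg_le_of_abs_le (abs_mul c _ ▸ ?_)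
    exact (mul_le_of_le_one_right (abs_nonneg c) (hq ω)).trans hc
  calc mgf W μ θ
      ≤ ∫ ω, (1 + Real.exp B * Real.exp (s * W ω + c * q ω)) ∂μ := by
        refine integral_mono Integrable.of_finite Integrable.of_finite fun ω => ?_
        refine (exp_mul_le_one_add_exp_mul hs hθ).trans ?_
        rw [← Real.exp_add]
        gcongr
        linarith [htilt ω]
    _ = _ := by
        rw [integral_add Integrable.of_finite Integrable.of_finite, integral_const_mul,
          integral_const, probReal_univ, one_smul]

theorem abs_integral_tilt_sub_mgf_le {r ε : ℝ} (hs : s ∈ Set.Ioo (2 * θ) (θ / 2))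
    (hq : ∀ ω, |q ω| ≤ 1) (hr : |r| ≤ 1) (hε : 0 ≤ ε) (hqr : ∀ ω, |q ω - r| ≤ ε * |W ω|) :
    |Real.exp (-(c * r)) * ∫ ω, Real.exp (s * W ω + c * q ω) ∂μ - mgf W μ s| ≤
      Real.exp (2 * |c|) * |c| * ε * (2 / (-θ) + mgf W μ (2 * θ - 1)) := by
  rw [mgf, mgf, ← integral_const_mul, ← integral_sub Integrable.of_finite Integrable.of_finite]
  calc _ ≤ ∫ ω, Real.exp (2 * |c|) * |c| * ε *
          (2 / (-θ) + Real.exp ((2 * θ - 1) * W ω)) ∂μ :=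
        abs_integral_le_integral_abs.trans (integral_mono Integrable.of_finite
          Integrable.of_finite fun ω => abs_exp_tilt_sub_le hs (hq ω) hr hε (hqr ω))
    _ = _ := by
        rw [integral_const_mul, integral_add Integrable.of_finite Integrable.of_finite,
          integral_const, probReal_univ, one_smul]

end Single

variable {ι : Type*} {l : Filter ι} {Ω : ι → Type*} [∀ n, Finite (Ω n)]
  [∀ n, MeasurableSpace (Ω n)] [∀ n, MeasurableSingletonClass (Ω n)] {μ : ∀ n, Measure (Ω n)}
  [∀ n, IsProbabilityMeasure (μ n)] {W q : ∀ n, Ω n → ℝ} {C : ℝ → ℝ} {θ : ℝ}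

theorem exists_eventually_mgf_le_of_tilt (hq : ∀ᶠ n in l, ∀ ω, |q n ω| ≤ 1)
    (h : ∀ θ < 0, ∃ s c : ι → ℝ, Tendsto s l (𝓝 θ) ∧ Tendsto c l (𝓝 (C θ)) ∧
      Tendsto (fun n => ∫ ω, Real.exp (s n * W n ω + c n * q n ω) ∂(μ n)) l (𝓝 1))
    (hθ : θ < 0) : ∃ K, ∀ᶠ n in l, mgf (W n) (μ n) θ ≤ K := by
  obtain ⟨s, c, hs, hc, hlim⟩ := h (θ - 1) (by linarith)
  refine ⟨1 + Real.exp (|C (θ - 1)| + 1) * 2, ?_⟩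
  filter_upwards [hq, hs.eventually_le_const (sub_one_lt θ),
    hc.abs.eventually_le_const (lt_add_one _), hlim.eventually_le_const one_lt_two]
    with n hq hs hc hlim
  refine (mgf_le_of_tilt hs hθ.le hc hq).trans ?_
  gcongr

theorem tendsto_mgf_of_tilt {ε r : ι → ℝ} {ρ : ℝ} (hε0 : ∀ n, 0 ≤ ε n) (hε : Tendsto ε l (𝓝 0))
    (hr : Tendsto r l (𝓝 ρ)) (hq : ∀ᶠ n in l, ∀ ω, |q n ω| ≤ 1) (hr1 : ∀ᶠ n in l, |r n| ≤ 1)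
    (hqr : ∀ᶠ n in l, ∀ ω, |q n ω - r n| ≤ ε n * |W n ω|)
    (h : ∀ θ < 0, ∃ s c : ι → ℝ, Tendsto s l (𝓝 θ) ∧ Tendsto c l (𝓝 (C θ)) ∧
      Tendsto (fun n => ∫ ω, Real.exp (s n * W n ω + c n * q n ω) ∂(μ n)) l (𝓝 1))
    (hθ : θ < 0) : ∃ s : ι → ℝ, Tendsto s l (𝓝 θ) ∧
      Tendsto (fun n => mgf (W n) (μ n) (s n)) l (𝓝 (Real.exp (-(C θ * ρ)))) := by
  obtain ⟨s, c, hs, hc, hlim⟩ := h θ hθ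
  obtain ⟨K, hK⟩ := exists_eventually_mgf_le_of_tilt hq h (θ := 2 * θ - 1) (by linarith)
  have hmain : Tendsto (fun n => Real.exp (-(c n * r n)) *
      ∫ ω, Real.exp (s n * W n ω + c n * q n ω) ∂(μ n)) l (𝓝 (Real.exp (-(C θ * ρ)))) := by
    simpa only [mul_one] using (hc.mul hr).neg.rexp.mul hlim
  have herror : Tendsto (fun n => Real.exp (2 * |c n|) * |c n| * ε n * (2 / (-θ) + K)) l
      (𝓝 0) := by
    simpa only [mul_zero, zero_mul] using
      (((hc.abs.const_mul 2).rexp.mul hc.abs).mul hε).mul_const (2 / (-θ) + K)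
  refine ⟨s, hs, tendsto_of_tendsto_of_dist hmain
    (squeeze_zero' (Eventually.of_forall fun _ => dist_nonneg) ?_ herror)⟩
  filter_upwards [hq, hr1, hqr, hK,
    hs.eventually_mem (Ioo_mem_nhds (by linarith : 2 * θ < θ) (by linarith : θ < θ / 2))]
    with n hq hr hqr hK hs
  rw [Real.dist_eq]
  refine (abs_integral_tilt_sub_mgf_le hs hq hr (hε0 n) hqr).trans ?_
  have := hε0 n
  gcongr

end TiltRemoval

section PeakExponent

/-- The number of peaks of a permutation of `n` points with a proportion `A` of fixed points,
centred and normalized as in the limit theorem. -/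
noncomputable def normalizedPeaks (A : ℝ) {n : ℕ} (σ : Equiv.Perm (Fin n)) : ℝ :=
  ((peaks σ : ℝ) - (1 - A ^ 3) / 3 * n) / √n

/-- The point at which `2 * a` letters sample the Laplace transform of `normalizedPeaks` on the
permutations of `n` points. -/
noncomputable def laplacePoint (n : ℕ) (a : ℝ) : ℝ := -(n ^ 2 * √n / (4 * a ^ 2))

/-- The coefficient of `n ^ 5 / a ^ 4` in the difference of the exponents of the label ratios of a
permutation of `n` points with `(1 - u) * n / 2` peaks and of the identity on `A * n` points. -/
noncomputable def tiltCoeff (A u : ℝ) : ℝ := -1 / 320 + u / 64 - u ^ 2 / 32 + 3 * A ^ 5 / 160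

/-- The difference of the exponents of the label ratios of `σ` and of the identity on `A * n`
points, up to lower order terms: linear in `normalizedPeaks`, with a tilt of bounded size. -/
noncomputable def peakExponent (a A : ℝ) {n : ℕ} (σ : Equiv.Perm (Fin n)) : ℝ :=
  laplacePoint n a * normalizedPeaks A σ +
    16 * laplacePoint n a ^ 2 * tiltCoeff A (1 - 2 * peaks σ / n)

theorem abs_tiltCoeff_le_one {A u : ℝ} (hA : A ∈ Set.Icc (0 : ℝ) 1) (hu : u ∈ Set.Icc (0 : ℝ) 1) :
    |tiltCoeff A u| ≤ 1 := by
  have hA0 : 0 ≤ A ^ 5 := pow_nonneg hA.1 5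
  have hA1 : A ^ 5 ≤ 1 := pow_le_one₀ hA.1 hA.2
  have hu1 : u ^ 2 ≤ 1 := pow_le_one₀ hu.1 hu.2
  rw [tiltCoeff, abs_le]
  constructor <;> linarith [hu.1, hu.2, sq_nonneg u]

theorem abs_tiltCoeff_sub_le {A u v : ℝ} (hu : u ∈ Set.Icc (0 : ℝ) 1)
    (hv : v ∈ Set.Icc (0 : ℝ) 1) : |tiltCoeff A u - tiltCoeff A v| ≤ |u - v| / 2 := by
  have hfactor : tiltCoeff A u - tiltCoeff A v = (u - v) * (1 / 64 - (u + v) / 32) := by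
    unfold tiltCoeff
    ring
  rw [hfactor, abs_mul, div_eq_mul_inv]
  refine mul_le_mul_of_nonneg_left (abs_le.2 ?_) (abs_nonneg _)
  constructor <;> linarith [hu.1, hu.2, hv.1, hv.2]

theorem two_mul_peaks_le_sub_one {n : ℕ} (hn : 1 ≤ n) (σ : Equiv.Perm (Fin n)) :
    2 * peaks σ ≤ n - 1 := by
  obtain ⟨i, rfl⟩ := Nat.exists_eq_add_of_le' hn
  exact two_mul_peaks_le σ

theorem one_sub_two_mul_peaks_div_mem {n : ℕ} (hn : 1 ≤ n) (σ : Equiv.Perm (Fin n)) :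
    1 - 2 * (peaks σ : ℝ) / n ∈ Set.Icc (0 : ℝ) 1 := by
  have hpeaks : (2 * peaks σ : ℝ) ≤ n := by
    exact_mod_cast (two_mul_peaks_le_sub_one hn σ).trans (Nat.sub_le _ _)
  exact ⟨sub_nonneg.2 (div_le_one_of_le₀ hpeaks n.cast_nonneg), sub_le_self _ (by positivity)⟩

theorem numFixedPoints_div_mem {n : ℕ} (τ : Equiv.Perm (Fin n)) :
    (numFixedPoints τ : ℝ) / n ∈ Set.Icc (0 : ℝ) 1 :=
  ⟨by positivity, div_le_one_of_le₀ (by exact_mod_cast numFixedPoints_le τ) n.cast_nonneg⟩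

theorem pow_five_div_pow_four_eq (n : ℕ) (a : ℝ) :
    (n : ℝ) ^ 5 / a ^ 4 = 16 * laplacePoint n a ^ 2 := by
  rw [laplacePoint, neg_sq, div_pow, mul_pow, Real.sq_sqrt n.cast_nonneg]
  ring

theorem div_sq_eq_laplacePoint (n : ℕ) (a : ℝ) :
    ((n : ℝ) / a) ^ 2 = -4 * laplacePoint n a / √n := by
  rcases n.eq_zero_or_pos with rfl | hn
  · simp
  · have hsqrt : √(n : ℝ) ≠ 0 := (Real.sqrt_pos.2 (by exact_mod_cast hn)).ne'
    rw [laplacePoint]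
    field_simp

theorem abs_ratioExponent_sub_le {n k m m' a : ℝ} (ha : 0 < a) (hk : k ∈ Set.Icc 0 n)
    (hm : m ∈ Set.Icc 0 n) (hm' : m' ∈ Set.Icc 0 n) (h : |m - m'| ≤ 1) :
    |ratioExponent a k m - ratioExponent a k m'| ≤ (n / a) ^ 2 + (n / a) ^ 4 := by
  obtain ⟨hk0, hkn⟩ := hk
  have hn : 0 ≤ n := hk0.trans hkn
  have hfactor : ratioExponent a k m - ratioExponent a k m' =
      (m - m') * (k ^ 2 / (8 * a ^ 2) + k ^ 3 * (k / 64 - (m + m') / 32) / a ^ 4) := by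
    unfold ratioExponent
    field_simp
    ring
  have hbracket : |k / 64 - (m + m') / 32| ≤ n := by
    rw [abs_le]
    constructor <;> linarith [hm.1, hm.2, hm'.1, hm'.2]
  rw [hfactor, abs_mul]
  calc |m - m'| * |k ^ 2 / (8 * a ^ 2) + k ^ 3 * (k / 64 - (m + m') / 32) / a ^ 4|
      ≤ 1 * (|k ^ 2 / (8 * a ^ 2)| + |k ^ 3 * (k / 64 - (m + m') / 32) / a ^ 4|) := by
        gcongr
        exact abs_add_le _ _
    _ = k ^ 2 / (8 * a ^ 2) + k ^ 3 * |k / 64 - (m + m') / 32| / a ^ 4 := by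
        rw [one_mul, abs_of_nonneg (by positivity), abs_div, abs_mul,
          abs_of_nonneg (pow_nonneg hk0 3), abs_of_nonneg (pow_nonneg ha.le 4)]
    _ ≤ n ^ 2 / (1 * a ^ 2) + n ^ 3 * n / a ^ 4 := by
        gcongr
        norm_num
    _ = (n / a) ^ 2 + (n / a) ^ 4 := by ring

theorem ratioExponent_sub_eq_peakExponent {n : ℕ} {a : ℝ} (hn : 1 ≤ n) (ha : a ≠ 0) (k : ℝ)
    (σ : Equiv.Perm (Fin n)) :
    ratioExponent a n (n - 2 * peaks σ) - ratioExponent a k k = peakExponent a (k / n) σ := by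
  have hn0 : (0 : ℝ) < n := by exact_mod_cast hn
  have hsqrt : √(n : ℝ) ≠ 0 := (Real.sqrt_pos.2 hn0).ne'
  rw [peakExponent, ← pow_five_div_pow_four_eq, laplacePoint, normalizedPeaks]
  unfold ratioExponent tiltCoeff
  field_simp
  ring

theorem abs_ratioExponent_sub_sub_peakExponent_le {n k : ℕ} {a : ℝ} (hn : 1 ≤ n) (hk : k ≤ n)
    (ha : 0 < a) (σ : Equiv.Perm (Fin n)) :
    |ratioExponent a n (n - 1 - 2 * peaks σ : ℕ) - ratioExponent a k (k - 1 : ℕ) -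
      peakExponent a (k / n) σ| ≤ 2 * ((n / a) ^ 2 + (n / a) ^ 4) := by
  have hpeaks := two_mul_peaks_le_sub_one hn σ
  have hp : (2 * peaks σ : ℝ) ≤ n - 1 :=
    le_sub_iff_add_le.2 (by exact_mod_cast Nat.add_le_of_le_sub hn hpeaks)
  have hpn : ((n - 1 - 2 * peaks σ : ℕ) : ℝ) = n - 1 - 2 * peaks σ := by
    rw [Nat.cast_sub hpeaks, Nat.cast_sub hn]
    push_cast
    ring
  have hk1 : (k : ℝ) ≤ (k - 1 : ℕ) + 1 := by exact_mod_cast (by omega : k ≤ k - 1 + 1)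
  have hk1' : ((k - 1 : ℕ) : ℝ) ≤ k := by exact_mod_cast Nat.sub_le k 1
  have hkn : (k : ℝ) ≤ n := by exact_mod_cast hk
  have : (0 : ℝ) ≤ peaks σ := Nat.cast_nonneg _
  have hσ := abs_ratioExponent_sub_le (n := n) (k := n) (m := n - 1 - 2 * peaks σ)
    (m' := n - 2 * peaks σ) ha ⟨n.cast_nonneg, le_rfl⟩ ⟨by linarith, by linarith⟩
    ⟨by linarith, by linarith⟩ (abs_le.2 ⟨by linarith, by linarith⟩)
  have hid := abs_ratioExponent_sub_le (n := n) (k := k) (m := (k - 1 : ℕ)) (m' := k) ha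
    ⟨k.cast_nonneg, hkn⟩ ⟨Nat.cast_nonneg _, hk1'.trans hkn⟩ ⟨k.cast_nonneg, hkn⟩
    (abs_le.2 ⟨by linarith, by linarith⟩)
  rw [← ratioExponent_sub_eq_peakExponent hn ha.ne', hpn]
  rw [abs_le] at hσ hid ⊢
  constructor <;> linarith [hσ.1, hσ.2, hid.1, hid.2]

end PeakExponent

section LaplaceTransform

open scoped Topology

/-- The factor within which the label ratio of a permutation agrees with that of the identity times
the exponential of `peakExponent`; here `x` is `n / a` and `K` bounds `n ^ 5 / a ^ 4`. -/
noncomputable def comparisonFactor (K x : ℝ) : ℝ :=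
  Real.exp (2 * (x ^ 2 + x ^ 4)) *
    ((1 + Real.exp (5 * K) * (7 * K * x)) / (1 - Real.exp (5 * K) * (7 * K * x)))

theorem comparisonFactor_pos {K x : ℝ} (hK : 0 ≤ K) (hx : 0 ≤ x)
    (hδ : Real.exp (5 * K) * (7 * K * x) < 1) : 0 < comparisonFactor K x :=
  mul_pos (Real.exp_pos _) (div_pos (by positivity) (sub_pos.2 hδ))

theorem tendsto_comparisonFactor (K : ℝ) : Tendsto (comparisonFactor K) (𝓝 0) (𝓝 1) := by
  have hcont : ContinuousAt (comparisonFactor K) 0 := by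
    unfold comparisonFactor
    fun_prop (disch := norm_num)
  simpa [comparisonFactor] using hcont.tendsto

theorem exp_mul_le_of_abs_mul_exp_neg_sub_one_le {A B u v w δ η : ℝ} (hδ : δ < 1)
    (hA : |A * Real.exp (-u) - 1| ≤ δ) (hB : |B * Real.exp (-v) - 1| ≤ δ)
    (hw : w ≤ η + (u - v)) : Real.exp w * B ≤ Real.exp η * ((1 + δ) / (1 - δ)) * A := by
  have hδ0 : 0 ≤ δ := (abs_nonneg _).trans hA
  have hδ1 : 0 < 1 - δ := sub_pos.2 hδ
  rw [Real.exp_neg, ← div_eq_mul_inv, abs_le] at hA hB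
  have hAu : (1 - δ) * Real.exp u ≤ A := by
    rw [← le_div_iff₀ (Real.exp_pos u)]
    linarith [hA.1]
  have hBv : B ≤ (1 + δ) * Real.exp v := by
    rw [← div_le_iff₀ (Real.exp_pos v)]
    linarith [hB.2]
  calc Real.exp w * B ≤ Real.exp w * ((1 + δ) * Real.exp v) := by gcongr
    _ ≤ Real.exp (η + (u - v)) * ((1 + δ) * Real.exp v) := by gcongr
    _ = Real.exp η * ((1 + δ) / (1 - δ)) * ((1 - δ) * Real.exp u) := by
        rw [Real.exp_add, Real.exp_sub]
        field_simp
    _ ≤ _ := by gcongr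

section Bounds

variable {n a : ℕ} {K : ℝ}

theorem labelRatio_pos {k m : ℕ} (hn : 1 ≤ n) (hk : k ≤ n) (hm : m ≤ n) (ha : 4 * n ≤ a)
    (hK1 : 1 ≤ K) (hK : (n : ℝ) ^ 5 ≤ K * a ^ 4)
    (hδ : Real.exp (5 * K) * (7 * K * (n / a)) < 1) : 0 < labelRatio a k m := by
  have hclose := abs_labelRatio_mul_exp_sub_one_le hn hk hm (by exact_mod_cast ha) hK1 hK
  refine pos_of_mul_pos_left ?_ (Real.exp_pos (-ratioExponent a k m)).le
  linarith [(abs_le.1 hclose).1]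

theorem exp_peakExponent_mul_labelRatio_le {k : ℕ} (hn : 1 ≤ n) (hk : k ≤ n) (ha : 4 * n ≤ a)
    (hK1 : 1 ≤ K) (hK : (n : ℝ) ^ 5 ≤ K * a ^ 4)
    (hδ : Real.exp (5 * K) * (7 * K * (n / a)) < 1) (σ : Equiv.Perm (Fin n)) :
    Real.exp (peakExponent a (k / n) σ) * labelRatio a k (k - 1) ≤
      comparisonFactor K (n / a) * labelRatio a n (n - 1 - 2 * peaks σ) := by
  have ha0 : (0 : ℝ) < a := by exact_mod_cast (by omega : 0 < a)
  have ha4 : (4 * n : ℝ) ≤ a := by exact_mod_cast ha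
  have hexp := abs_le.1 (abs_ratioExponent_sub_sub_peakExponent_le hn hk ha0 σ)
  exact exp_mul_le_of_abs_mul_exp_neg_sub_one_le hδ
    (abs_labelRatio_mul_exp_sub_one_le hn le_rfl (by omega) ha4 hK1 hK)
    (abs_labelRatio_mul_exp_sub_one_le hn hk (by omega) ha4 hK1 hK) (by linarith [hexp.1])

theorem labelRatio_le_mul_exp_peakExponent {k : ℕ} (hn : 1 ≤ n) (hk : k ≤ n) (ha : 4 * n ≤ a)
    (hK1 : 1 ≤ K) (hK : (n : ℝ) ^ 5 ≤ K * a ^ 4)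
    (hδ : Real.exp (5 * K) * (7 * K * (n / a)) < 1) (σ : Equiv.Perm (Fin n)) :
    labelRatio a n (n - 1 - 2 * peaks σ) ≤
      comparisonFactor K (n / a) * labelRatio a k (k - 1) *
        Real.exp (peakExponent a (k / n) σ) := by
  have ha0 : (0 : ℝ) < a := by exact_mod_cast (by omega : 0 < a)
  have ha4 : (4 * n : ℝ) ≤ a := by exact_mod_cast ha
  have hexp := abs_le.1 (abs_ratioExponent_sub_sub_peakExponent_le hn hk ha0 σ)
  rw [← div_le_iff₀ (Real.exp_pos _), div_eq_inv_mul, ← Real.exp_neg]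
  exact exp_mul_le_of_abs_mul_exp_neg_sub_one_le hδ
    (abs_labelRatio_mul_exp_sub_one_le hn hk (by omega) ha4 hK1 hK)
    (abs_labelRatio_mul_exp_sub_one_le hn le_rfl (by omega) ha4 hK1 hK) (by linarith [hexp.2])

theorem one_add_pow_le_exp (n : ℕ) {a : ℝ} (ha : 0 < a) :
    (1 + (1 / (2 * a) + n / (2 * a) ^ 2)) ^ n ≤ Real.exp (n / a / 2 + (n / a) ^ 2 / 4) := by
  calc (1 + (1 / (2 * a) + n / (2 * a) ^ 2)) ^ n
      ≤ Real.exp (1 / (2 * a) + n / (2 * a) ^ 2) ^ n := by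
        gcongr
        rw [add_comm]
        exact Real.add_one_le_exp _
    _ = Real.exp (n / a / 2 + (n / a) ^ 2 / 4) := by
        rw [← Real.exp_nat_mul]
        congr 1
        ring

theorem integral_exp_peakExponent_le (hn : 1 ≤ n) (ha : 4 * n ≤ a) (hK1 : 1 ≤ K)
    (hK : (n : ℝ) ^ 5 ≤ K * a ^ 4) (hδ : Real.exp (5 * K) * (7 * K * (n / a)) < 1)
    (τ : Equiv.Perm (Fin n)) :
    ∫ σ, Real.exp (peakExponent a (numFixedPoints τ / n) σ)
        ∂uniformOn (ConjClasses.mk τ).carrier ≤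
      comparisonFactor K (n / a) * Real.exp (n / a / 2 + (n / a) ^ 2 / 4) := by
  have hk := numFixedPoints_le τ
  have ha0 : (0 : ℝ) < a := by exact_mod_cast (by omega : 0 < a)
  have hR := labelRatio_pos (k := numFixedPoints τ) (m := numFixedPoints τ - 1) hn hk (by omega)
    ha hK1 hK hδ
  have hc := comparisonFactor_pos (x := n / a) (zero_le_one.trans hK1) (by positivity) hδ
  refine le_of_mul_le_mul_right ?_ hR
  rw [← integral_mul_const]
  calc _ ≤ ∫ σ, comparisonFactor K (n / a) * labelRatio a n (n - 1 - 2 * peaks σ)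
          ∂uniformOn (ConjClasses.mk τ).carrier :=
        integral_mono Integrable.of_finite Integrable.of_finite
          (exp_peakExponent_mul_labelRatio_le hn hk ha hK1 hK hδ)
    _ ≤ comparisonFactor K (n / a) * (Real.exp (n / a / 2 + (n / a) ^ 2 / 4) *
          labelRatio a (numFixedPoints τ) (numFixedPoints τ - 1)) := by
        rw [integral_const_mul, integral_uniformOn_carrier_mk]
        gcongr
        refine (expect_labelRatio_le (by omega) (by omega) τ).trans ?_
        gcongr
        exact one_add_pow_le_exp n ha0
    _ = _ := (mul_assoc _ _ _).symm

theorem le_integral_exp_peakExponent (hn : 1 ≤ n) (ha : 4 * n ≤ a) (hK1 : 1 ≤ K)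
    (hK : (n : ℝ) ^ 5 ≤ K * a ^ 4) (hδ : Real.exp (5 * K) * (7 * K * (n / a)) < 1)
    (τ : Equiv.Perm (Fin n)) :
    (1 - (n / a / 2 + (n / a) ^ 2 / 4)) / comparisonFactor K (n / a) ≤
      ∫ σ, Real.exp (peakExponent a (numFixedPoints τ / n) σ)
        ∂uniformOn (ConjClasses.mk τ).carrier := by
  have hk := numFixedPoints_le τ
  have hR := labelRatio_pos (k := numFixedPoints τ) (m := numFixedPoints τ - 1) hn hk (by omega)
    ha hK1 hK hδ
  have hc := comparisonFactor_pos (x := n / a) (zero_le_one.trans hK1) (by positivity) hδ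
  rw [div_le_iff₀ hc]
  refine le_of_mul_le_mul_right ?_ hR
  calc (1 - (n / a / 2 + (n / a) ^ 2 / 4)) *
        labelRatio a (numFixedPoints τ) (numFixedPoints τ - 1)
      = (1 - n * (1 / (2 * a) + n / (2 * a) ^ 2)) *
        labelRatio a (numFixedPoints τ) (numFixedPoints τ - 1) := by ring
    _ ≤ ∫ σ, labelRatio a n (n - 1 - 2 * peaks σ) ∂uniformOn (ConjClasses.mk τ).carrier := by
        rw [integral_uniformOn_carrier_mk]
        exact le_expect_labelRatio (by omega) (by omega) τ
    _ ≤ ∫ σ, comparisonFactor K (n / a) * labelRatio a (numFixedPoints τ) (numFixedPoints τ - 1) *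
          Real.exp (peakExponent a (numFixedPoints τ / n) σ)
          ∂uniformOn (ConjClasses.mk τ).carrier :=
        integral_mono Integrable.of_finite Integrable.of_finite
          (labelRatio_le_mul_exp_peakExponent hn hk ha hK1 hK hδ)
    _ = _ := by
        rw [integral_const_mul]
        ring

end Bounds

section Limit

theorem exists_natCast_sq_tendsto {ι : Type*} {l : Filter ι} {y : ι → ℝ} (hy : Tendsto y l atTop)
    {t : ℝ} (ht : 0 < t) : ∃ a : ι → ℕ, Tendsto (fun i => y i / (a i : ℝ) ^ 2) l (𝓝 t) := by
  have hsqrt : Tendsto (fun i => √(y i / t)) l atTop :=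
    Real.tendsto_sqrt_atTop.comp (hy.atTop_div_const ht)
  refine ⟨fun i => ⌈√(y i / t)⌉₊, ?_⟩
  have hceil : Tendsto (fun i => (((⌈√(y i / t)⌉₊ : ℝ) / √(y i / t)) ^ 2)⁻¹) l (𝓝 1) := by
    simpa using (((tendsto_nat_ceil_div_atTop (R := ℝ)).comp hsqrt).pow 2).inv₀ (by norm_num)
  rw [← mul_one t]
  refine (hceil.const_mul t).congr' ?_
  filter_upwards [hy.eventually_gt_atTop 0] with i hi
  rw [div_pow, inv_div, Real.sq_sqrt (by positivity)]
  field_simp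

theorem exists_tendsto_laplacePoint {θ : ℝ} (hθ : θ < 0) :
    ∃ a : ℕ → ℕ, Tendsto (fun n => laplacePoint n (a n)) atTop (𝓝 θ) := by
  have hy : Tendsto (fun n : ℕ => (n : ℝ) ^ 2 * √n / 4) atTop atTop :=
    (((tendsto_pow_atTop two_ne_zero).atTop_mul_atTop₀ Real.tendsto_sqrt_atTop).comp
      tendsto_natCast_atTop_atTop).atTop_div_const (by norm_num)
  obtain ⟨a, ha⟩ := exists_natCast_sq_tendsto hy (neg_pos.2 hθ)
  refine ⟨a, ?_⟩
  simpa only [laplacePoint, div_div, neg_neg] using ha.neg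

variable {a : ℕ → ℕ} {θ : ℝ}

theorem tendsto_div_of_tendsto_laplacePoint
    (h : Tendsto (fun n => laplacePoint n (a n)) atTop (𝓝 θ)) :
    Tendsto (fun n : ℕ => (n : ℝ) / a n) atTop (𝓝 0) := by
  have hsqrt : Tendsto (fun n : ℕ => √(n : ℝ)) atTop atTop :=
    Real.tendsto_sqrt_atTop.comp tendsto_natCast_atTop_atTop
  have hsq : Tendsto (fun n : ℕ => ((n : ℝ) / a n) ^ 2) atTop (𝓝 0) := by
    simpa only [div_sq_eq_laplacePoint] using (h.const_mul (-4)).div_atTop hsqrt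
  simpa only [Real.sqrt_zero, Real.sqrt_sq, div_nonneg, Nat.cast_nonneg] using hsq.sqrt

theorem eventually_scale_of_tendsto_laplacePoint (hθ : θ < 0)
    (h : Tendsto (fun n => laplacePoint n (a n)) atTop (𝓝 θ)) {K : ℝ} (hK : 16 * θ ^ 2 < K) :
    ∀ᶠ n in atTop, 1 ≤ n ∧ 4 * n ≤ a n ∧ (n : ℝ) ^ 5 ≤ K * (a n : ℝ) ^ 4 := by
  filter_upwards [eventually_ge_atTop 1, h.eventually_lt_const hθ,
    ((h.pow 2).const_mul 16).eventually_lt_const hK,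
    (tendsto_div_of_tendsto_laplacePoint h).eventually_lt_const (by norm_num : (0 : ℝ) < 1 / 4)]
    with n hn hneg hpow hdiv
  have ha : (0 : ℝ) < a n := by
    refine Nat.cast_pos.2 (Nat.pos_of_ne_zero fun h0 => hneg.ne ?_)
    simp [laplacePoint, h0]
  rw [← pow_five_div_pow_four_eq, div_lt_iff₀ (by positivity)] at hpow
  rw [div_lt_div_iff₀ ha (by norm_num)] at hdiv
  refine ⟨hn, ?_, hpow.le⟩
  exact_mod_cast (by linarith : (4 * n : ℝ) ≤ a n)

theorem tendsto_integral_exp_peakExponent (τ : ∀ n, Equiv.Perm (Fin n)) (hθ : θ < 0)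
    (h : Tendsto (fun n => laplacePoint n (a n)) atTop (𝓝 θ)) :
    Tendsto (fun n => ∫ σ, Real.exp (peakExponent (a n) (numFixedPoints (τ n) / n) σ)
      ∂uniformOn (ConjClasses.mk (τ n)).carrier) atTop (𝓝 1) := by
  have hx := tendsto_div_of_tendsto_laplacePoint h
  obtain ⟨K, hmax⟩ := exists_gt (max 1 (16 * θ ^ 2))
  obtain ⟨hK1, hK⟩ := max_lt_iff.1 hmax
  have hfactor := (tendsto_comparisonFactor K).comp hx
  have hδ : Tendsto (fun n : ℕ => Real.exp (5 * K) * (7 * K * (n / a n))) atTop (𝓝 0) := by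
    simpa only [mul_zero] using (hx.const_mul (7 * K)).const_mul (Real.exp (5 * K))
  have herror : Tendsto (fun n : ℕ => (n : ℝ) / a n / 2 + ((n : ℝ) / a n) ^ 2 / 4) atTop
      (𝓝 0) := by
    simpa using (hx.div_const 2).add ((hx.pow 2).div_const 4)
  have hlower := (herror.const_sub 1).div hfactor one_ne_zero
  have hupper := hfactor.mul herror.rexp
  rw [sub_zero, div_one] at hlower
  rw [Real.exp_zero, mul_one] at hupper
  have hscale := (eventually_scale_of_tendsto_laplacePoint hθ h hK).and
    (hδ.eventually_lt_const one_pos)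
  exact tendsto_of_tendsto_of_tendsto_of_le_of_le' hlower hupper
    (hscale.mono fun n ⟨⟨hn, ha, hna⟩, hδ⟩ =>
      le_integral_exp_peakExponent hn ha hK1.le hna hδ (τ n))
    (hscale.mono fun n ⟨⟨hn, ha, hna⟩, hδ⟩ =>
      integral_exp_peakExponent_le hn ha hK1.le hna hδ (τ n))

end Limit

end LaplaceTransform

section CentralLimit

open scoped Topology

theorem abs_tiltCoeff_sub_le_normalizedPeaks {n : ℕ} (hn : 1 ≤ n) {A : ℝ}
    (hA : (1 + 2 * A ^ 3) / 3 ∈ Set.Icc (0 : ℝ) 1) (σ : Equiv.Perm (Fin n)) :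
    |tiltCoeff A (1 - 2 * peaks σ / n) - tiltCoeff A ((1 + 2 * A ^ 3) / 3)| ≤
      1 / √n * |normalizedPeaks A σ| := by
  have hn0 : (0 : ℝ) < n := by exact_mod_cast hn
  have hcentre : 1 - 2 * (peaks σ : ℝ) / n - (1 + 2 * A ^ 3) / 3 =
      -(2 / √n) * normalizedPeaks A σ := by
    rw [normalizedPeaks, neg_mul, div_mul_div_comm, Real.mul_self_sqrt hn0.le]
    field_simp
    ring
  refine (abs_tiltCoeff_sub_le (one_sub_two_mul_peaks_div_mem hn σ) hA).trans_eq ?_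
  rw [hcentre, abs_mul, abs_neg, abs_of_nonneg (by positivity)]
  ring

theorem peakVariance_mul_sq_div_two (α θ : ℝ) :
    peakVariance α * θ ^ 2 / 2 = -(16 * θ ^ 2 * tiltCoeff α ((1 + 2 * α ^ 3) / 3)) := by
  unfold peakVariance tiltCoeff
  ring

theorem tendsto_mgf_normalizedPeaks (τ : ∀ n, Equiv.Perm (Fin n)) {α : ℝ}
    (hτ : Tendsto (fun n => (numFixedPoints (τ n) : ℝ) / n) atTop (𝓝 α)) {θ : ℝ} (hθ : θ < 0) :
    ∃ s : ℕ → ℝ, Tendsto s atTop (𝓝 θ) ∧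
      Tendsto (fun n => mgf (normalizedPeaks (numFixedPoints (τ n) / n))
        (uniformOn (ConjClasses.mk (τ n)).carrier) (s n)) atTop
        (𝓝 (Real.exp (peakVariance α * θ ^ 2 / 2))) := by
  have hmem (n : ℕ) : (1 + 2 * ((numFixedPoints (τ n) : ℝ) / n) ^ 3) / 3 ∈ Set.Icc (0 : ℝ) 1 := by
    obtain ⟨h0, h1⟩ := numFixedPoints_div_mem (τ n)
    have hpow0 := pow_nonneg h0 3
    have hpow1 := pow_le_one₀ h0 h1 (n := 3)
    constructor <;> linarith
  have hcont : Continuous fun A : ℝ => tiltCoeff A ((1 + 2 * A ^ 3) / 3) := by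
    unfold tiltCoeff
    fun_prop
  rw [peakVariance_mul_sq_div_two]
  refine tendsto_mgf_of_tilt (C := fun θ => 16 * θ ^ 2) (ε := fun n => 1 / √n)
    (q := fun n σ => tiltCoeff (numFixedPoints (τ n) / n) (1 - 2 * peaks σ / n))
    (fun n => by positivity) ?_ ((hcont.tendsto α).comp hτ) ?_
    (.of_forall fun n => abs_tiltCoeff_le_one (numFixedPoints_div_mem _) (hmem n)) ?_
    (fun θ hθ => ?_) hθ
  · exact (Real.tendsto_sqrt_atTop.comp tendsto_natCast_atTop_atTop).const_div_atTop 1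
  · filter_upwards [eventually_ge_atTop 1] with n hn σ
    exact abs_tiltCoeff_le_one (numFixedPoints_div_mem _) (one_sub_two_mul_peaks_div_mem hn σ)
  · filter_upwards [eventually_ge_atTop 1] with n hn
    exact abs_tiltCoeff_sub_le_normalizedPeaks hn (hmem n)
  · obtain ⟨a, ha⟩ := exists_tendsto_laplacePoint hθ
    exact ⟨_, _, ha, (ha.pow 2).const_mul 16, tendsto_integral_exp_peakExponent τ hθ ha⟩

theorem tendstoInDistribution_normalizedPeaks (τ : ∀ n, Equiv.Perm (Fin n)) {α : ℝ}
    (hα : α ∈ Set.Icc (0 : ℝ) 1)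
    (hτ : Tendsto (fun n => (numFixedPoints (τ n) : ℝ) / n) atTop (𝓝 α)) :
    TendstoInDistribution (fun n => normalizedPeaks (numFixedPoints (τ n) / n)) atTop
      (id : ℝ → ℝ) (fun n => uniformOn (ConjClasses.mk (τ n)).carrier)
      (gaussianReal 0 (peakVarianceNN α hα)) where
  forall_aemeasurable n := (measurable_of_finite _).aemeasurable
  tendsto := by
    refine tendsto_of_tendsto_mgf_perturbed (fun n θ _ => ?_) (fun θ _ => ?_) fun θ hθ => ?_
    · exact (integrable_map_measure (by fun_prop) (measurable_of_finite _).aemeasurable).2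
        Integrable.of_finite
    · simpa [integrableExpSet] using integrable_exp_mul_gaussianReal θ
    · obtain ⟨s, hs, h⟩ := tendsto_mgf_normalizedPeaks τ hτ hθ
      refine ⟨s, hs, ?_⟩
      have hgaussian : mgf id (gaussianReal 0 (peakVarianceNN α hα)) θ =
          Real.exp (peakVariance α * θ ^ 2 / 2) := by
        simp only [mgf_id_gaussianReal, zero_mul, zero_add]
        rfl
      simpa [mgf_id_map, (measurable_of_finite _).aemeasurable, hgaussian] using h

theorem tendstoInDistribution_comp_of_hasLaw {ι E : Type*} {l : Filter ι} {S Ω : ι → Type*}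
    {Ω' : Type*} [TopologicalSpace E] [MeasurableSpace E] [OpensMeasurableSpace E]
    [∀ i, MeasurableSpace (S i)] [∀ i, MeasurableSpace (Ω i)] [MeasurableSpace Ω']
    {μ : ∀ i, Measure (S i)} [∀ i, IsProbabilityMeasure (μ i)] {P : ∀ i, Measure (Ω i)}
    [∀ i, IsProbabilityMeasure (P i)] {ν : Measure Ω'} [IsProbabilityMeasure ν]
    {X : ∀ i, Ω i → S i} {f : ∀ i, S i → E} {Z : Ω' → E} (hX : ∀ i, HasLaw (X i) (μ i) (P i))
    (h : TendstoInDistribution f l Z μ ν) :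
    TendstoInDistribution (fun i ω => f i (X i ω)) l Z P ν where
  forall_aemeasurable i := by
    have hf := h.forall_aemeasurable i
    rw [← (hX i).map_eq] at hf
    exact hf.comp_aemeasurable (hX i).aemeasurable
  aemeasurable_limit := h.aemeasurable_limit
  tendsto := by
    refine h.tendsto.congr fun i => Subtype.ext ?_
    have hf := h.forall_aemeasurable i
    rw [← (hX i).map_eq] at hf
    change (μ i).map (f i) = (P i).map (f i ∘ X i)
    rw [← AEMeasurable.map_map_of_aemeasurable hf (hX i).aemeasurable, (hX i).map_eq]

end CentralLimit

theorem theorem1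
    (C : ∀ n : ℕ, ConjClasses (Equiv.Perm (Fin n)))
    (α : ℝ) (hα : α ∈ Set.Icc (0 : ℝ) 1)
    (hC : Tendsto (fun n => fixedPointDensity (C n)) atTop (nhds α))
    {Ω : ℕ → Type*} [∀ n, MeasurableSpace (Ω n)]
    (P : ∀ n, Measure (Ω n)) [∀ n, IsProbabilityMeasure (P n)]
    (π : ∀ n, Ω n → Equiv.Perm (Fin n))
    (hπ : ∀ n, HasLaw (π n) (uniformOn (C n).carrier) (P n)) :
    TendstoInDistribution
      (fun (n : ℕ) (ω : Ω n) =>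
        ((peaks (π n ω) : ℝ) - (1 - fixedPointDensity (C n) ^ 3) / 3 * n) / Real.sqrt n)
      atTop (id : ℝ → ℝ) P
      (gaussianReal 0 (peakVarianceNN α hα)) := by
  choose τ hτ using fun n => ConjClasses.exists_rep (C n)
  obtain rfl : (fun n => ConjClasses.mk (τ n)) = C := funext hτ
  exact tendstoInDistribution_comp_of_hasLaw hπ (tendstoInDistribution_normalizedPeaks τ hα hC)
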